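/- Let $d\ge 1$ and let $f=p\circ\exp$ with $p$ a monic complex polynomial of degree $d$. Let $I(f)=\{z: f^n(z)\to\infty\}$, let $F(t)=e^{dt}-1$, and let $S(f)$ be the set of (finite) singular values of $f$, i.e. the closure of the set of its critical and finite asymptotic values. A *ray tail* of $f$ is a curve $\gamma:[0,\infty)\to I(f)$ (continuous) such that each $f^n\circ\gamma$, $n\ge 0$, is injective with $f^n(\gamma(t))\to\infty$ as $t\to\infty$, and $f^n(\gamma(t))\to\infty$ as $n\to\infty$ uniformly in $t$. A *dynamic ray* is an injective curve $\gamma:(0,\infty)\to I(f)$ whose restrictions to $[t,\infty)$, $t>0$, are all ray tails, and which is maximal: up to an orientation-preserving change of parameter it is not the restriction to some $(b,\infty)$, $b>0$, of another such curve. If $z=\lim_{t\to0}\gamma(t)$ exists, $z$ is the *endpoint* of $\gamma$. Fix $r\in\mathbb R$ such that $\mathbb H_r=\{\operatorname{Re}z>r\}$ contains no singular value of $f$. For $n\in\mathbb Z$ let $T_n$ be the connected component of $f^{-1}(\mathbb H_r)$ that contains $t+2\pi i n/d$ for all large real $t$. A dynamic ray $\gamma$ has *external address* $\underline s=(s_0s_1s_2\dots)\in\mathbb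 Z^{\mathbb N}$ if for every $n\ge0$ one has $f^n(\gamma(t))\in T_{s_n}$ for all large $t$. An address $\underline s$ is *exponentially bounded* if $s_n/F^n(t)\to0$ for some $t>0$; the infimum of such $t$ is denoted $t_{\underline s}$. Let $\sigma$ be the shift on addresses. 1. For every exponentially bounded external address $\underline s$ there is a dynamic ray with external address $\underline s$. 2. Let $\mathcal R_{\underline s}$ be a dynamic ray with exponentially bounded external address $\underline s$, and suppose that no strict forward iterate of $\mathcal R_{\underline s}$ contains a singular value, in the sense that for no $n\ge1$ a dynamic ray extending $f^n(\mathcal R_{\underline s})$ contains a point of $S(f)$. Then $\mathcal R_{\underline s}$ is the unique dynamic ray with external address $\underline s$ (up to change of parameter). For every $n\ge 0$ there is also exactly one dynamic ray $\mathcal R_{\sigma^n\underline s}$ with external address $\sigma^n\underline s$, and these rays can be parametrized by $t\in(t_{\sigma^n\underline s},\infty)$ in such a way that $$\mathcal R_{\underline s}(t)=t+\frac{2\pi i s_0}{d}+O(e^{-t/2})\quad(t\to\infty),\qquad f^n\circ\mathcal R_{\underline s}=\mathcal R_{\sigma^n\underline s}\circ F^n\ \text{ on }(t_{\underline s},\infty)\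 \text{ for all } n\ge0,$$ and the asymptotic bounds are uniform in $n$ on every ray tail contained in $\mathcal R_{\underline s}$: for every $t'>t_{\underline s}$ there is $C$ such that for all $n\ge0$ and all $u\ge F^n(t')$ $$\Bigl|\mathcal R_{\sigma^n\underline s}(u)-u-\frac{2\pi i s_n}{d}\Bigr|\le C e^{-u/2}.$$ 3. If $S(f)\cap I(f)=\emptyset$, then $I(f)$ is the disjoint union of the dynamic rays and their escaping endpoints: every escaping point lies on a dynamic ray or is the endpoint of one, any two dynamic rays coincide (as point sets) or are disjoint, and no endpoint that escapes lies on a dynamic ray. -/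

import Mathlib

open Filter Topology Set

noncomputable section

namespace PolyExp

/-- The family `N_d` of the functions `p ∘ exp`, `p` a monic complex polynomial of degree `d`. -/
def Family (d : ℕ) : Set (ℂ → ℂ) :=
  {f | ∃ p : Polynomial ℂ, p.Monic ∧ p.natDegree = d ∧ f = fun z => p.eval (Complex.exp z)}

/-- The escaping set `I(f)`. -/
def escapingSet (f : ℂ → ℂ) : Set ℂ :=
  {z | Tendsto (fun n : ℕ => f^[n] z) atTop (Bornology.cobounded ℂ)}

/-- Critical values. -/
def criticalValues (f : ℂ → ℂ) : Set ℂ :=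
  {v | ∃ c : ℂ, deriv f c = 0 ∧ f c = v}

/-- Finite asymptotic values: limits of `f` along curves tending to infinity. -/
def asymptoticValues (f : ℂ → ℂ) : Set ℂ :=
  {a | ∃ γ : ℝ → ℂ, ContinuousOn γ (Ici 0) ∧ Tendsto γ atTop (Bornology.cobounded ℂ) ∧
    Tendsto (fun t => f (γ t)) atTop (𝓝 a)}

/-- The (finite) singular values: the closure of the set of critical and asymptotic values. -/
def singularValues (f : ℂ → ℂ) : Set ℂ :=
  closure (criticalValues f ∪ asymptoticValues f)

/-- The right half-plane `H_r`. -/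
def rightHalfPlane (r : ℝ) : Set ℂ := {z | r < z.re}

/-- The point `t + 2πin/d`. -/
def stripPoint (d : ℕ) (n : ℤ) (t : ℝ) : ℂ :=
  (t : ℂ) + 2 * (Real.pi : ℂ) * Complex.I * (n : ℂ) / (d : ℂ)

/-- The tract `T_n`: the connected component of `f⁻¹(H_r)` that contains the points
`t + 2πin/d` for all large real `t`. -/
def tract (f : ℂ → ℂ) (d : ℕ) (r : ℝ) (n : ℤ) : Set ℂ :=
  {z | ∀ᶠ t : ℝ in atTop,
    z ∈ connectedComponentIn (f ⁻¹' rightHalfPlane r) (stripPoint d n t)}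

/-- The restriction of `γ` to `[a, ∞)` is a ray tail of `f`. -/
structure IsRayTail (f : ℂ → ℂ) (γ : ℝ → ℂ) (a : ℝ) : Prop where
  continuousOn : ContinuousOn γ (Ici a)
  mapsTo : MapsTo γ (Ici a) (escapingSet f)
  injOn_iterate : ∀ n : ℕ, InjOn (fun t => f^[n] (γ t)) (Ici a)
  tendsto_iterate : ∀ n : ℕ, Tendsto (fun t => f^[n] (γ t)) atTop (Bornology.cobounded ℂ)
  uniform_escape : ∀ M : ℝ, ∀ᶠ n : ℕ in atTop, ∀ t ∈ Ici a, M ≤ ‖f^[n] (γ t)‖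

/-- `γ : (0, ∞) → I(f)` is an injective curve all of whose restrictions to `[t, ∞)`, `t > 0`,
are ray tails (no maximality). Only the values of `γ` on `(0, ∞)` matter. -/
structure IsRayCurve (f : ℂ → ℂ) (γ : ℝ → ℂ) : Prop where
  mapsTo : MapsTo γ (Ioi 0) (escapingSet f)
  injOn : InjOn γ (Ioi 0)
  rayTail : ∀ t : ℝ, 0 < t → IsRayTail f γ t

/-- The curve `γ` on `(a, ∞)` and the curve `δ` on `(b, ∞)` are the same up to an
orientation-preserving homeomorphic change of parameter `h : (a, ∞) → (b, ∞)`. -/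
def SameCurve (γ : ℝ → ℂ) (a : ℝ) (δ : ℝ → ℂ) (b : ℝ) : Prop :=
  ∃ h : ℝ → ℝ, ContinuousOn h (Ioi a) ∧ StrictMonoOn h (Ioi a) ∧ h '' Ioi a = Ioi b ∧
    ∀ t ∈ Ioi a, γ t = δ (h t)

/-- A curve `δ` on `(0, ∞)` extends the curve `γ` on `(0, ∞)`: up to change of parameter `γ` is
the restriction of `δ` to some `(b, ∞)`, `b ≥ 0`. -/
def Extends (δ γ : ℝ → ℂ) : Prop :=
  ∃ b : ℝ, 0 ≤ b ∧ SameCurve γ 0 δ b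

/-- Dynamic rays: curves as in `IsRayCurve` that are maximal, that is, admit no proper
extension to a longer curve of this kind. -/
structure IsDynamicRay (f : ℂ → ℂ) (γ : ℝ → ℂ) : Prop where
  isRayCurve : IsRayCurve f γ
  maximal : ∀ δ : ℝ → ℂ, IsRayCurve f δ → ∀ b : ℝ, 0 ≤ b → SameCurve γ 0 δ b → b = 0

/-- The point set of a ray. -/
def trace (γ : ℝ → ℂ) : Set ℂ := γ '' Ioi 0

/-- `z` is the endpoint of the ray `γ`. -/
def IsEndpoint (γ : ℝ → ℂ) (z : ℂ) : Prop := Tendsto γ (𝓝[>] 0) (𝓝 z)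

/-- The ray `γ` has external address `s`: near infinity its `n`-th iterate lies in `T_{s n}`. -/
def HasAddress (f : ℂ → ℂ) (d : ℕ) (r : ℝ) (γ : ℝ → ℂ) (s : ℕ → ℤ) : Prop :=
  ∀ n : ℕ, ∀ᶠ t : ℝ in atTop, f^[n] (γ t) ∈ tract f d r (s n)

/-- The `n`-th iterate `σ^n` of the shift. -/
def shift (n : ℕ) (s : ℕ → ℤ) : ℕ → ℤ := fun k => s (n + k)

/-- `F(t) = exp(dt) - 1`. -/
def F (d : ℕ) (t : ℝ) : ℝ := Real.exp (d * t) - 1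

/-- The numbers `t > 0` with `s_n / F^n(t) → 0`. -/
def boundSet (d : ℕ) (s : ℕ → ℤ) : Set ℝ :=
  {t | 0 < t ∧ Tendsto (fun n : ℕ => (s n : ℝ) / (F d)^[n] t) atTop (𝓝 0)}

/-- Exponentially bounded external addresses. -/
def ExpBounded (d : ℕ) (s : ℕ → ℤ) : Prop := (boundSet d s).Nonempty

/-- The number `t_s` of an exponentially bounded address. -/
def minPotential (d : ℕ) (s : ℕ → ℤ) : ℝ := sInf (boundSet d s)

/-- No strict forward iterate of the ray `γ` contains a singular value; as for the rays
themselves, the `n`-th iterate of `γ` is understood as the full dynamic ray through `f^n ∘ γ`. -/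
def IteratesAvoidSingularValues (f : ℂ → ℂ) (γ : ℝ → ℂ) : Prop :=
  ∀ n : ℕ, 1 ≤ n → ∀ δ : ℝ → ℂ, IsDynamicRay f δ → Extends δ (fun t => f^[n] (γ t)) →
    Disjoint (trace δ) (singularValues f)

/-- The points that escape on rays. -/
def onRays (f : ℂ → ℂ) : Set ℂ := {z | ∃ γ, IsDynamicRay f γ ∧ z ∈ trace γ}

/-- The escaping endpoints of dynamic rays. -/
def escapingEndpoints (f : ℂ → ℂ) : Set ℂ :=
  {z | z ∈ escapingSet f ∧ ∃ γ, IsDynamicRay f γ ∧ IsEndpoint γ z}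

end PolyExp

end

/-!
Everything rests on one coordinate. On a half-plane `{Re z ≥ R}` the map `Φ = (1/d) log f` is a small
perturbation of the identity, so `f = exp (d Φ)` behaves there like `z ↦ exp (d z)`
(`exists_isLarge`). The strips `|Im Φ - 2πn/d| ≤ π/(2d)` encode the position of an orbit that stays
far to the right by an address, and the set `tailSet` of points whose orbit stays in `{Re z ≥ R}`
and has the address `s` carries the whole argument.

*Potentials.* A point has potential `t` if its orbit grows like `F^n(t)`. Every point of `tailSet` has
a potential. If one of two points with the same address has a head start of size one in real part,
then the head start explodes, so its potential is larger (`tailSet.pot_lt`). Hence two points with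
the same address and potential have orbits at bounded distance, and coincide because `f` expands in
the strips (`tailSet.eq_of_pot`). Conversely, an address and a potential `u` such that `F^k(u)`
dominates `|s_k|` are realised by an orbit that follows the model points `F^k(u) + 2πi s_k/d`
(`IsStd.exists_mem_tailSet`), and every potential above a realised one is realised, by pulling back
(`tailSet.exists_pot_gt`). The order makes the dependence of the point on its potential continuous,
also at the smallest potential (`tailSet.tendsto_of_pot`).

*Rays.* Consequently every ray can be parametrized by potential in exactly one way
(`IsRayCurve.exists_isPotRay`, `SameCurve.eq_of_isPotRay`), rays exist for each exponentially bounded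
address, and Zorn's lemma extends them to dynamic rays. Far to the right the tracts are the strips
because `f` is injective on tracts (`eq_of_mem_farStrip_of_mem_tract`), so both notions of address
agree.

*Rays that avoid singular values.* Away from the singular values `p` and `exp`, hence `f`, can be
lifted along curves and `f` is locally injective. Therefore two rays with the same address coincide as
long as their images avoid the singular values (`IsPotRay.eqOn_of_address`), and the image of a maximal
ray is maximal (`IsMaxPotRay.iterate`). Since far iterates of the ray contain all model orbits with
potentials above `F^n(t_s)`, the ray has exactly the potentials `t > t_s`
(`IteratesAvoidSingularValues.exists_rays`). The asymptotics are those of the model orbits.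

*No escaping singular values.* Now every ray has the potentials `t > t_s`. An iterate of an escaping
point `z` lies in `tailSet` and is the limit of a ray; lifting that ray gives a ray that ends at `z` or
passes through it (`escapingSet_eq`). The delicate point is that no ray lands at a point of another (or
the same) ray `δ`. The images of `δ` are close to horizontal half-lines, and since `f` is
`2πi`-periodic their translates by `±2πi` eventually are barriers that the images of the landing ray
cannot cross (`between_barriers`). The landing ray is thus trapped next to `δ` with uniformly large
real parts (`IsPotRay.trapped`). This bounds its potentials from below by a number larger than the
minimal potential of the address of `δ`, and it bounds the difference of both addresses, so that the
two minimal potentials agree: a contradiction (`IsMaxPotRay.not_tendsto`).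
-/

noncomputable section

namespace PolyExp

variable {f : ℂ → ℂ} {d : ℕ} {R r : ℝ} {s s' : ℕ → ℤ} {z w : ℂ} {γ δ : ℝ → ℂ} {a b : ℝ}

/-! ### Iteration of `F` -/

lemma continuous_F (d : ℕ) : Continuous (F d) := by unfold F; fun_prop

lemma F_strictMono (hd : 1 ≤ d) : StrictMono (F d) := by
  intro a b hab
  have : (0 : ℝ) < d := by exact_mod_cast hd
  have := Real.exp_lt_exp.2 (mul_lt_mul_of_pos_left hab this)
  simp only [F]; linarith

lemma F_zero (d : ℕ) : F d 0 = 0 := by simp [F]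

lemma F_iterate_zero (d n : ℕ) : (F d)^[n] 0 = 0 :=
  Function.iterate_fixed (F_zero d) n

lemma F_iterate_strictMono (hd : 1 ≤ d) (n : ℕ) : StrictMono ((F d)^[n]) :=
  (F_strictMono hd).iterate n

lemma F_iterate_nonneg (hd : 1 ≤ d) (n : ℕ) {t : ℝ} (ht : 0 ≤ t) : 0 ≤ (F d)^[n] t := by
  simpa [F_iterate_zero] using (F_iterate_strictMono hd n).monotone ht

lemma F_iterate_pos (hd : 1 ≤ d) (n : ℕ) {t : ℝ} (ht : 0 < t) : 0 < (F d)^[n] t := by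
  simpa [F_iterate_zero] using F_iterate_strictMono hd n ht

lemma add_sq_le_F (hd : 1 ≤ d) {t : ℝ} (ht : 0 ≤ t) : t + t ^ 2 / 2 ≤ F d t := by
  have h1 : (1 : ℝ) ≤ d := by exact_mod_cast hd
  have h2 : t ≤ d * t := by nlinarith
  have h3 := Real.exp_le_exp.2 h2
  have h4 := Real.quadratic_le_exp_of_nonneg ht
  simp only [F]; linarith

lemma le_F (hd : 1 ≤ d) {t : ℝ} (ht : 0 ≤ t) : t ≤ F d t := by
  have := add_sq_le_F hd ht
  nlinarith [sq_nonneg t]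

lemma add_mul_sq_le_F_iterate (hd : 1 ≤ d) {t : ℝ} (ht : 0 ≤ t) (n : ℕ) :
    t + n * (t ^ 2 / 2) ≤ (F d)^[n] t := by
  induction n with
  | zero => simp
  | succ n ih =>
    rw [Function.iterate_succ_apply']
    have h0 : 0 ≤ (F d)^[n] t := F_iterate_nonneg hd n ht
    have h1 := add_sq_le_F hd h0
    have h2 : t ≤ (F d)^[n] t := by
      have : (0 : ℝ) ≤ n * (t ^ 2 / 2) := by positivity
      linarith
    have h3 : t ^ 2 ≤ ((F d)^[n] t) ^ 2 := by gcongr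
    push_cast
    nlinarith

lemma le_F_iterate (hd : 1 ≤ d) {t : ℝ} (ht : 0 ≤ t) (n : ℕ) : t ≤ (F d)^[n] t := by
  have h := add_mul_sq_le_F_iterate hd ht n
  have : (0 : ℝ) ≤ n * (t ^ 2 / 2) := by positivity
  linarith

lemma tendsto_F_iterate (hd : 1 ≤ d) {t : ℝ} (ht : 0 < t) :
    Tendsto (fun n => (F d)^[n] t) atTop atTop := by
  refine tendsto_atTop_mono (fun n => add_mul_sq_le_F_iterate hd ht.le n) ?_
  refine tendsto_atTop_add_const_left _ _ ?_
  exact Tendsto.atTop_mul_const (by positivity) tendsto_natCast_atTop_atTop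

lemma mul_F_le_F_mul {c t : ℝ} (hc : 1 ≤ c) (d : ℕ) : c * F d t ≤ F d (c * t) := by
  have h := one_add_mul_self_le_rpow_one_add (s := Real.exp (d * t) - 1) (p := c)
    (by linarith [Real.exp_pos (d * t)]) hc
  have h2 : (1 + (Real.exp (d * t) - 1)) ^ c = Real.exp (d * (c * t)) := by
    rw [add_sub_cancel, ← Real.exp_mul]; ring_nf
  rw [h2] at h
  simp only [F]; linarith

/-- `F` is superlinear, by Bernoulli's inequality. -/
lemma mul_F_iterate_le (hd : 1 ≤ d) {c t : ℝ} (hc : 1 ≤ c) (n : ℕ) :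
    c * (F d)^[n] t ≤ (F d)^[n] (c * t) := by
  induction n with
  | zero => simp
  | succ n ih =>
    rw [Function.iterate_succ_apply', Function.iterate_succ_apply']
    exact (mul_F_le_F_mul hc d).trans ((F_strictMono hd).monotone ih)

/-- The orbit of a larger potential under `F` eventually exceeds the orbit of a smaller one by any
factor and any constant. -/
lemma eventually_mul_F_iterate_add_le (hd : 1 ≤ d) {t₁ t₂ : ℝ} (h1 : 0 < t₁) (h12 : t₁ < t₂)
    (K : ℝ) : ∀ᶠ n : ℕ in atTop, K * (F d)^[n] t₁ + K ≤ (F d)^[n] t₂ := by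
  have hd' : (1 : ℝ) ≤ d := by exact_mod_cast hd
  set c := t₂ / t₁ with hc
  have hc1 : 1 < c := by rw [hc, lt_div_iff₀ h1]; linarith
  have hct : c * t₁ = t₂ := by rw [hc]; field_simp
  have hx := tendsto_F_iterate hd h1
  have h2 : Tendsto (fun n => (c - 1) * (F d)^[n] t₁) atTop atTop :=
    hx.const_mul_atTop (by linarith)
  rw [← map_add_atTop_eq_nat 1, eventually_map]
  filter_upwards [h2.eventually_ge_atTop K, hx.eventually_ge_atTop 0] with n hn h0
  rw [Function.iterate_succ_apply', Function.iterate_succ_apply']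
  set x := (F d)^[n] t₁
  have h3 : c * x ≤ (F d)^[n] t₂ := by rw [← hct]; exact mul_F_iterate_le hd hc1.le n
  refine le_trans ?_ ((F_strictMono hd).monotone h3)
  have h4 : (d : ℝ) * (c * x) = d * x + d * ((c - 1) * x) := by ring
  have h5 : 0 ≤ (c - 1) * x := mul_nonneg (by linarith) h0
  have h6 : K + 1 ≤ Real.exp (d * ((c - 1) * x)) := by
    have := Real.add_one_le_exp (d * ((c - 1) * x))
    nlinarith
  have h7 : 1 ≤ Real.exp (d * x) := Real.one_le_exp (by positivity)
  simp only [F]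
  rw [h4, Real.exp_add]
  nlinarith

/-- The inverse of `F`. -/
def Finv (d : ℕ) (u : ℝ) : ℝ := Real.log (1 + u) / d

lemma F_Finv (hd : 1 ≤ d) {u : ℝ} (hu : -1 < u) : F d (Finv d u) = u := by
  have : (d : ℝ) ≠ 0 := by positivity
  simp only [F, Finv]
  rw [mul_div_cancel₀ _ this, Real.exp_log (by linarith)]; ring

lemma Finv_F (hd : 1 ≤ d) (t : ℝ) : Finv d (F d t) = t := by
  have : (d : ℝ) ≠ 0 := by positivity
  simp [F, Finv, this]

lemma continuousOn_Finv (d : ℕ) : ContinuousOn (Finv d) (Ioi (-1)) := by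
  unfold Finv
  refine ContinuousOn.div_const (ContinuousOn.log (by fun_prop) ?_) _
  intro x hx
  have : -1 < x := hx
  linarith

lemma Finv_lt_iff (hd : 1 ≤ d) {u t : ℝ} (hu : -1 < u) : Finv d u < t ↔ u < F d t := by
  rw [← (F_strictMono hd).lt_iff_lt, F_Finv hd hu]

lemma lt_Finv_iff (hd : 1 ≤ d) {u t : ℝ} (hu : -1 < u) : t < Finv d u ↔ F d t < u := by
  rw [← (F_strictMono hd).lt_iff_lt, F_Finv hd hu]

lemma exists_F_iterate_eq (hd : 1 ≤ d) (n : ℕ) {u : ℝ} (hu : 0 ≤ u) :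
    ∃ t, 0 ≤ t ∧ (F d)^[n] t = u := by
  induction n generalizing u with
  | zero => exact ⟨u, hu, rfl⟩
  | succ n ih =>
    have h0 : 0 ≤ Finv d u := by
      by_contra! h
      rw [Finv_lt_iff hd (by linarith), F_zero] at h
      linarith
    obtain ⟨t, ht, hte⟩ := ih h0
    exact ⟨t, ht, by rw [Function.iterate_succ_apply', hte, F_Finv hd (by linarith)]⟩

lemma isEmbedding_F_iterate (hd : 1 ≤ d) (n : ℕ) : IsEmbedding ((F d)^[n]) := by
  refine (F_iterate_strictMono hd n).isEmbedding_of_ordConnected ?_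
  exact (isPreconnected_range ((continuous_F d).iterate n)).ordConnected

/-! ### Exponentially bounded addresses -/

lemma shift_zero (s : ℕ → ℤ) : shift 0 s = s := by ext k; simp [shift]

lemma shift_shift (m n : ℕ) (s : ℕ → ℤ) : shift m (shift n s) = shift (n + m) s := by
  ext k; simp [shift, add_assoc]

lemma boundSet_mono (hd : 1 ≤ d) {s : ℕ → ℤ} {t u : ℝ} (ht : t ∈ boundSet d s) (htu : t ≤ u) :
    u ∈ boundSet d s := by
  refine ⟨ht.1.trans_le htu, squeeze_zero_norm (fun n => ?_) (tendsto_zero_iff_norm_tendsto_zero.1 ht.2)⟩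
  have h1 := F_iterate_pos hd n ht.1
  have h2 := (F_iterate_strictMono hd n).monotone htu
  rw [norm_div, norm_div, Real.norm_of_nonneg h1.le, Real.norm_of_nonneg (h1.le.trans h2)]
  gcongr

lemma minPotential_nonneg (d : ℕ) (s : ℕ → ℤ) : 0 ≤ minPotential d s :=
  Real.sInf_nonneg fun _ ht => ht.1.le

lemma mem_boundSet_of_lt (hd : 1 ≤ d) {s : ℕ → ℤ} (hs : ExpBounded d s) {t : ℝ}
    (ht : minPotential d s < t) : t ∈ boundSet d s := by
  obtain ⟨u, hu, hut⟩ := exists_lt_of_csInf_lt hs ht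
  exact boundSet_mono hd hu hut.le

lemma minPotential_le {s : ℕ → ℤ} {t : ℝ} (ht : t ∈ boundSet d s) : minPotential d s ≤ t :=
  csInf_le ⟨0, fun _ h => h.1.le⟩ ht

lemma F_iterate_mem_boundSet_shift (hd : 1 ≤ d) {s : ℕ → ℤ} (n : ℕ) {t : ℝ} :
    0 < t → ((F d)^[n] t ∈ boundSet d (shift n s) ↔ t ∈ boundSet d s) := by
  intro ht
  have h : (fun k : ℕ => (shift n s k : ℝ) / (F d)^[k] ((F d)^[n] t)) =
      fun k => (s (k + n) : ℝ) / (F d)^[k + n] t := by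
    ext k
    rw [Function.iterate_add_apply, shift, add_comm n k]
  simp only [boundSet, mem_ofPred_eq, h, F_iterate_pos hd n ht, ht, true_and]
  exact tendsto_add_atTop_iff_nat (f := fun k => (s k : ℝ) / (F d)^[k] t) n

lemma ExpBounded.shift (hd : 1 ≤ d) {s : ℕ → ℤ} (hs : ExpBounded d s) (n : ℕ) :
    ExpBounded d (shift n s) := by
  obtain ⟨t, ht⟩ := hs
  exact ⟨_, (F_iterate_mem_boundSet_shift hd n ht.1).2 ht⟩

lemma minPotential_shift (hd : 1 ≤ d) {s : ℕ → ℤ} (hs : ExpBounded d s) (n : ℕ) :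
    minPotential d (shift n s) = (F d)^[n] (minPotential d s) := by
  apply le_antisymm
  · by_contra! h
    obtain ⟨t, ht0, ht⟩ := exists_F_iterate_eq hd n (minPotential_nonneg d (PolyExp.shift n s))
    rw [← ht, (F_iterate_strictMono hd n).lt_iff_lt] at h
    obtain ⟨u, hu1, hu2⟩ := exists_between h
    have hu := mem_boundSet_of_lt hd hs hu1
    have h3 := minPotential_le ((F_iterate_mem_boundSet_shift hd n hu.1).2 hu)
    rw [← ht, (F_iterate_strictMono hd n).le_iff_le] at h3
    linarith
  · refine le_csInf (hs.shift hd n) fun u hu => ?_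
    obtain ⟨t, ht0, rfl⟩ := exists_F_iterate_eq hd n hu.1.le
    have ht : 0 < t := by
      rcases ht0.eq_or_lt with h | h
      · exact absurd hu.1 (by rw [← h, F_iterate_zero]; exact lt_irrefl _)
      · exact h
    exact (F_iterate_strictMono hd n).monotone
      (minPotential_le ((F_iterate_mem_boundSet_shift hd n ht).1 hu))

/-- If the entries of an address grow at most like the orbit of `τ`, then all `t > τ` belong to its
bound set. -/
lemma mem_boundSet_of_eventually_le (hd : 1 ≤ d) {s : ℕ → ℤ} {τ t K : ℝ} (hτ : 0 < τ) (ht : τ < t)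
    (h : ∀ᶠ n : ℕ in atTop, |(s n : ℝ)| ≤ K * (F d)^[n] τ + K) : t ∈ boundSet d s := by
  refine ⟨hτ.trans ht, ?_⟩
  rw [Metric.tendsto_nhds]
  intro ε hε
  have h1 := eventually_mul_F_iterate_add_le hd hτ ht (2 * K / ε)
  have h2 := (tendsto_F_iterate hd (hτ.trans ht)).eventually_gt_atTop 0
  filter_upwards [h, h1, h2] with n h h1 h2
  rw [dist_zero_right, norm_div, Real.norm_eq_abs, Real.norm_of_nonneg h2.le, div_lt_iff₀ h2]
  have h3 : 2 * (K * (F d)^[n] τ + K) ≤ ε * (F d)^[n] t := by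
    have := mul_le_mul_of_nonneg_left h1 hε.le
    have e : ε * (2 * K / ε * (F d)^[n] τ + 2 * K / ε) = 2 * (K * (F d)^[n] τ + K) := by
      field_simp
    linarith
  have h4 : 0 < ε * (F d)^[n] t := by positivity
  linarith

/-! ### The logarithmic chart near `+∞` -/

/-- The logarithmic coordinate `Φ(z) = (1/d) log f(z)` on a right half-plane, normalised by
`Φ(z) = z + o(1)` as `Re z → ∞`. The branch is fixed by the principal logarithm of
`f(z) exp (-d z)`, which is close to `1` there; elsewhere the values are meaningless. -/
def chart (f : ℂ → ℂ) (d : ℕ) (z : ℂ) : ℂ :=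
  z + Complex.log (f z * Complex.exp (-(d * z))) / d

/-- `R` is so large that `chart f d` is a small perturbation of the identity, and a logarithm of
`f`, on `{Re z ≥ R}`. All estimates on the dynamics of `f` near infinity are derived from these
properties. -/
structure IsLarge (f : ℂ → ℂ) (d : ℕ) (R : ℝ) : Prop where
  one_le : 1 ≤ d
  big : 100 ≤ R
  differentiable : Differentiable ℂ f
  continuousAt_chart : ∀ z : ℂ, R ≤ z.re → ContinuousAt (chart f d) z
  exp_chart : ∀ z : ℂ, R ≤ z.re → Complex.exp (d * chart f d z) = f z
  near : ∀ z : ℂ, R ≤ z.re → ‖chart f d z - z‖ ≤ 1 / 8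
  asymp : ∃ K : ℝ, 0 ≤ K ∧ ∀ z : ℂ, R ≤ z.re → ‖chart f d z - z‖ ≤ K * Real.exp (-z.re)
  expand : ∀ z w : ℂ, R ≤ z.re → R ≤ w.re → ‖z - w‖ ≤ 2 * ‖chart f d z - chart f d w‖
  surj : ∀ ζ : ℂ, R + 1 ≤ ζ.re → ∃ z : ℂ, R ≤ z.re ∧ chart f d z = ζ

lemma norm_exp_neg_sub_exp_neg_le {R : ℝ} {z w : ℂ} (hz : R ≤ z.re) (hw : R ≤ w.re) :
    ‖Complex.exp (-z) - Complex.exp (-w)‖ ≤ Real.exp (-R) * ‖z - w‖ := by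
  have hconv : Convex ℝ {z : ℂ | R ≤ z.re} := convex_halfSpace_re_ge R
  refine hconv.norm_image_sub_le_of_norm_hasDerivWithin_le
    (f := fun z => Complex.exp (-z)) (f' := fun z => Complex.exp (-z) * (-1))
    (fun x _ => ((Complex.hasDerivAt_exp (-x)).comp x (hasDerivAt_neg x)).hasDerivWithinAt)
    (fun x hx => ?_) hw hz
  have hx' : R ≤ x.re := hx
  rw [norm_mul, Complex.norm_exp]
  simpa using hx'

lemma eval_exp_mul_exp_neg (p : Polynomial ℂ) (z : ℂ) :
    p.eval (Complex.exp z) * Complex.exp (-(p.natDegree * z)) =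
      p.reverse.eval (Complex.exp (-z)) := by
  let : Invertible (Complex.exp z) := invertibleOfNonzero (Complex.exp_ne_zero z)
  have h := Polynomial.eval₂_reverse_mul_pow (RingHom.id ℂ) (Complex.exp z) p
  rw [invOf_eq_inv, ← Complex.exp_neg] at h
  rw [Polynomial.eval, ← h, Polynomial.eval, mul_assoc, ← Complex.exp_nat_mul, ← Complex.exp_add]
  simp

/-- With `q` the reverse polynomial of `p`, the chart is `z + (1/d) log q(exp (-z))`, and `q(0) = 1`
because `p` is monic. -/
theorem exists_isLarge {d : ℕ} (hd : 1 ≤ d) {f : ℂ → ℂ} (hf : f ∈ Family d) :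
    ∃ R₀ : ℝ, ∀ R, R₀ ≤ R → IsLarge f d R := by
  obtain ⟨p, hp, hpd, rfl⟩ := hf
  set q := p.reverse with hq
  have hq0 : q.eval 0 = 1 := by
    rw [← Polynomial.coeff_zero_eq_eval_zero, hq, Polynomial.coeff_zero_reverse, hp.leadingCoeff]
  set g : ℂ → ℂ := fun x => Complex.log (q.eval x) / d with hg
  have hg0 : g 0 = 0 := by simp [hg, hq0]
  have hchart : ∀ z, chart (fun z => p.eval (Complex.exp z)) d z = z + g (Complex.exp (-z)) := by
    intro z
    simp only [chart, hg]
    rw [← eval_exp_mul_exp_neg, hpd]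
  have hslit : q.eval 0 ∈ Complex.slitPlane := by rw [hq0]; exact Complex.one_mem_slitPlane
  have hgd : ContDiffAt ℂ 1 g 0 := by
    refine ContDiffAt.div_const ?_ _
    exact (Complex.contDiffAt_log hslit).comp 0 (Polynomial.contDiff_aeval (𝕜 := ℂ) q 1).contDiffAt
  obtain ⟨K, t, ht, hK⟩ := hgd.exists_lipschitzOnWith
  have hev : ∀ᶠ x in 𝓝 (0 : ℂ), q.eval x ∈ Complex.slitPlane :=
    q.continuous.continuousAt.eventually_mem (Complex.isOpen_slitPlane.mem_nhds hslit)
  obtain ⟨ε, hε, hball⟩ := Metric.mem_nhds_iff.1 (inter_mem ht hev)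
  have hlim : Tendsto (fun R : ℝ => Real.exp (-R)) atTop (𝓝 0) :=
    Real.tendsto_exp_neg_atTop_nhds_zero
  have hev2 : ∀ᶠ R : ℝ in atTop, 100 ≤ R ∧ Real.exp (-R) < ε ∧ K * Real.exp (-R) ≤ 1 / 8 := by
    have h3 : Tendsto (fun R : ℝ => (K : ℝ) * Real.exp (-R)) atTop (𝓝 (K * 0)) :=
      hlim.const_mul _
    rw [mul_zero] at h3
    filter_upwards [eventually_ge_atTop 100, hlim.eventually_lt_const hε,
      h3.eventually_le_const (by norm_num : (0 : ℝ) < 1 / 8)] with R h1 h2 h3 using ⟨h1, h2, h3⟩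
  obtain ⟨R₀, hR₀⟩ := eventually_atTop.1 hev2
  refine ⟨R₀, fun R hR => ?_⟩
  obtain ⟨hR1, hR2, hR3⟩ := hR₀ R hR
  have hmem : ∀ z : ℂ, R ≤ z.re → Complex.exp (-z) ∈ t ∩ {x | q.eval x ∈ Complex.slitPlane} := by
    intro z hz
    apply hball
    rw [mem_ball_zero_iff, Complex.norm_exp, Complex.neg_re]
    exact lt_of_le_of_lt (Real.exp_le_exp.2 (by linarith)) hR2
  have hK' : ∀ x ∈ t, ∀ y ∈ t, ‖g x - g y‖ ≤ K * ‖x - y‖ := by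
    intro x hx y hy
    rw [← dist_eq_norm, ← dist_eq_norm]
    exact hK.dist_le_mul x hx y hy
  have h0t : (0 : ℂ) ∈ t := (hball (Metric.mem_ball_self hε)).1
  have hnear : ∀ z : ℂ, R ≤ z.re → ‖g (Complex.exp (-z))‖ ≤ K * Real.exp (-z.re) := by
    intro z hz
    have := hK' _ (hmem z hz).1 0 h0t
    rwa [hg0, sub_zero, sub_zero, Complex.norm_exp, Complex.neg_re] at this
  have hnear' : ∀ z : ℂ, R ≤ z.re → ‖g (Complex.exp (-z))‖ ≤ 1 / 8 := by
    intro z hz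
    refine (hnear z hz).trans (le_trans ?_ hR3)
    have : Real.exp (-z.re) ≤ Real.exp (-R) := Real.exp_le_exp.2 (by linarith)
    exact mul_le_mul_of_nonneg_left this K.2
  have hlip : ∀ z w : ℂ, R ≤ z.re → R ≤ w.re →
      ‖g (Complex.exp (-z)) - g (Complex.exp (-w))‖ ≤ 1 / 8 * ‖z - w‖ := by
    intro z w hz hw
    refine (hK' _ (hmem z hz).1 _ (hmem w hw).1).trans ?_
    have h1 := norm_exp_neg_sub_exp_neg_le hz hw
    calc (K : ℝ) * ‖Complex.exp (-z) - Complex.exp (-w)‖ ≤ K * (Real.exp (-R) * ‖z - w‖) :=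
          mul_le_mul_of_nonneg_left h1 K.2
      _ = K * Real.exp (-R) * ‖z - w‖ := by ring
      _ ≤ _ := by gcongr
  have hdC : (d : ℂ) ≠ 0 := by
    have : d ≠ 0 := by omega
    exact_mod_cast this
  refine ⟨hd, hR1, ?_, ?_, ?_, ?_, ⟨K, K.2, ?_⟩, ?_, ?_⟩
  · exact p.differentiable.comp Complex.differentiable_exp
  · intro z hz
    have : chart (fun z => p.eval (Complex.exp z)) d = fun z => z + g (Complex.exp (-z)) :=
      funext hchart
    rw [this]
    have h1 : ContinuousAt (fun z : ℂ => q.eval (Complex.exp (-z))) z := by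
      have := q.continuous
      fun_prop
    exact continuousAt_id.add ((h1.clog (hmem z hz).2).div_const _)
  · intro z hz
    rw [hchart, mul_add, hg]
    simp only
    rw [mul_div_cancel₀ _ hdC, Complex.exp_add,
      Complex.exp_log (Complex.slitPlane_ne_zero (hmem z hz).2), ← eval_exp_mul_exp_neg, hpd,
      mul_comm, mul_assoc, ← Complex.exp_add]
    simp
  · intro z hz
    rw [hchart, add_sub_cancel_left]; exact hnear' z hz
  · intro z hz
    rw [hchart, add_sub_cancel_left]; exact hnear z hz
  · intro z w hz hw
    rw [hchart, hchart]
    have h1 := hlip z w hz hw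
    have h2 : ‖z - w‖ ≤ ‖z + g (Complex.exp (-z)) - (w + g (Complex.exp (-w)))‖ +
        ‖g (Complex.exp (-z)) - g (Complex.exp (-w))‖ := by
      refine le_trans (le_of_eq ?_) (norm_sub_le _ _)
      congr 1; ring
    have := norm_nonneg (z - w)
    linarith
  · intro ζ hζ
    have happ : ApproximatesLinearOn (chart (fun z => p.eval (Complex.exp z)) d)
        ((ContinuousLinearEquiv.refl ℂ ℂ : ℂ ≃L[ℂ] ℂ) : ℂ →L[ℂ] ℂ) (Metric.closedBall ζ 1)
        (1 / 8 : NNReal) := by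
      have hre : ∀ x ∈ Metric.closedBall ζ 1, R ≤ x.re := by
        intro x hx
        have h1 := (Complex.abs_re_le_norm (x - ζ)).trans (mem_closedBall_iff_norm.1 hx)
        rw [Complex.sub_re] at h1
        linarith [(abs_le.1 h1).1]
      intro x hx y hy
      rw [hchart, hchart]
      have h1 := hlip x y (hre x hx) (hre y hy)
      have e : x + g (Complex.exp (-x)) - (y + g (Complex.exp (-y))) -
        ((ContinuousLinearEquiv.refl ℂ ℂ : ℂ ≃L[ℂ] ℂ) : ℂ →L[ℂ] ℂ) (x - y) =
        g (Complex.exp (-x)) - g (Complex.exp (-y)) := by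
        simp; ring
      rw [e]
      simpa using h1
    have hs := happ.surjOn_closedBall_of_nonlinearRightInverse
      (ContinuousLinearEquiv.refl ℂ ℂ).toNonlinearRightInverse zero_le_one subset_rfl
    have hn : ((ContinuousLinearEquiv.refl ℂ ℂ).toNonlinearRightInverse.nnnorm : ℝ) ≤ 1 := by
      change ‖((ContinuousLinearEquiv.refl ℂ ℂ).symm : ℂ →L[ℂ] ℂ)‖ ≤ 1
      exact ContinuousLinearMap.norm_id_le
    have hn0 : (0 : ℝ) < ((ContinuousLinearEquiv.refl ℂ ℂ).toNonlinearRightInverse.nnnorm : ℝ) := by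
      change 0 < ‖((ContinuousLinearEquiv.refl ℂ ℂ).symm : ℂ →L[ℂ] ℂ)‖
      have : ((ContinuousLinearEquiv.refl ℂ ℂ).symm : ℂ →L[ℂ] ℂ) = ContinuousLinearMap.id ℂ ℂ := rfl
      rw [this, ContinuousLinearMap.norm_id]; norm_num
    obtain ⟨z, hz, hzζ⟩ := hs (show ζ ∈ _ by
      rw [Metric.mem_closedBall, dist_comm, dist_eq_norm, hchart, add_sub_cancel_left]
      refine (hnear' ζ (by linarith)).trans ?_
      have := (one_le_inv₀ hn0).2 hn
      norm_num
      linarith)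
    refine ⟨z, ?_, hzζ⟩
    have h1 := (Complex.abs_re_le_norm (z - ζ)).trans (mem_closedBall_iff_norm.1 hz)
    rw [Complex.sub_re] at h1
    linarith [(abs_le.1 h1).1]

/-- Points with large images lie far to the right. -/
lemma exists_lt_re_of_lt_norm {d : ℕ} {f : ℂ → ℂ} (hf : f ∈ Family d) (M : ℝ) :
    ∃ B : ℝ, ∀ z, B < ‖f z‖ → M < z.re := by
  obtain ⟨p, -, -, rfl⟩ := hf
  obtain ⟨B, hB⟩ := (isCompact_closedBall (0 : ℂ) (Real.exp M)).exists_bound_of_continuousOn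
    p.continuous.continuousOn
  refine ⟨B, fun z hz => ?_⟩
  by_contra! h
  refine absurd (hB (Complex.exp z) ?_) (not_le.2 hz)
  rw [mem_closedBall_zero_iff, Complex.norm_exp]
  exact Real.exp_le_exp.2 h

lemma Family.periodic {d : ℕ} {f : ℂ → ℂ} (hf : f ∈ Family d) (z : ℂ) :
    f (z + 2 * Real.pi * Complex.I) = f z := by
  obtain ⟨p, -, -, rfl⟩ := hf
  simp only [Complex.exp_add, Complex.exp_two_pi_mul_I, mul_one]

/-! ### Strips and orbits that stay far to the right -/

/-- `z` lies in the `n`-th strip, a neighbourhood of height `π/d` of the line `Im = 2πn/d` in the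
coordinate `chart f d`. Far to the right the union of the strips is the set `{Re f ≥ 0}`. -/
def InStrip (f : ℂ → ℂ) (d : ℕ) (n : ℤ) (z : ℂ) : Prop :=
  |(chart f d z).im - 2 * Real.pi * n / d| ≤ Real.pi / (2 * d)

/-- The points whose orbits stay in `{Re z ≥ R}` and visit the strips prescribed by `s`. -/
def tailSet (f : ℂ → ℂ) (d : ℕ) (R : ℝ) (s : ℕ → ℤ) : Set ℂ :=
  {z | ∀ k : ℕ, R ≤ (f^[k] z).re ∧ InStrip f d (s k) (f^[k] z)}

lemma IsLarge.cast_one_le (h : IsLarge f d R) : (1 : ℝ) ≤ d := by exact_mod_cast h.one_le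

lemma IsLarge.ne_zero (h : IsLarge f d R) : (d : ℂ) ≠ 0 := by
  have : d ≠ 0 := by have := h.one_le; omega
  exact_mod_cast this

/-- Later arguments use several levels `R`, `R + 2`, …, because a comparison point may lie slightly to
the left of a given one. -/
lemma IsLarge.mono {R' : ℝ} (h : IsLarge f d R) (hR : R ≤ R') : IsLarge f d R' where
  one_le := h.one_le
  big := h.big.trans hR
  differentiable := h.differentiable
  continuousAt_chart z hz := h.continuousAt_chart z (hR.trans hz)
  exp_chart z hz := h.exp_chart z (hR.trans hz)
  near z hz := h.near z (hR.trans hz)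
  asymp := by
    obtain ⟨K, hK, hK'⟩ := h.asymp
    exact ⟨K, hK, fun z hz => hK' z (hR.trans hz)⟩
  expand z w hz hw := h.expand z w (hR.trans hz) (hR.trans hw)
  surj ζ hζ := by
    obtain ⟨z, hz, rfl⟩ := h.surj ζ (by linarith)
    refine ⟨z, ?_, rfl⟩
    have h1 := (Complex.abs_re_le_norm _).trans (h.near z hz)
    rw [Complex.sub_re] at h1
    linarith [(abs_le.1 h1).2]

lemma IsLarge.re_near (h : IsLarge f d R) (hz : R ≤ z.re) :
    |(chart f d z).re - z.re| ≤ 1 / 8 := by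
  simpa using (Complex.abs_re_le_norm _).trans (h.near z hz)

lemma IsLarge.im_near (h : IsLarge f d R) (hz : R ≤ z.re) :
    |(chart f d z).im - z.im| ≤ 1 / 8 := by
  simpa using (Complex.abs_im_le_norm _).trans (h.near z hz)

lemma IsLarge.norm_eq (h : IsLarge f d R) (hz : R ≤ z.re) :
    ‖f z‖ = Real.exp (d * (chart f d z).re) := by
  rw [← h.exp_chart z hz, Complex.norm_exp]
  simp

lemma IsLarge.norm_le (h : IsLarge f d R) (hz : R ≤ z.re) :
    ‖f z‖ ≤ Real.exp (d * (z.re + 1 / 8)) := by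
  rw [h.norm_eq hz]
  have := (abs_le.1 (h.re_near hz)).2
  gcongr
  linarith

lemma IsLarge.le_norm (h : IsLarge f d R) (hz : R ≤ z.re) :
    Real.exp (d * (z.re - 1 / 8)) ≤ ‖f z‖ := by
  rw [h.norm_eq hz]
  have := (abs_le.1 (h.re_near hz)).1
  gcongr
  linarith

lemma IsLarge.pi_div_le (h : IsLarge f d R) : Real.pi / (2 * d) ≤ 1.6 := by
  have := h.cast_one_le
  have := Real.pi_lt_d2
  rw [div_le_iff₀ (by positivity)]
  nlinarith

lemma InStrip.abs_im_le (h : IsLarge f d R) (hz : R ≤ z.re) {n : ℤ} (hn : InStrip f d n z) :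
    |z.im - 2 * Real.pi * n / d| ≤ 2 := by
  have h1 := abs_le.1 (h.im_near hz)
  have h2 := abs_le.1 (hn.trans h.pi_div_le)
  rw [abs_le]; constructor <;> linarith [h1.1, h1.2, h2.1, h2.2]

lemma InStrip.abs_im_sub_le (h : IsLarge f d R) (hz : R ≤ z.re) (hw : R ≤ w.re) {n : ℤ}
    (hn : InStrip f d n z) (hn' : InStrip f d n w) : |z.im - w.im| ≤ 4 := by
  have h1 := abs_le.1 (hn.abs_im_le h hz)
  have h2 := abs_le.1 (hn'.abs_im_le h hw)
  rw [abs_le]; constructor <;> linarith [h1.1, h1.2, h2.1, h2.2]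

/-- In the `n`-th strip `d Φ` is the principal logarithm of `f`, up to `2πin`. -/
lemma InStrip.mul_chart (h : IsLarge f d R) (hz : R ≤ z.re) {n : ℤ} (hn : InStrip f d n z) :
    d * chart f d z = Complex.log (f z) + n * (2 * Real.pi * Complex.I) := by
  have hd := h.cast_one_le
  have e : Complex.exp (d * chart f d z - n * (2 * Real.pi * Complex.I)) = f z := by
    rw [Complex.exp_sub, Complex.exp_int_mul_two_pi_mul_I, div_one, h.exp_chart z hz]
  have him : (d * chart f d z - n * (2 * Real.pi * Complex.I)).im =
      d * ((chart f d z).im - 2 * Real.pi * n / d) := by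
    simp; field_simp
  have h1 : |(d * chart f d z - n * (2 * Real.pi * Complex.I)).im| ≤ Real.pi / 2 := by
    rw [him, abs_mul, abs_of_nonneg (by positivity)]
    calc (d : ℝ) * _ ≤ d * (Real.pi / (2 * d)) := by gcongr; exact hn
      _ = Real.pi / 2 := by field_simp
  have := Real.pi_pos
  rw [← e, Complex.log_exp (by linarith [(abs_le.1 h1).1]) (by linarith [(abs_le.1 h1).2])]
  ring

lemma inStrip_of_chart_eq (h : IsLarge f d R) {n : ℤ} {ζ : ℂ} (hζ : 0 ≤ ζ.re)
    (e : d * chart f d z = Complex.log ζ + n * (2 * Real.pi * Complex.I)) : InStrip f d n z := by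
  have hd := h.cast_one_le
  have h1 : (d : ℝ) * ((chart f d z).im - 2 * Real.pi * n / d) = ζ.arg := by
    have := congrArg Complex.im e
    simp at this
    rw [mul_sub, this, Complex.log_im]
    field_simp; ring
  have h2 := Complex.abs_arg_le_pi_div_two_iff.2 hζ
  rw [← h1, abs_mul, abs_of_nonneg (by positivity : (0 : ℝ) ≤ d)] at h2
  rw [InStrip, le_div_iff₀ (by positivity)]
  linarith

lemma IsLarge.exists_inStrip (h : IsLarge f d R) (hz : R ≤ z.re) (hfz : 0 ≤ (f z).re) :
    ∃ n : ℤ, InStrip f d n z := by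
  have h0 : f z ≠ 0 := by
    rw [← h.exp_chart z hz]; exact Complex.exp_ne_zero _
  obtain ⟨n, hn⟩ := Complex.exp_eq_exp_iff_exists_int.1
    ((h.exp_chart z hz).trans (Complex.exp_log h0).symm)
  exact ⟨n, inStrip_of_chart_eq h hfz hn⟩

lemma InStrip.unique (hd : 1 ≤ d) {m n : ℤ} (hm : InStrip f d m z) (hn : InStrip f d n z) :
    m = n := by
  have hd' : (0 : ℝ) < d := by exact_mod_cast hd
  have hpi := Real.pi_pos
  rw [InStrip, le_div_iff₀ (by positivity)] at hm hn
  set c := (chart f d z).im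
  have e : ∀ k : ℤ, |c - 2 * Real.pi * k / d| * (2 * d) = |2 * c * d - 4 * Real.pi * k| := by
    intro k
    have h2d : (0 : ℝ) < 2 * d := by positivity
    rw [← abs_of_pos h2d, ← abs_mul]
    congr 1; field_simp; ring
  rw [e, abs_le] at hm
  rw [e, abs_le] at hn
  have h1 : (m : ℝ) - n < 1 := by nlinarith
  have h2 : (n : ℝ) - m < 1 := by nlinarith
  have h3 : m - n < 1 := by exact_mod_cast h1
  have h4 : n - m < 1 := by exact_mod_cast h2
  omega

lemma norm_log_sub_log_le (hR : 0 < R) (hz : R ≤ z.re) (hw : R ≤ w.re) :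
    ‖Complex.log z - Complex.log w‖ ≤ R⁻¹ * ‖z - w‖ := by
  have hconv : Convex ℝ {z : ℂ | R ≤ z.re} := convex_halfSpace_re_ge R
  refine hconv.norm_image_sub_le_of_norm_hasDerivWithin_le
    (f := Complex.log) (f' := fun z => z⁻¹) (fun x hx => ?_) (fun x hx => ?_) hw hz
  · have hx' : R ≤ x.re := hx
    exact (Complex.hasDerivAt_log (Or.inl (hR.trans_le hx'))).hasDerivWithinAt
  · have hx' : R ≤ x.re := hx
    rw [norm_inv]
    have h1 : R ≤ ‖x‖ := hx'.trans ((le_abs_self _).trans (Complex.abs_re_le_norm x))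
    gcongr

/-- `f` expands distances inside a strip. -/
lemma InStrip.expand (h : IsLarge f d R) {n : ℤ} (hz : R ≤ z.re) (hw : R ≤ w.re)
    (hfz : R ≤ (f z).re) (hfw : R ≤ (f w).re) (hnz : InStrip f d n z) (hnw : InStrip f d n w) :
    ‖z - w‖ ≤ 1 / 2 * ‖f z - f w‖ := by
  have hd := h.cast_one_le
  have h1 := h.expand z w hz hw
  have h2 : d * (chart f d z - chart f d w) = Complex.log (f z) - Complex.log (f w) := by
    rw [mul_sub, hnz.mul_chart h hz, hnw.mul_chart h hw]; ring
  have hR : 0 < R := by linarith [h.big]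
  have h3 := norm_log_sub_log_le hR hfz hfw
  rw [← h2, norm_mul, Complex.norm_natCast] at h3
  have h4 : R⁻¹ ≤ 1 / 4 := by
    rw [inv_eq_one_div]
    exact one_div_le_one_div_of_le (by norm_num) (by linarith [h.big])
  have h5 : ‖chart f d z - chart f d w‖ ≤ d * ‖chart f d z - chart f d w‖ :=
    le_mul_of_one_le_left (norm_nonneg _) hd
  have h6 : R⁻¹ * ‖f z - f w‖ ≤ 1 / 4 * ‖f z - f w‖ := by gcongr
  linarith

/-- The inverse branch of `f` with values in the `n`-th strip. -/
lemma IsLarge.exists_preimage (h : IsLarge f d R) (n : ℤ) {ζ : ℂ} (hζ : 0 ≤ ζ.re)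
    (hζ' : Real.exp (d * (R + 1)) ≤ ‖ζ‖) :
    ∃ z, R ≤ z.re ∧ f z = ζ ∧ InStrip f d n z ∧
      d * chart f d z = Complex.log ζ + n * (2 * Real.pi * Complex.I) := by
  have hd := h.cast_one_le
  have hζ0 : ζ ≠ 0 := by
    rintro rfl
    rw [norm_zero] at hζ'
    exact absurd (Real.exp_pos (d * (R + 1))) (not_lt.2 hζ')
  have hlog : d * (R + 1) ≤ Real.log ‖ζ‖ := (Real.le_log_iff_exp_le (norm_pos_iff.2 hζ0)).2 hζ'
  obtain ⟨z, hz, e⟩ := h.surj ((Complex.log ζ + n * (2 * Real.pi * Complex.I)) / d) (by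
    rw [Complex.div_natCast_re, le_div_iff₀ (by positivity)]
    simp [Complex.log_re]
    linarith)
  have e' : d * chart f d z = Complex.log ζ + n * (2 * Real.pi * Complex.I) := by
    rw [e, mul_div_cancel₀ _ h.ne_zero]
  refine ⟨z, hz, ?_, inStrip_of_chart_eq h hζ e', e'⟩
  rw [← h.exp_chart z hz, e', Complex.exp_add, Complex.exp_log hζ0,
    Complex.exp_int_mul_two_pi_mul_I, mul_one]

lemma tailSet.map (hz : z ∈ tailSet f d R s) : f z ∈ tailSet f d R (shift 1 s) := by
  intro k
  have := hz (k + 1)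
  rw [Function.iterate_succ_apply] at this
  simpa [shift, add_comm] using this

lemma tailSet.iterate (hz : z ∈ tailSet f d R s) (n : ℕ) :
    f^[n] z ∈ tailSet f d R (shift n s) := by
  intro k
  have := hz (n + k)
  rw [add_comm, Function.iterate_add_apply, add_comm] at this
  exact this

lemma tailSet.cons (hz : R ≤ z.re) (hs : InStrip f d (s 0) z)
    (hfz : f z ∈ tailSet f d R (shift 1 s)) : z ∈ tailSet f d R s := by
  intro k
  cases k with
  | zero => exact ⟨hz, hs⟩
  | succ k =>
    rw [Function.iterate_succ_apply]
    simpa [shift, add_comm] using hfz k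

lemma tailSet.re (hz : z ∈ tailSet f d R s) : R ≤ z.re := (hz 0).1

lemma tailSet.mono {R' : ℝ} (hR : R ≤ R') (hz : z ∈ tailSet f d R' s) : z ∈ tailSet f d R s :=
  fun k => ⟨hR.trans (hz k).1, (hz k).2⟩

lemma tailSet.unique (hd : 1 ≤ d) {s' : ℕ → ℤ} (hz : z ∈ tailSet f d R s)
    (hz' : z ∈ tailSet f d R s') : s = s' := by
  ext k
  exact (hz k).2.unique hd (hz' k).2

lemma exists_mem_tailSet (h : IsLarge f d R) (hz : ∀ k : ℕ, R ≤ (f^[k] z).re) :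
    ∃ s, z ∈ tailSet f d R s := by
  have h1 : ∀ k : ℕ, ∃ n : ℤ, InStrip f d n (f^[k] z) := by
    intro k
    refine h.exists_inStrip (hz k) ?_
    have := hz (k + 1)
    rw [Function.iterate_succ_apply'] at this
    linarith [h.big]
  choose s hs using h1
  exact ⟨s, fun k => ⟨hz k, hs k⟩⟩

lemma isClosed_tailSet (h : IsLarge f d R) (s : ℕ → ℤ) : IsClosed (tailSet f d R s) := by
  refine isClosed_of_closure_subset fun z hz => ?_
  have hcont : ∀ k, Continuous (f^[k]) := fun k => h.differentiable.continuous.iterate k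
  intro k
  have hre : R ≤ (f^[k] z).re := by
    have hc : IsClosed {z | R ≤ (f^[k] z).re} :=
      isClosed_le continuous_const (Complex.continuous_re.comp (hcont k))
    exact closure_minimal (fun z hz => (hz k).1) hc hz
  refine ⟨hre, ?_⟩
  have hca : ContinuousAt (fun z => |(chart f d (f^[k] z)).im - 2 * Real.pi * s k / d|) z := by
    have h1 : ContinuousAt (fun z => chart f d (f^[k] z)) z :=
      ContinuousAt.comp (f := f^[k]) (h.continuousAt_chart _ hre) (hcont k).continuousAt
    have h2 := Complex.continuous_im.continuousAt.comp h1
    exact (h2.sub continuousAt_const).abs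
  obtain ⟨x, hx, hxz⟩ := mem_closure_iff_seq_limit.1 hz
  exact le_of_tendsto (hca.tendsto.comp hxz) (Eventually.of_forall fun n => (hx n k).2)

/-! ### Potentials -/

/-- `z` has potential `t`: its orbit grows like the orbit of `t` under `F`, in the sense that it
is eventually dominated by the orbits of all larger potentials and eventually dominates the orbits
of all smaller positive ones. -/
structure HasPot (f : ℂ → ℂ) (d : ℕ) (z : ℂ) (t : ℝ) : Prop where
  nonneg : 0 ≤ t
  le : ∀ u, t < u → ∀ᶠ n : ℕ in atTop, ‖f^[n] z‖ ≤ (F d)^[n] u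
  ge : ∀ u, 0 < u → u < t → ∀ᶠ n : ℕ in atTop, (F d)^[n] u ≤ ‖f^[n] z‖

/-- Orbits that stay within a bounded factor or distance have comparable potentials, because the
orbits of different potentials under `F` separate. -/
lemma HasPot.le_of_norm_le (hd : 1 ≤ d) {t u C : ℝ} (hz : HasPot f d z t) (hw : HasPot f d w u)
    (h : ∀ᶠ k : ℕ in atTop, ‖f^[k] z‖ ≤ ‖f^[k] w‖ + C) : t ≤ u := by
  by_contra! hut
  obtain ⟨a, hua, hat⟩ := exists_between hut
  obtain ⟨b, hab, hbt⟩ := exists_between hat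
  have ha0 : 0 < a := hw.nonneg.trans_lt hua
  have h1 := eventually_mul_F_iterate_add_le hd ha0 hab (|C| + 1)
  obtain ⟨n, h1, h2, h3, h4⟩ := (h1.and (h.and ((hw.le a hua).and
    (hz.ge b (ha0.trans hab) hbt)))).exists
  have h5 := F_iterate_pos hd n ha0
  nlinarith [le_abs_self C, abs_nonneg C]

lemma HasPot.unique (hd : 1 ≤ d) {t u : ℝ} (hz : HasPot f d z t) (hz' : HasPot f d z u) :
    t = u :=
  le_antisymm (hz.le_of_norm_le (C := 0) hd hz' (by simp))
    (hz'.le_of_norm_le (C := 0) hd hz (by simp))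

lemma HasPot.map (hd : 1 ≤ d) {t : ℝ} (hz : HasPot f d z t) : HasPot f d (f z) (F d t) := by
  refine ⟨by simpa using F_iterate_nonneg hd 1 hz.nonneg, fun u hu => ?_, fun u hu0 hu => ?_⟩
  · have hu1 : -1 < u := lt_trans (by simp only [F]; linarith [Real.exp_pos (d * t)]) hu
    have h1 := hz.le (Finv d u) ((lt_Finv_iff hd hu1).2 hu)
    rw [← map_add_atTop_eq_nat 1, eventually_map] at h1
    filter_upwards [h1] with n hn
    rwa [Function.iterate_succ_apply, Function.iterate_succ_apply, F_Finv hd hu1] at hn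
  · have h1 := hz.ge (Finv d u) ((lt_Finv_iff hd (by linarith)).2 (by rwa [F_zero]))
      ((Finv_lt_iff hd (by linarith)).2 hu)
    rw [← map_add_atTop_eq_nat 1, eventually_map] at h1
    filter_upwards [h1] with n hn
    rwa [Function.iterate_succ_apply, Function.iterate_succ_apply, F_Finv hd (by linarith)] at hn

lemma HasPot.of_map (hd : 1 ≤ d) {t : ℝ} (ht : 0 ≤ t) (hz : HasPot f d (f z) (F d t)) :
    HasPot f d z t := by
  refine ⟨ht, fun u hu => ?_, fun u hu0 hu => ?_⟩
  · have h1 := hz.le (F d u) (F_strictMono hd hu)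
    rw [← map_add_atTop_eq_nat 1, eventually_map]
    simpa [Function.iterate_succ_apply] using h1
  · have h1 := hz.ge (F d u) (by simpa using F_iterate_pos hd 1 hu0) (F_strictMono hd hu)
    rw [← map_add_atTop_eq_nat 1, eventually_map]
    simpa [Function.iterate_succ_apply] using h1

lemma HasPot.iterate (hd : 1 ≤ d) {t : ℝ} (hz : HasPot f d z t) (n : ℕ) :
    HasPot f d (f^[n] z) ((F d)^[n] t) := by
  induction n with
  | zero => exact hz
  | succ n ih =>
    rw [Function.iterate_succ_apply', Function.iterate_succ_apply']
    exact ih.map hd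

lemma HasPot.of_iterate (hd : 1 ≤ d) {t : ℝ} (ht : 0 ≤ t) {n : ℕ}
    (hz : HasPot f d (f^[n] z) ((F d)^[n] t)) : HasPot f d z t := by
  induction n generalizing z t with
  | zero => exact hz
  | succ n ih =>
    rw [Function.iterate_succ_apply, Function.iterate_succ_apply] at hz
    exact (ih (by simpa using F_iterate_nonneg hd 1 ht) hz).of_map hd ht

lemma HasPot.tendsto_norm (hd : 1 ≤ d) {t : ℝ} (ht : 0 < t) (hz : HasPot f d z t) :
    Tendsto (fun n => ‖f^[n] z‖) atTop atTop := by
  obtain ⟨u, hu0, hut⟩ := exists_between ht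
  exact tendsto_atTop_mono' _ (hz.ge u hu0 hut) (tendsto_F_iterate hd hu0)

lemma HasPot.mem_escapingSet (hd : 1 ≤ d) {t : ℝ} (ht : 0 < t) (hz : HasPot f d z t) :
    z ∈ escapingSet f :=
  tendsto_norm_atTop_iff_cobounded.1 (hz.tendsto_norm hd ht)

/-- The margin of size one is reproduced by one step, which makes the estimate suitable for induction. -/
lemma IsLarge.norm_map_le (h : IsLarge f d R) {u : ℝ} (hz : R ≤ z.re) (hu : ‖z‖ ≤ u - 1) :
    ‖f z‖ ≤ F d u - 1 := by
  have hd := h.cast_one_le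
  have hzn : z.re ≤ ‖z‖ := (le_abs_self _).trans (Complex.abs_re_le_norm z)
  refine (h.norm_le hz).trans ?_
  have h1 : Real.exp (d * (z.re + 1 / 8)) ≤ Real.exp (d * (u - 7 / 8)) := by
    gcongr; linarith
  refine h1.trans ?_
  have h2 : Real.exp (d * u) = Real.exp (d * (u - 7 / 8)) * Real.exp (d * (7 / 8)) := by
    rw [← Real.exp_add]; ring_nf
  have h3 := Real.add_one_le_exp (d * (7 / 8) : ℝ)
  have h4 := Real.add_one_le_exp (d * (u - 7 / 8) : ℝ)
  have h5 : (100 : ℝ) ≤ u - 7 / 8 := by linarith [h.big]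
  simp only [F]
  rw [h2]
  have h6 : (15 / 8 : ℝ) ≤ Real.exp (d * (7 / 8)) := by linarith
  have h7 : (100 : ℝ) ≤ Real.exp (d * (u - 7 / 8)) := by nlinarith
  nlinarith

lemma tailSet.norm_iterate_le (h : IsLarge f d R) (hz : z ∈ tailSet f d R s) {u : ℝ}
    (hu : ‖z‖ ≤ u - 1) (k : ℕ) : ‖f^[k] z‖ ≤ (F d)^[k] u - 1 := by
  induction k with
  | zero => exact hu
  | succ k ih =>
    rw [Function.iterate_succ_apply', Function.iterate_succ_apply']
    exact h.norm_map_le (hz k).1 ih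

/-- The potential is the infimum of all `t` whose orbit dominates. Once the orbit of `z` is below
`F^n(v) - 1` it remains so, so below the infimum the domination is eventually reversed. -/
lemma tailSet.exists_hasPot (h : IsLarge f d R) (hz : z ∈ tailSet f d R s) :
    ∃ t, HasPot f d z t := by
  have hd := h.one_le
  set A : Set ℝ := {t | 0 < t ∧ ∀ᶠ n : ℕ in atTop, ‖f^[n] z‖ ≤ (F d)^[n] t} with hA
  have hne : A.Nonempty := by
    refine ⟨‖z‖ + 1, by positivity, Eventually.of_forall fun n => ?_⟩
    linarith [tailSet.norm_iterate_le h hz (u := ‖z‖ + 1) (by linarith) n]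
  have hbdd : BddBelow A := ⟨0, fun t ht => ht.1.le⟩
  refine ⟨sInf A, Real.sInf_nonneg fun t ht => ht.1.le, fun u hu => ?_, fun u hu0 hu => ?_⟩
  · obtain ⟨t, ht, htu⟩ := exists_lt_of_csInf_lt hne hu
    filter_upwards [ht.2] with n hn
    exact hn.trans ((F_iterate_strictMono hd n).monotone htu.le)
  · by_contra hcon
    obtain ⟨v, huv, hv⟩ := exists_between hu
    -- a single `n` at which `F^n(u)` dominates suffices for domination by `F^m(v)` at all later times
    refine absurd (csInf_le hbdd (show v ∈ A from ⟨hu0.trans huv, ?_⟩)) (not_le.2 hv)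
    obtain ⟨n, hn1, hn2⟩ := (Filter.not_eventually.1 hcon).and_eventually
      (eventually_mul_F_iterate_add_le hd hu0 huv 1) |>.exists
    refine eventually_atTop.2 ⟨n, fun m hm => ?_⟩
    obtain ⟨k, rfl⟩ := Nat.exists_eq_add_of_le hm
    have := tailSet.norm_iterate_le h (tailSet.iterate hz n) (u := (F d)^[n] v) (by linarith) k
    rw [← Function.iterate_add_apply, ← Function.iterate_add_apply, add_comm k n] at this
    linarith

/-! ### Potentials order the points with a given address -/

/-- A head start of size one is amplified: the real part dominates the modulus of the other
point. -/
lemma InStrip.head_start (h : IsLarge f d R) {m : ℤ} (hz : R ≤ z.re) (hw : R ≤ w.re)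
    (hfz : R ≤ (f z).re) (hfw : R ≤ (f w).re)
    (hm : InStrip f d m (f z)) (hm' : InStrip f d m (f w)) (hzw : z.re + 1 ≤ w.re) :
    2 * ‖f z‖ ≤ ‖f w‖ ∧ ‖f z‖ + 3 ≤ (f w).re := by
  have hd := h.cast_one_le
  have h1 : 2 * ‖f z‖ ≤ ‖f w‖ := by
    have e : (2 : ℝ) ≤ Real.exp (d * (3 / 4)) := by
      have h1 := Real.quadratic_le_exp_of_nonneg (x := (3 / 4 : ℝ)) (by norm_num)
      have h2 : Real.exp (3 / 4) ≤ Real.exp (d * (3 / 4)) := by gcongr; linarith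
      linarith
    calc 2 * ‖f z‖ ≤ Real.exp (d * (3 / 4)) * Real.exp (d * (z.re + 1 / 8)) := by
          gcongr
          exact h.norm_le hz
      _ = Real.exp (d * (z.re + 7 / 8)) := by rw [← Real.exp_add]; ring_nf
      _ ≤ Real.exp (d * (w.re - 1 / 8)) := by gcongr; linarith
      _ ≤ _ := h.le_norm hw
  refine ⟨h1, ?_⟩
  have h2 := abs_le.1 (hm'.abs_im_sub_le h hfw hfz hm)
  have h3 := abs_le.1 (Complex.abs_im_le_norm (f z))
  have h4 : (f w).im ^ 2 ≤ (‖f z‖ + 4) ^ 2 := by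
    apply sq_le_sq'
    · linarith [h2.1, h3.1]
    · linarith [h2.2, h3.2]
  have h5 : ‖f w‖ ^ 2 = (f w).re ^ 2 + (f w).im ^ 2 := by
    rw [Complex.sq_norm, Complex.normSq_apply]; ring
  have h6 : 100 ≤ ‖f z‖ := by
    linarith [h.big, (le_abs_self _).trans (Complex.abs_re_le_norm (f z))]
  have h7 : (2 * ‖f z‖) ^ 2 ≤ ‖f w‖ ^ 2 := by gcongr
  have h8 : 0 ≤ (f w).re := by linarith [h.big]
  nlinarith

/-- A point with a head start over an orbit of the same address keeps growing like an orbit of a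
larger potential. -/
lemma tailSet.lower_growth (h : IsLarge f d R) (hz : z ∈ tailSet f d R s)
    (hw : w ∈ tailSet f d R s) {v : ℝ} (hwv : v + 1 ≤ w.re) (hzw : ‖z‖ + 3 ≤ w.re)
    (k : ℕ) : (F d)^[k] v + 1 ≤ (f^[k] w).re ∧ ‖f^[k] z‖ + 3 ≤ (f^[k] w).re := by
  have hd := h.cast_one_le
  induction k with
  | zero => exact ⟨hwv, hzw⟩
  | succ k ih =>
    have hz1 := hz (k + 1)
    have hw1 := hw (k + 1)
    rw [Function.iterate_succ_apply'] at hz1 hw1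
    rw [Function.iterate_succ_apply', Function.iterate_succ_apply', Function.iterate_succ_apply']
    have hre : (f^[k] z).re ≤ ‖f^[k] z‖ := (le_abs_self _).trans (Complex.abs_re_le_norm _)
    obtain ⟨h1, h2⟩ := InStrip.head_start h (hz k).1 (hw k).1 hz1.1 hw1.1 hz1.2 hw1.2
      (by linarith [ih.2])
    refine ⟨?_, h2⟩
    set u := (F d)^[k] v
    set x := ‖f (f^[k] w)‖
    have hx : Real.exp (d * (u + 7 / 8)) ≤ x := by
      refine le_trans ?_ (h.le_norm (hw k).1)
      gcongr; linarith [ih.1]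
    have h3 := abs_le.1 (hw1.2.abs_im_sub_le h hw1.1 hz1.1 hz1.2)
    have h4 := abs_le.1 (Complex.abs_im_le_norm (f (f^[k] z)))
    have h5 : (f (f^[k] w)).im ^ 2 ≤ (x / 2 + 4) ^ 2 := by
      apply sq_le_sq'
      · linarith [h3.1, h4.1]
      · linarith [h3.2, h4.2]
    have h6 : x ^ 2 = (f (f^[k] w)).re ^ 2 + (f (f^[k] w)).im ^ 2 := by
      rw [Complex.sq_norm, Complex.normSq_apply]; ring
    have h7 : 100 ≤ x := by
      linarith [h.big, hw1.1, (le_abs_self _).trans (Complex.abs_re_le_norm (f (f^[k] w)))]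
    have h8 : 0 ≤ (f (f^[k] w)).re := by linarith [h.big, hw1.1]
    have h9 : 0.8 * x ≤ (f (f^[k] w)).re := by
      apply le_of_sq_le_sq _ h8
      nlinarith
    have h10 : Real.exp (d * (u + 7 / 8)) = Real.exp (d * u) * Real.exp (d * (7 / 8)) := by
      rw [← Real.exp_add]; ring_nf
    have h11 := Real.add_one_le_exp (d * (7 / 8) : ℝ)
    have h12 := Real.exp_pos (d * u)
    simp only [F]
    nlinarith

/-- A head start in real part forces a larger potential. -/
lemma tailSet.pot_lt (h : IsLarge f d R) (hz : z ∈ tailSet f d R s) (hw : w ∈ tailSet f d R s)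
    {t u : ℝ} (ht : HasPot f d z t) (hu : HasPot f d w u) (hzw : z.re + 1 ≤ w.re) : t < u := by
  have hd := h.one_le
  have hz1 := tailSet.map hz
  have hw1 := tailSet.map hw
  obtain ⟨-, h2⟩ := InStrip.head_start h (tailSet.re hz) (tailSet.re hw) (tailSet.re hz1)
    (tailSet.re hw1) (hz1 0).2 (hw1 0).2 hzw
  rw [← (F_strictMono hd).lt_iff_lt]
  have h1 : F d t ≤ ‖f z‖ + 1 := by
    by_contra! hlt
    obtain ⟨b, hb1, hb2⟩ := exists_between hlt
    obtain ⟨n, hn⟩ := ((ht.map hd).ge b (lt_trans (by positivity) hb1) hb2).exists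
    have h3 := tailSet.norm_iterate_le h hz1 (u := ‖f z‖ + 1) (by linarith) n
    have h4 := F_iterate_strictMono hd n hb1
    linarith
  have h2 : ‖f z‖ + 2 ≤ F d u := by
    by_contra! hlt
    obtain ⟨b, hb1, hb2⟩ := exists_between hlt
    obtain ⟨n, hn⟩ := ((hu.map hd).le b hb1).exists
    have h3 := (tailSet.lower_growth h hz1 hw1 (v := ‖f z‖ + 2) (by linarith) h2 n).1
    have h4 := F_iterate_strictMono hd n hb2
    have h5 : (f^[n] (f w)).re ≤ ‖f^[n] (f w)‖ :=
      (le_abs_self _).trans (Complex.abs_re_le_norm _)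
    linarith
  linarith

/-- Points of smaller potential stay to the left, up to an error of size one, along the whole orbit. -/
lemma tailSet.re_iterate_lt (h : IsLarge f d R) (hz : z ∈ tailSet f d R s)
    (hw : w ∈ tailSet f d R s) {t u : ℝ} (ht : HasPot f d z t) (hu : HasPot f d w u)
    (htu : t ≤ u) (k : ℕ) : (f^[k] z).re < (f^[k] w).re + 1 := by
  by_contra! hcon
  have h1 := tailSet.pot_lt h (tailSet.iterate hw k) (tailSet.iterate hz k)
    (hu.iterate h.one_le k) (ht.iterate h.one_le k) hcon
  exact absurd ((F_iterate_strictMono h.one_le k).monotone htu) (not_le.2 h1)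

lemma tailSet.norm_iterate_sub_le (h : IsLarge f d R) (hz : z ∈ tailSet f d R s)
    (hw : w ∈ tailSet f d R s) {C : ℝ} {k : ℕ} (hk : |(f^[k] z).re - (f^[k] w).re| ≤ C) :
    ‖f^[k] z - f^[k] w‖ ≤ C + 4 := by
  refine (Complex.norm_le_abs_re_add_abs_im _).trans ?_
  rw [Complex.sub_re, Complex.sub_im]
  exact add_le_add hk ((hz k).2.abs_im_sub_le h (hz k).1 (hw k).1 (hw k).2)

lemma norm_le_of_re_le (hz : 0 ≤ z.re) {C : ℝ} (hre : z.re ≤ w.re + C)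
    (him : |z.im - w.im| ≤ 4) (hC : 0 ≤ C) : ‖z‖ ≤ ‖w‖ + (C + 4) := by
  have h1 : ‖z‖ ≤ ‖(⟨z.re, w.im⟩ : ℂ)‖ + 4 := by
    refine (norm_le_norm_add_norm_sub' z ⟨z.re, w.im⟩).trans ?_
    gcongr
    refine (Complex.norm_le_abs_re_add_abs_im _).trans ?_
    simpa using him
  have h2 : ‖(⟨z.re, w.im⟩ : ℂ)‖ ≤ ‖w‖ + C := by
    refine le_trans ?_ (show ‖w + C‖ ≤ ‖w‖ + C from (norm_add_le _ _).trans (by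
      rw [Complex.norm_real, Real.norm_of_nonneg hC]))
    rw [Complex.norm_def, Complex.norm_def]
    apply Real.sqrt_le_sqrt
    simp only [Complex.normSq_apply, Complex.add_re, Complex.add_im, Complex.ofReal_re,
      Complex.ofReal_im, add_zero]
    nlinarith
  linarith

/-- Converse of `tailSet.re_iterate_lt`. -/
lemma tailSet.pot_le (h : IsLarge f d R) (hz : z ∈ tailSet f d R s) (hw : w ∈ tailSet f d R s)
    {t u C : ℝ} (ht : HasPot f d z t) (hu : HasPot f d w u) (hC : 0 ≤ C)
    (hre : ∀ k : ℕ, (f^[k] z).re ≤ (f^[k] w).re + C) : t ≤ u := by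
  refine ht.le_of_norm_le h.one_le hu (C := C + 4) (Eventually.of_forall fun k => ?_)
  exact norm_le_of_re_le (by linarith [h.big, (hz k).1]) (hre k)
    ((hz k).2.abs_im_sub_le h (hz k).1 (hw k).1 (hw k).2) hC

/-- Since `f` expands inside strips, two orbits with the same address that stay a bounded distance
apart agree. -/
lemma tailSet.eq_of_bounded (h : IsLarge f d R) (hz : z ∈ tailSet f d R s)
    (hw : w ∈ tailSet f d R s) {C : ℝ} (hC : ∀ k : ℕ, ‖f^[k] z - f^[k] w‖ ≤ C) : z = w := by
  have h1 : ∀ k : ℕ, ‖z - w‖ ≤ (1 / 2) ^ k * ‖f^[k] z - f^[k] w‖ := by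
    intro k
    induction k with
    | zero => simp
    | succ k ih =>
      have hz1 := hz (k + 1)
      have hw1 := hw (k + 1)
      rw [Function.iterate_succ_apply'] at hz1 hw1
      rw [Function.iterate_succ_apply', Function.iterate_succ_apply', pow_succ, mul_assoc]
      refine ih.trans ?_
      gcongr
      exact InStrip.expand h (hz k).1 (hw k).1 hz1.1 hw1.1 (hz k).2 (hw k).2
  have h2 : Tendsto (fun k : ℕ => (1 / 2 : ℝ) ^ k * C) atTop (𝓝 (0 * C)) :=
    (tendsto_pow_atTop_nhds_zero_of_lt_one (by norm_num) (by norm_num)).mul_const C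
  rw [zero_mul] at h2
  have h3 : ‖z - w‖ ≤ 0 := ge_of_tendsto h2 (Eventually.of_forall fun k =>
    (h1 k).trans (by gcongr; exact hC k))
  exact sub_eq_zero.1 (norm_le_zero_iff.1 h3)

/-- A point of `tailSet` is determined by its address and its potential. -/
lemma tailSet.eq_of_pot (h : IsLarge f d R) (hz : z ∈ tailSet f d R s)
    (hw : w ∈ tailSet f d R s) {t : ℝ} (ht : HasPot f d z t) (hu : HasPot f d w t) : z = w := by
  refine tailSet.eq_of_bounded h hz hw (C := 1 + 4) fun k =>
    tailSet.norm_iterate_sub_le h hz hw ?_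
  have h1 := tailSet.re_iterate_lt h hz hw ht hu le_rfl k
  have h2 := tailSet.re_iterate_lt h hw hz hu ht le_rfl k
  rw [abs_le]
  constructor <;> linarith

/-- The imaginary parts of an orbit, and with them the entries of its address, grow at most as fast
as the potential allows. -/
lemma tailSet.mem_boundSet (h : IsLarge f d R) (hz : z ∈ tailSet f d R s) {t u : ℝ}
    (ht : HasPot f d z t) (htu : t < u) : u ∈ boundSet d s := by
  obtain ⟨v, hv1, hv2⟩ := exists_between htu
  have hv0 : 0 < v := ht.nonneg.trans_lt hv1
  refine mem_boundSet_of_eventually_le h.one_le hv0 hv2 (K := 2 * d) ?_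
  filter_upwards [ht.le v hv1] with n hn
  have hd := h.cast_one_le
  have h1 := abs_le.1 ((hz n).2.abs_im_le h (hz n).1)
  have h2 := abs_le.1 ((Complex.abs_im_le_norm _).trans hn)
  have h3 : |2 * Real.pi * s n / d| ≤ (F d)^[n] v + 2 := by
    rw [abs_le]; constructor <;> linarith [h1.1, h1.2, h2.1, h2.2]
  have hpi := Real.pi_gt_three
  have h4 : |2 * Real.pi * s n / d| = 2 * Real.pi * |(s n : ℝ)| / d := by
    rw [abs_div, abs_mul, abs_of_pos (by positivity : 0 < 2 * Real.pi),
      abs_of_pos (by positivity : (0 : ℝ) < d)]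
  rw [h4, div_le_iff₀ (by positivity)] at h3
  have h5 := F_iterate_pos h.one_le n hv0
  nlinarith [abs_nonneg (s n : ℝ)]

lemma tailSet.minPotential_le (h : IsLarge f d R) (hz : z ∈ tailSet f d R s) {t : ℝ}
    (ht : HasPot f d z t) : minPotential d s ≤ t := by
  refine le_of_forall_gt fun u hu => ?_
  obtain ⟨v, hv1, hv2⟩ := exists_between hu
  exact (PolyExp.minPotential_le (tailSet.mem_boundSet h hz ht hv1)).trans_lt hv2

lemma tailSet.expBounded (h : IsLarge f d R) (hz : z ∈ tailSet f d R s) : ExpBounded d s := by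
  obtain ⟨t, ht⟩ := tailSet.exists_hasPot h hz
  exact ⟨_, tailSet.mem_boundSet h hz ht (lt_add_one t)⟩

/-! ### Existence of points with prescribed address and potential -/

/-- The potential `u` is large for the address `s`: the orbit of `u` under `F` dominates the
imaginary parts of the strips prescribed by `s`. Then the points `F^k(u) + 2πi s_k/d` are close to
an orbit of `f`. -/
structure IsStd (d : ℕ) (R : ℝ) (s : ℕ → ℤ) (u : ℝ) : Prop where
  big : Real.exp (d * (R + 1)) + R + 100 ≤ u
  cone : ∀ k : ℕ, 2 * Real.pi * |(s k : ℝ)| / d ≤ (F d)^[k] u / 10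

lemma stripPoint_re (d : ℕ) (n : ℤ) (t : ℝ) : (stripPoint d n t).re = t := by
  simp [stripPoint, Complex.div_natCast_re]

lemma stripPoint_im (d : ℕ) (n : ℤ) (t : ℝ) : (stripPoint d n t).im = 2 * Real.pi * n / d := by
  simp [stripPoint, Complex.div_natCast_im]

lemma InStrip.of_tendsto {ι : Type*} {l : Filter ι} [l.NeBot] (h : IsLarge f d R) {x : ι → ℂ}
    (hx : Tendsto x l (𝓝 z)) (hz : R ≤ z.re) {n : ℤ} (hn : ∀ᶠ i in l, InStrip f d n (x i)) :
    InStrip f d n z := by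
  have h1 := Complex.continuous_im.continuousAt.comp (h.continuousAt_chart z hz)
  have h2 : ContinuousAt (fun z => |(chart f d z).im - 2 * Real.pi * n / d|) z :=
    (h1.sub continuousAt_const).abs
  exact le_of_tendsto (h2.tendsto.comp hx) hn

/-- If `f z` is close to a model point, then `Φ(z)` is close to the preceding one, with an error that
is exponentially small in the potential. -/
lemma chart_sub_stripPoint_le (h : IsLarge f d R) (hz : R ≤ z.re) {m n : ℤ} {u : ℝ}
    (hn : InStrip f d n z) (hfz : ‖f z - stripPoint d m (F d u)‖ ≤ 1)
    (hsmall : (2 + 2 * Real.pi * |(m : ℝ)| / d) * Real.exp (-(d * u)) ≤ 1 / 2) :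
    ‖chart f d z - stripPoint d n u‖ ≤
      3 / 2 * ((2 + 2 * Real.pi * |(m : ℝ)| / d) * Real.exp (-(d * u))) := by
  have hd := h.cast_one_le
  set E := Real.exp (d * u) with hE
  have hE0 : 0 < E := Real.exp_pos _
  set δ : ℂ := f z / E - 1 with hδ
  have hfz' : f z = (E : ℂ) * (1 + δ) := by
    have : (E : ℂ) ≠ 0 := by exact_mod_cast hE0.ne'
    rw [hδ]; field_simp; ring
  have h1 : ‖f z - E‖ ≤ 2 + 2 * Real.pi * |(m : ℝ)| / d := by
    have e : f z - E = (f z - stripPoint d m (F d u)) + (stripPoint d m (F d u) - E) := by ring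
    have e2 : stripPoint d m (F d u) - E = -1 + (2 * Real.pi * m / d : ℝ) * Complex.I := by
      simp only [stripPoint, F, ← hE]; push_cast; ring
    rw [e]
    refine (norm_add_le _ _).trans ?_
    have h3 : ‖stripPoint d m (F d u) - E‖ ≤ 1 + 2 * Real.pi * |(m : ℝ)| / d := by
      rw [e2]
      refine (norm_add_le _ _).trans ?_
      rw [norm_neg, norm_one, norm_mul, Complex.norm_I, mul_one, Complex.norm_real,
        Real.norm_eq_abs, abs_div, abs_mul, abs_of_pos (by positivity : 0 < 2 * Real.pi),
        abs_of_pos (by positivity : (0 : ℝ) < d)]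
    linarith
  have h2 : ‖δ‖ ≤ (2 + 2 * Real.pi * |(m : ℝ)| / d) * Real.exp (-(d * u)) := by
    have : δ = (f z - E) * (Real.exp (-(d * u)) : ℝ) := by
      have : (E : ℂ) ≠ 0 := by exact_mod_cast hE0.ne'
      rw [Real.exp_neg, ← hE, hδ]; push_cast; field_simp
    rw [this, norm_mul, Complex.norm_real, Real.norm_of_nonneg (Real.exp_pos _).le]
    gcongr
  have h3 : ‖Complex.log (1 + δ)‖ ≤ 3 / 2 * ‖δ‖ :=
    Complex.norm_log_one_add_half_le_self (h2.trans hsmall)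
  have h4 : (1 : ℂ) + δ ≠ 0 := by
    intro h0
    have : δ = -1 := by linear_combination h0
    rw [this] at h2
    norm_num at h2
    linarith
  have h5 : Complex.log (f z) = (d * u : ℝ) + Complex.log (1 + δ) := by
    rw [hfz', Complex.log_ofReal_mul hE0 h4, hE, Real.log_exp]
  have h6 : d * (chart f d z - stripPoint d n u) = Complex.log (1 + δ) := by
    rw [mul_sub, hn.mul_chart h hz, h5, stripPoint]
    have := h.ne_zero
    push_cast
    field_simp
    ring
  have h7 : ‖chart f d z - stripPoint d n u‖ ≤ ‖Complex.log (1 + δ)‖ := by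
    rw [← h6, norm_mul, Complex.norm_natCast]
    exact le_mul_of_one_le_left (norm_nonneg _) hd
  linarith

lemma IsStd.shift_one (h : 1 ≤ d) {u : ℝ} (hu : IsStd d R s u) (hu0 : 0 ≤ u) :
    IsStd d R (shift 1 s) (F d u) := by
  refine ⟨hu.big.trans (le_F h hu0), fun k => ?_⟩
  have := hu.cone (k + 1)
  rw [Function.iterate_succ_apply] at this
  simpa [shift, add_comm] using this

lemma IsStd.nonneg (h : IsLarge f d R) {u : ℝ} (hu : IsStd d R s u) : 0 ≤ u := by
  linarith [hu.big, Real.exp_pos (d * (R + 1)), h.big]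

lemma IsStd.smallness (h : IsLarge f d R) {u : ℝ} (hu : IsStd d R s u) :
    (2 + 2 * Real.pi * |(s 1 : ℝ)| / d) * Real.exp (-(d * u)) ≤ 1 / 2 := by
  have hd := h.cast_one_le
  have h1 := hu.cone 1
  simp only [Function.iterate_one, F] at h1
  have h2 : 100 ≤ Real.exp (d * u) := by
    have h3 := Real.add_one_le_exp (d * u)
    have h4 := hu.big
    have h5 := Real.exp_pos (d * (R + 1))
    have h6 := h.big
    nlinarith
  rw [Real.exp_neg, ← div_eq_mul_inv, div_le_iff₀ (by positivity)]
  linarith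

/-- One step of pulling back along the model orbit. -/
lemma IsStd.exists_preimage (h : IsLarge f d R) {u : ℝ} (hu : IsStd d R s u)
    (hw : ‖w - stripPoint d (s 1) (F d u)‖ ≤ 1) :
    ∃ z, f z = w ∧ InStrip f d (s 0) z ∧ ‖z - stripPoint d (s 0) u‖ ≤ 1 := by
  have hu0 := hu.nonneg h
  have h1 := le_F h.one_le hu0
  have h2 := (Complex.abs_re_le_norm _).trans hw
  rw [Complex.sub_re, stripPoint_re] at h2
  have h3 := (abs_le.1 h2).1
  have h4 := hu.big
  have h5 := Real.exp_pos (d * (R + 1))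
  have h6 := h.big
  obtain ⟨z, hz, rfl, hsz, -⟩ := h.exists_preimage (s 0) (ζ := w) (by linarith)
    ((by linarith : _ ≤ w.re).trans ((le_abs_self _).trans (Complex.abs_re_le_norm w)))
  refine ⟨z, rfl, hsz, ?_⟩
  have h7 := chart_sub_stripPoint_le h hz hsz hw (hu.smallness h)
  have h8 := h.near z hz
  have h9 := hu.smallness h
  have h10 : ‖z - stripPoint d (s 0) u‖ ≤ ‖chart f d z - stripPoint d (s 0) u‖ +
      ‖chart f d z - z‖ := by
    refine le_trans (le_of_eq ?_) (norm_sub_le _ _)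
    congr 1; ring
  linarith

/-- An orbit that follows the model orbit for `n` steps. -/
lemma IsStd.exists_finite (h : IsLarge f d R) (n : ℕ) {s : ℕ → ℤ} {u : ℝ}
    (hu : IsStd d R s u) : ∃ z, ∀ k ≤ n, ‖f^[k] z - stripPoint d (s k) ((F d)^[k] u)‖ ≤ 1 ∧
      (k < n → InStrip f d (s k) (f^[k] z)) := by
  induction n generalizing s u with
  | zero => exact ⟨stripPoint d (s 0) u, fun k hk => by simp [Nat.le_zero.1 hk]⟩
  | succ n ih =>
    obtain ⟨w, hw⟩ := ih (hu.shift_one h.one_le (hu.nonneg h))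
    obtain ⟨z, rfl, h1, h2⟩ := hu.exists_preimage h (hw 0 n.zero_le).1
    refine ⟨z, fun k hk => ?_⟩
    cases k with
    | zero => exact ⟨h2, fun _ => h1⟩
    | succ k =>
      have := hw k (by omega)
      rw [Function.iterate_succ_apply, Function.iterate_succ_apply]
      simp only [shift, add_comm 1 k] at this
      exact ⟨this.1, fun hk => this.2 (by omega)⟩

/-- For large potentials there is a point with the given address and potential, whose orbit
follows the points `F^k(u) + 2πi s_k/d`. -/
theorem IsStd.exists_mem_tailSet (h : IsLarge f d R) {u : ℝ} (hu : IsStd d R s u) :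
    ∃ z ∈ tailSet f d R s, HasPot f d z u ∧
      ∀ k : ℕ, ‖f^[k] z - stripPoint d (s k) ((F d)^[k] u)‖ ≤ 1 := by
  choose x hx using fun n => hu.exists_finite h n
  obtain ⟨z, -, φ, hφ, hlim⟩ := (isCompact_closedBall (stripPoint d (s 0) u) 1).tendsto_subseq
    (x := x) fun n => mem_closedBall_iff_norm.2 (hx n 0 n.zero_le).1
  have hcont : ∀ k, Tendsto (fun i => f^[k] (x (φ i))) atTop (𝓝 (f^[k] z)) := fun k =>
    (h.differentiable.continuous.iterate k).continuousAt.tendsto.comp hlim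
  have h1 : ∀ k : ℕ, ‖f^[k] z - stripPoint d (s k) ((F d)^[k] u)‖ ≤ 1 := by
    intro k
    refine le_of_tendsto ((hcont k).sub_const _).norm ?_
    filter_upwards [hφ.tendsto_atTop.eventually_ge_atTop k] with i hi using (hx _ k hi).1
  have hu0 := hu.nonneg h
  have hu0' : 0 < u := by linarith [hu.big, Real.exp_pos (d * (R + 1)), h.big]
  have hre : ∀ k : ℕ, |(f^[k] z).re - (F d)^[k] u| ≤ 1 := by
    intro k
    have := (Complex.abs_re_le_norm _).trans (h1 k)
    rwa [Complex.sub_re, stripPoint_re] at this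
  have him : ∀ k : ℕ, |(f^[k] z).im| ≤ 1 + (F d)^[k] u / 10 := by
    intro k
    have h2 := (Complex.abs_im_le_norm _).trans (h1 k)
    rw [Complex.sub_im, stripPoint_im] at h2
    have h3 := hu.cone k
    have hd := h.cast_one_le
    have h4 : |2 * Real.pi * s k / d| = 2 * Real.pi * |(s k : ℝ)| / d := by
      rw [abs_div, abs_mul, abs_of_pos (by positivity : 0 < 2 * Real.pi),
        abs_of_pos (by positivity : (0 : ℝ) < d)]
    rw [← h4] at h3
    have h5 := abs_le.1 h3
    have h6 := abs_le.1 h2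
    rw [abs_le]; constructor <;> linarith [h5.1, h5.2, h6.1, h6.2]
  have hR : ∀ k : ℕ, R ≤ (f^[k] z).re := by
    intro k
    have h2 := (abs_le.1 (hre k)).1
    have h3 := le_F_iterate h.one_le hu0 k
    linarith [hu.big, Real.exp_pos (d * (R + 1))]
  refine ⟨z, fun k => ⟨hR k, InStrip.of_tendsto h (hcont k) (hR k) ?_⟩,
    ⟨hu0, fun v hv => ?_, fun v hv0 hv => ?_⟩, h1⟩
  · filter_upwards [hφ.tendsto_atTop.eventually_gt_atTop k] with i hi using (hx _ k hi.le).2 hi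
  · filter_upwards [eventually_mul_F_iterate_add_le h.one_le hu0' hv 2] with n hn
    have h2 := Complex.norm_le_abs_re_add_abs_im (f^[n] z)
    have h3 : |(f^[n] z).re| ≤ 1 + (F d)^[n] u := by
      have := abs_le.1 (hre n)
      have h4 := F_iterate_nonneg h.one_le n hu0
      rw [abs_le]; constructor <;> linarith [this.1, this.2]
    linarith [him n, F_iterate_nonneg h.one_le n hu0]
  · filter_upwards [eventually_mul_F_iterate_add_le h.one_le hv0 hv 1] with n hn
    have h2 := (le_abs_self _).trans (Complex.abs_re_le_norm (f^[n] z))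
    linarith [(abs_le.1 (hre n)).1]

/-- Every potential above the minimal one becomes large for the shifted address after some steps. -/
lemma eventually_isStd_shift (hd : 1 ≤ d) (R : ℝ) {t : ℝ} (ht : t ∈ boundSet d s) :
    ∀ᶠ n : ℕ in atTop, ∀ u, (F d)^[n] t ≤ u → IsStd d R (shift n s) u := by
  have h1 := (Metric.tendsto_nhds.1 ht.2) (1 / (20 * Real.pi)) (by positivity)
  obtain ⟨N, hN⟩ := eventually_atTop.1 h1
  filter_upwards [eventually_ge_atTop N, (tendsto_F_iterate hd ht.1).eventually_ge_atTop
    (Real.exp (d * (R + 1)) + R + 100)] with n hn hn2 u hu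
  refine ⟨hn2.trans hu, fun k => ?_⟩
  have h2 := hN (n + k) (by omega)
  have h3 := F_iterate_pos hd (n + k) ht.1
  rw [dist_zero_right, norm_div, Real.norm_eq_abs, Real.norm_of_nonneg h3.le,
    div_lt_iff₀ h3] at h2
  have h4 : (F d)^[n + k] t ≤ (F d)^[k] u := by
    rw [add_comm, Function.iterate_add_apply]
    exact (F_iterate_strictMono hd k).monotone hu
  have hd' : (1 : ℝ) ≤ d := by exact_mod_cast hd
  have hpi := Real.pi_pos
  calc 2 * Real.pi * |(shift n s k : ℝ)| / d ≤ 2 * Real.pi * |(shift n s k : ℝ)| :=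
        div_le_self (by positivity) hd'
    _ ≤ 2 * Real.pi * (1 / (20 * Real.pi) * (F d)^[n + k] t) := by
        gcongr; exact h2.le
    _ = (F d)^[n + k] t / 10 := by field_simp; norm_num
    _ ≤ _ := by gcongr

lemma exists_isStd (hd : 1 ≤ d) (R : ℝ) (hs : ExpBounded d s) :
    ∃ U, ∀ u, U ≤ u → IsStd d R s u := by
  obtain ⟨t, ht0, ht⟩ := hs
  obtain ⟨B, hB⟩ := ht.norm.bddAbove_range
  have hB' : ∀ k, |(s k : ℝ)| ≤ max B 1 * (F d)^[k] t := by
    intro k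
    have h1 : ‖(s k : ℝ) / (F d)^[k] t‖ ≤ max B 1 := (hB ⟨k, rfl⟩).trans (le_max_left _ _)
    have h2 := F_iterate_pos hd k ht0
    rwa [norm_div, Real.norm_eq_abs, Real.norm_of_nonneg h2.le, div_le_iff₀ h2] at h1
  have hpi := Real.pi_gt_three
  have hB1 : 1 ≤ max B 1 := le_max_right _ _
  have hd' : (1 : ℝ) ≤ d := by exact_mod_cast hd
  refine ⟨max (Real.exp (d * (R + 1)) + R + 100) (20 * Real.pi * max B 1 * t), fun u hu =>
    ⟨(le_max_left _ _).trans hu, fun k => ?_⟩⟩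
  have h1 : 20 * Real.pi * max B 1 * (F d)^[k] t ≤ (F d)^[k] u :=
    (mul_F_iterate_le hd (by nlinarith) k).trans
      ((F_iterate_strictMono hd k).monotone ((le_max_right _ _).trans hu))
  calc 2 * Real.pi * |(s k : ℝ)| / d ≤ 2 * Real.pi * |(s k : ℝ)| :=
        div_le_self (by positivity) hd'
    _ ≤ 2 * Real.pi * (max B 1 * (F d)^[k] t) := by gcongr; exact hB' k
    _ ≤ _ := by linarith

/-- The set of potentials realised in `tailSet` is upward closed: a point of larger potential is
obtained by pulling back a point far out along the orbit, which stays to the right of the given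
orbit. -/
theorem tailSet.exists_pot_gt (h : IsLarge f d R) (hw : w ∈ tailSet f d (R + 2) s) {t u : ℝ}
    (ht : HasPot f d w t) (htu : t < u) : ∃ z ∈ tailSet f d R s, HasPot f d z u := by
  have hd := h.one_le
  have hu0 : 0 < u := ht.nonneg.trans_lt htu
  have hub : u ∈ boundSet d s := tailSet.mem_boundSet (h.mono (by linarith)) hw ht htu
  obtain ⟨n, hn⟩ := (eventually_isStd_shift hd R hub).exists
  obtain ⟨v, hv, hvu, -⟩ := (hn _ le_rfl).exists_mem_tailSet h
  clear hn hub
  induction n generalizing w s t u with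
  | zero => exact ⟨v, by rwa [shift_zero] at hv, hvu⟩
  | succ n ih =>
    rw [Function.iterate_succ_apply] at hvu
    rw [add_comm, ← shift_shift] at hv
    obtain ⟨y, hy, hyu⟩ := ih (tailSet.map hw) (ht.map hd) (F_strictMono hd htu)
      (by simpa using F_iterate_pos hd 1 hu0) hv hvu
    have hfw := tailSet.mono (by linarith : R ≤ R + 2) (tailSet.map hw)
    have hwR : R + 2 ≤ w.re := tailSet.re hw
    have h1 := tailSet.re_iterate_lt h hfw hy (ht.map hd) hyu (F_strictMono hd htu).le 0
    simp only [Function.iterate_zero, id] at h1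
    have h2 : ‖f w‖ ≤ ‖y‖ + (1 + 4) :=
      norm_le_of_re_le (by linarith [tailSet.re hfw, h.big]) h1.le
        ((hfw 0).2.abs_im_sub_le h (tailSet.re hfw) (tailSet.re hy) (hy 0).2) zero_le_one
    have hd' := h.cast_one_le
    have h3 := h.le_norm (z := w) (by linarith)
    -- `‖y‖` is at least about `‖f w‖`, hence the preimage of `y` is not much to the left of `w`
    have h4 : (2 : ℝ) ≤ Real.exp (d * (7 / 8)) := by
      have h5 : (7 / 8 : ℝ) ≤ d * (7 / 8) := by nlinarith
      have := Real.quadratic_le_exp_of_nonneg (x := (7 / 8 : ℝ)) (by norm_num)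
      have := Real.exp_le_exp.2 h5
      linarith
    have h5 : Real.exp (d * (w.re - 1 / 8)) =
        Real.exp (d * (w.re - 1)) * Real.exp (d * (7 / 8)) := by
      rw [← Real.exp_add]; ring_nf
    have h6 : Real.exp (d * (R + 1)) ≤ Real.exp (d * (w.re - 1)) := by
      gcongr; linarith
    have h7 : (100 : ℝ) ≤ Real.exp (d * (R + 1)) := by
      have := Real.add_one_le_exp (d * (R + 1))
      have := h.big
      nlinarith
    obtain ⟨z, hz, rfl, hsz, -⟩ := h.exists_preimage (s 0) (ζ := y)
      (by linarith [tailSet.re hy, h.big]) (by nlinarith)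
    exact ⟨z, tailSet.cons hz hsz hy, hyu.of_map hd hu0.le⟩

/-! ### Points and potentials depend continuously on each other -/

lemma mem_of_mapClusterPt {X ι : Type*} [TopologicalSpace X] {l : Filter ι} {x : ι → X} {a : X}
    {C : Set X} (hC : IsClosed C) (ha : MapClusterPt a l x) (hx : ∀ᶠ i in l, x i ∈ C) : a ∈ C := by
  rw [← hC.closure_eq, mem_closure_iff_clusterPt]
  exact ClusterPt.mono ha (le_principal_iff.2 hx)

lemma isClosed_re_iterate_le (hf : Continuous f) (g : ℕ → ℝ) :
    IsClosed {y : ℂ | ∀ k : ℕ, (f^[k] y).re ≤ g k} := by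
  have : {y : ℂ | ∀ k : ℕ, (f^[k] y).re ≤ g k} = ⋂ k, {y | (f^[k] y).re ≤ g k} := by
    ext y; simp
  rw [this]
  exact isClosed_iInter fun k =>
    isClosed_le (Complex.continuous_re.comp (hf.iterate k)) continuous_const

lemma isClosed_le_re_iterate (hf : Continuous f) (g : ℕ → ℝ) :
    IsClosed {y : ℂ | ∀ k : ℕ, g k ≤ (f^[k] y).re} := by
  have : {y : ℂ | ∀ k : ℕ, g k ≤ (f^[k] y).re} = ⋂ k, {y | g k ≤ (f^[k] y).re} := by
    ext y; simp
  rw [this]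
  exact isClosed_iInter fun k =>
    isClosed_le continuous_const (Complex.continuous_re.comp (hf.iterate k))

/-- The point with a given address depends continuously on its potential, also at the smallest
possible potential. -/
theorem tailSet.tendsto_of_pot {ι : Type*} {l : Filter ι} (h : IsLarge f d R) {x : ι → ℂ}
    {T : ι → ℝ} {t : ℝ} (hx : ∀ᶠ i in l, x i ∈ tailSet f d (R + 2) s ∧ HasPot f d (x i) (T i))
    (hz : z ∈ tailSet f d (R + 2) s) (ht : HasPot f d z t) (hT : Tendsto T l (𝓝 t)) :
    Tendsto x l (𝓝 z) := by
  have hRR : R ≤ R + 2 := by linarith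
  have hfc := h.differentiable.continuous
  obtain ⟨v, hv, hvt⟩ := tailSet.exists_pot_gt h hz ht (lt_add_one t)
  refine (isCompact_closedBall (0 : ℂ) (‖v‖ + (1 + 4))).tendsto_nhds_of_unique_mapClusterPt ?_ ?_
  · filter_upwards [hx, hT.eventually_lt_const (lt_add_one t)] with i hi hTi
    rw [mem_closedBall_zero_iff]
    have hxi := tailSet.mono hRR hi.1
    have h1 := tailSet.re_iterate_lt h hxi hv hi.2 hvt hTi.le 0
    simp only [Function.iterate_zero, id] at h1
    exact norm_le_of_re_le (by linarith [tailSet.re hxi, h.big]) h1.le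
      ((hxi 0).2.abs_im_sub_le h (tailSet.re hxi) (tailSet.re hv) (hv 0).2) zero_le_one
  · intro a _ ha
    have haJ : a ∈ tailSet f d (R + 2) s :=
      mem_of_mapClusterPt (isClosed_tailSet (h.mono hRR) s) ha (hx.mono fun i hi => hi.1)
    have haJ' := tailSet.mono hRR haJ
    obtain ⟨u, hu⟩ := tailSet.exists_hasPot h haJ'
    -- a cluster point has the right potential: compare with points of nearby potentials
    have hut : u = t := by
      apply le_antisymm
      · refine le_of_forall_gt fun b hb => ?_
        obtain ⟨c, htc, hcb⟩ := exists_between hb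
        obtain ⟨y, hy, hyc⟩ := tailSet.exists_pot_gt h hz ht htc
        refine lt_of_le_of_lt (tailSet.pot_le h haJ' hy hu hyc zero_le_one ?_) hcb
        refine mem_of_mapClusterPt (isClosed_re_iterate_le hfc fun k => (f^[k] y).re + 1) ha ?_
        filter_upwards [hx, hT.eventually_lt_const htc] with i hi hTi k
        exact (tailSet.re_iterate_lt h (tailSet.mono hRR hi.1) hy hi.2 hyc hTi.le k).le
      · by_contra! hlt
        obtain ⟨c, huc, hct⟩ := exists_between hlt
        obtain ⟨y, hy, hyc⟩ := tailSet.exists_pot_gt h haJ hu huc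
        refine absurd (tailSet.pot_le h hy haJ' hyc hu zero_le_one fun k => ?_) (not_le.2 huc)
        rw [← sub_le_iff_le_add]
        revert k
        refine mem_of_mapClusterPt (isClosed_le_re_iterate hfc fun k => (f^[k] y).re - 1) ha ?_
        filter_upwards [hx, hT.eventually_const_lt hct] with i hi hTi k
        have := tailSet.re_iterate_lt h hy (tailSet.mono hRR hi.1) hyc hi.2 hTi.le k
        linarith
    rw [hut] at hu
    exact tailSet.eq_of_pot h haJ' (tailSet.mono hRR hz) hu ht

/-- Among the points with a given address, the potential is continuous. -/
theorem tailSet.tendsto_pot {ι : Type*} {l : Filter ι} (h : IsLarge f d R) {x : ι → ℂ}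
    {T : ι → ℝ} {t : ℝ} (hx : ∀ᶠ i in l, x i ∈ tailSet f d (R + 2) s ∧ HasPot f d (x i) (T i))
    (hz : z ∈ tailSet f d (R + 2) s) (ht : HasPot f d z t) (hT : Tendsto x l (𝓝 z)) :
    Tendsto T l (𝓝 t) := by
  have hRR : R ≤ R + 2 := by linarith
  have hfc := h.differentiable.continuous
  rw [tendsto_order]
  constructor
  · intro a hat
    by_contra hcon
    obtain ⟨c, hac, hct⟩ := exists_between hat
    have hfr : ∃ᶠ i in l, T i ≤ a := by simpa using Filter.not_eventually.1 hcon
    obtain ⟨i, hTi, hi⟩ := (hfr.and_eventually hx).exists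
    obtain ⟨y, hy, hyc⟩ := tailSet.exists_pot_gt h hi.1 hi.2 (hTi.trans_lt hac)
    refine absurd (tailSet.pot_le h (tailSet.mono hRR hz) hy ht hyc zero_le_one ?_) (not_le.2 hct)
    refine (isClosed_re_iterate_le hfc fun k => (f^[k] y).re + 1).mem_of_frequently_of_tendsto
      ((hfr.and_eventually hx).mono ?_) hT
    rintro i ⟨hTi, hi⟩ k
    exact (tailSet.re_iterate_lt h (tailSet.mono hRR hi.1) hy hi.2 hyc (hTi.trans hac.le) k).le
  · intro a hat
    by_contra hcon
    obtain ⟨c, htc, hca⟩ := exists_between hat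
    have hfr : ∃ᶠ i in l, a ≤ T i := by simpa using Filter.not_eventually.1 hcon
    obtain ⟨y, hy, hyc⟩ := tailSet.exists_pot_gt h hz ht htc
    refine absurd (tailSet.pot_le h hy (tailSet.mono hRR hz) hyc ht zero_le_one fun k => ?_)
      (not_le.2 htc)
    rw [← sub_le_iff_le_add]
    revert k
    refine (isClosed_le_re_iterate hfc fun k => (f^[k] y).re - 1).mem_of_frequently_of_tendsto
      ((hfr.and_eventually hx).mono ?_) hT
    rintro i ⟨hTi, hi⟩ k
    have := tailSet.re_iterate_lt h hy (tailSet.mono hRR hi.1) hyc hi.2 (hca.le.trans hTi) k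
    linarith

/-! ### Lifting through `f` away from the singular values -/

/-- `p(0)` is an asymptotic value of `p ∘ exp`. -/
lemma eval_zero_mem_singularValues (p : Polynomial ℂ) :
    p.eval 0 ∈ singularValues fun z => p.eval (Complex.exp z) := by
  refine subset_closure (Or.inr ⟨fun t => ((-t : ℝ) : ℂ), by fun_prop, ?_, ?_⟩)
  · rw [← tendsto_norm_atTop_iff_cobounded]
    simpa using! tendsto_abs_atTop_atTop
  · have h1 : Tendsto (fun t : ℝ => Complex.exp ((-t : ℝ) : ℂ)) atTop (𝓝 0) := by
      rw [tendsto_zero_iff_norm_tendsto_zero]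
      simpa [Complex.norm_exp] using! Real.tendsto_exp_neg_atTop_nhds_zero
    exact (p.continuous.tendsto 0).comp h1

lemma deriv_ne_zero_of_notMem (hz : f z ∉ singularValues f) : deriv f z ≠ 0 := fun h =>
  hz (subset_closure (Or.inl ⟨z, h, rfl⟩))

lemma eval_mem_singularValues {p : Polynomial ℂ} {c : ℂ} (hc : p.derivative.eval c = 0) :
    p.eval c ∈ singularValues fun z => p.eval (Complex.exp z) := by
  rcases eq_or_ne c 0 with rfl | h0
  · exact eval_zero_mem_singularValues p
  · refine subset_closure (Or.inl ⟨Complex.log c, ?_, by simp [Complex.exp_log h0]⟩)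
    have h1 := (p.hasDerivAt (Complex.exp (Complex.log c))).comp _
      (Complex.hasDerivAt_exp (Complex.log c))
    rw [Complex.exp_log h0, hc, zero_mul] at h1
    exact h1.deriv

/-- `f` is a composition of two covering maps away from its singular values, so maps of simply
connected spaces that avoid the singular values can be lifted. -/
theorem exists_lift {A : Type*} [TopologicalSpace A] [SimplyConnectedSpace A]
    [LocallyPathConnectedSpace A] (hf : f ∈ Family d) (δ : C(A, ℂ)) {a : A}
    (hδ : ∀ x, δ x ∉ singularValues f) (hz : f z = δ a) :
    ∃ η : C(A, ℂ), η a = z ∧ ∀ x, f (η x) = δ x := by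
  obtain ⟨p, -, -, rfl⟩ := hf
  obtain ⟨ω, ⟨hω1, hω2⟩, -⟩ := p.isCoveringMapOn_eval.existsUnique_continuousMap_lifts δ
    (a₀ := a) (e₀ := Complex.exp z) hz (by
      rintro x ⟨c, hc, hcx⟩
      exact hδ x (hcx ▸ eval_mem_singularValues hc))
  obtain ⟨η, ⟨hη1, hη2⟩, -⟩ := Complex.isCoveringMapOn_exp.existsUnique_continuousMap_lifts ω
    (a₀ := a) (e₀ := z) hω1.symm (by
      intro x hx
      have h1 : p.eval (ω x) = δ x := congrFun hω2 x
      rw [mem_singleton_iff.1 hx] at h1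
      exact hδ x (h1 ▸ eval_zero_mem_singularValues p))
  refine ⟨η, hη1, fun x => ?_⟩
  have h1 : Complex.exp (η x) = ω x := congrFun hη2 x
  have h2 : p.eval (ω x) = δ x := congrFun hω2 x
  simp only [h1, h2]

lemma exists_lift_Ioi (hf : f ∈ Family d) {δ : ℝ → ℂ} {b u₀ : ℝ} (hδ : ContinuousOn δ (Ioi b))
    (hδS : ∀ u, b < u → δ u ∉ singularValues f) (hu₀ : b < u₀) (hz : f z = δ u₀) :
    ∃ η : ℝ → ℂ, ContinuousOn η (Ioi b) ∧ η u₀ = z ∧ ∀ u, b < u → f (η u) = δ u := by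
  have hconv : Convex ℝ (Ioi b) := convex_Ioi b
  have := hconv.contractibleSpace ⟨u₀, hu₀⟩
  have := isOpen_Ioi (a := b) |>.locallyPathConnectedSpace
  obtain ⟨η, h1, h2⟩ := exists_lift hf (A := Ioi b) ⟨(Ioi b).domRestrict δ, hδ.domRestrict⟩
    (a := ⟨u₀, hu₀⟩) (z := z) (fun x => hδS x x.2) hz
  refine ⟨fun u => if h : b < u then η ⟨u, h⟩ else 0, ?_, ?_, ?_⟩
  · rw [continuousOn_iff_continuous_domRestrict]
    convert η.continuous using 1
    ext x
    simp [domRestrict, show b < (x : ℝ) from x.2]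
  · simp [hu₀, h1]
  · intro u hu
    have := h2 ⟨u, hu⟩
    simpa [hu] using this

/-- If no image of `z` is singular, the iterates of `f` are locally injective at `z`. -/
lemma exists_injOn_iterate (hf : Differentiable ℂ f) (n : ℕ)
    (hz : ∀ i, i < n → f^[i + 1] z ∉ singularValues f) : ∃ U ∈ 𝓝 z, InjOn f^[n] U := by
  induction n generalizing z with
  | zero => exact ⟨univ, univ_mem, injOn_id _⟩
  | succ n ih =>
    obtain ⟨V, hV, hVi⟩ := ih (z := f z) fun i hi => by
      have := hz (i + 1) (by omega)
      rwa [Function.iterate_succ_apply] at this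
    have h0 : deriv f z ≠ 0 := deriv_ne_zero_of_notMem (hz 0 (by omega))
    have hs : HasStrictDerivAt f (deriv f z) z :=
      (hf.analyticAt z).hasStrictDerivAt
    have hs' := hs.hasStrictFDerivAt_equiv h0
    set e := hs'.toOpenPartialHomeomorph f
    refine ⟨e.source ∩ f ⁻¹' V, inter_mem (e.open_source.mem_nhds
      hs'.mem_toOpenPartialHomeomorph_source) (hf.continuous.continuousAt hV), ?_⟩
    intro x hx y hy hxy
    rw [Function.iterate_succ_apply, Function.iterate_succ_apply] at hxy
    exact e.injOn hx.1 hy.1 (hVi hx.2 hy.2 hxy)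

/-- Two continuous maps on a preconnected set that agree somewhere agree everywhere if the
coincidence set is open. -/
lemma eqOn_of_isPreconnected {X : Type*} [TopologicalSpace X] {S : Set X} (hS : IsPreconnected S)
    {g₁ g₂ : X → ℂ} (h₁ : ContinuousOn g₁ S) (h₂ : ContinuousOn g₂ S) {x₀ : X} (hx₀ : x₀ ∈ S)
    (h0 : g₁ x₀ = g₂ x₀)
    (hopen : ∀ x ∈ S, g₁ x = g₂ x → ∀ᶠ y in 𝓝[S] x, g₁ y = g₂ y) : EqOn g₁ g₂ S := by
  have := isPreconnected_iff_preconnectedSpace.1 hS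
  have hcl : IsClopen {x : S | g₁ x = g₂ x} := by
    refine ⟨isClosed_eq h₁.domRestrict h₂.domRestrict, ?_⟩
    rw [isOpen_iff_mem_nhds]
    rintro ⟨x, hx⟩ hxe
    rw [mem_nhds_subtype_iff_nhdsWithin]
    filter_upwards [hopen x hx hxe, self_mem_nhdsWithin] with y hy hyS
    exact ⟨⟨y, hyS⟩, hy, rfl⟩
  have huniv := hcl.eq_univ ⟨⟨x₀, hx₀⟩, h0⟩
  intro x hx
  have : (⟨x, hx⟩ : S) ∈ {x : S | g₁ x = g₂ x} := by rw [huniv]; trivial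
  exact this

/-! ### Tracts -/

lemma isOpen_rightHalfPlane (r : ℝ) : IsOpen (rightHalfPlane r) :=
  isOpen_lt continuous_const Complex.continuous_re

/-- `f` is injective on each component of the preimage of a half-plane without singular values. -/
theorem injOn_connectedComponentIn (hf : f ∈ Family d) (hfd : Differentiable ℂ f)
    (hr : Disjoint (rightHalfPlane r) (singularValues f)) {a : ℂ} (ha : a ∈ f ⁻¹' rightHalfPlane r) :
    InjOn f (connectedComponentIn (f ⁻¹' rightHalfPlane r) a) := by
  have hconv : Convex ℝ (rightHalfPlane r) := convex_halfSpace_re_gt r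
  have := hconv.contractibleSpace ⟨f a, ha⟩
  have := (isOpen_rightHalfPlane r).locallyPathConnectedSpace
  obtain ⟨σ, h1, h2⟩ := exists_lift hf (A := rightHalfPlane r) ⟨Subtype.val, continuous_subtype_val⟩
    (a := ⟨f a, ha⟩) (z := a) (fun x => disjoint_left.1 hr x.2) rfl
  set C := connectedComponentIn (f ⁻¹' rightHalfPlane r) a
  have hC : C ⊆ f ⁻¹' rightHalfPlane r := connectedComponentIn_subset _ _
  classical
  set g : ℂ → ℂ := fun x => if h : f x ∈ rightHalfPlane r then σ ⟨f x, h⟩ else 0 with hg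
  have hgx : ∀ x (h : f x ∈ rightHalfPlane r), g x = σ ⟨f x, h⟩ := fun x h => by simp [hg, h]
  have hgc : ContinuousOn g C := by
    rw [continuousOn_iff_continuous_domRestrict]
    have : Continuous fun x : C => σ ⟨f x, hC x.2⟩ :=
      σ.continuous.comp ((hfd.continuous.comp continuous_subtype_val).subtype_mk _)
    convert this using 1
    ext x
    exact hgx x (hC x.2)
  have heq : EqOn g id C := by
    refine eqOn_of_isPreconnected isPreconnected_connectedComponentIn hgc continuousOn_id
      (mem_connectedComponentIn ha) (by rw [hgx a ha, h1]; rfl) ?_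
    intro x hx hxe
    obtain ⟨U, hU, hUi⟩ := exists_injOn_iterate (z := x) hfd 1 (by
      intro i hi
      obtain rfl : i = 0 := by omega
      exact disjoint_left.1 hr (hC hx))
    rw [Function.iterate_one] at hUi
    have h3 := (hgc x hx).tendsto
    rw [hxe] at h3
    filter_upwards [h3 hU, nhdsWithin_le_nhds hU, self_mem_nhdsWithin] with y hy1 hy2 hyC
    refine hUi hy1 hy2 ?_
    rw [hgx y (hC hyC)]
    exact h2 _
  intro x hx y hy hxy
  have h3 := heq hx
  have h4 := heq hy
  rw [hgx x (hC hx)] at h3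
  rw [hgx y (hC hy)] at h4
  simp only [id] at h3 h4
  rw [← h3, ← h4]
  congr 1
  exact Subtype.ext hxy

/-- The far part of the `n`-th strip, cut off so that `f` maps it bijectively onto a right
half-plane. -/
def farStrip (f : ℂ → ℂ) (d : ℕ) (R : ℝ) (n : ℤ) : Set ℂ :=
  {z | R ≤ z.re ∧ InStrip f d n z ∧ Real.exp (d * (R + 1)) < (f z).re}

lemma IsLarge.le_exp (h : IsLarge f d R) : R + 2 ≤ Real.exp (d * (R + 1)) := by
  have h1 := Real.add_one_le_exp (d * (R + 1))
  have h2 := h.cast_one_le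
  have h3 := h.big
  nlinarith

lemma exists_mem_farStrip (h : IsLarge f d R) (n : ℤ) {ζ : ℂ}
    (hζ : Real.exp (d * (R + 1)) < ζ.re) : ∃ z ∈ farStrip f d R n, f z = ζ := by
  have h1 := h.le_exp
  have h2 := h.big
  obtain ⟨z, hz, rfl, hs, -⟩ := h.exists_preimage n (ζ := ζ) (by linarith)
    (hζ.le.trans ((le_abs_self _).trans (Complex.abs_re_le_norm ζ)))
  exact ⟨z, ⟨hz, hs, hζ⟩, rfl⟩

/-- The far strip is the image of a half-plane under a Lipschitz inverse branch of `f`. -/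
lemma isPreconnected_farStrip (h : IsLarge f d R) (n : ℤ) :
    IsPreconnected (farStrip f d R n) := by
  set H := rightHalfPlane (Real.exp (d * (R + 1)))
  choose! L hL1 hL2 using fun ζ (hζ : ζ ∈ H) => exists_mem_farStrip h n hζ
  have h0 := h.le_exp
  have hexp : ∀ z ∈ farStrip f d R n, ∀ w ∈ farStrip f d R n, ‖z - w‖ ≤ 1 / 2 * ‖f z - f w‖ :=
    fun z hz w hw => InStrip.expand h hz.1 hw.1 (by linarith [hz.2.2]) (by linarith [hw.2.2])
      hz.2.1 hw.2.1
  have himg : farStrip f d R n = L '' H := by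
    apply Subset.antisymm
    · intro z hz
      refine ⟨f z, hz.2.2, ?_⟩
      have h1 := hexp _ (hL1 (f z) hz.2.2) z hz
      rw [hL2 _ hz.2.2, sub_self, norm_zero, mul_zero] at h1
      exact sub_eq_zero.1 (norm_le_zero_iff.1 h1)
    · rintro _ ⟨ζ, hζ, rfl⟩
      exact hL1 ζ hζ
  rw [himg]
  have hconv : Convex ℝ H := convex_halfSpace_re_gt _
  refine hconv.isPreconnected.image L ?_
  have hlip : LipschitzOnWith (1 / 2) L H := by
    refine LipschitzOnWith.of_dist_le_mul fun x hx y hy => ?_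
    have h1 := hexp _ (hL1 x hx) _ (hL1 y hy)
    rw [hL2 x hx, hL2 y hy] at h1
    simpa [dist_eq_norm] using h1
  exact hlip.continuousOn

lemma eventually_stripPoint_mem_farStrip (h : IsLarge f d R) (n : ℤ) :
    ∀ᶠ t : ℝ in atTop, stripPoint d n t ∈ farStrip f d R n := by
  obtain ⟨K, hK0, hK⟩ := h.asymp
  have hd := h.cast_one_le
  have hlim : Tendsto (fun t : ℝ => (d * K) * Real.exp (-t)) atTop (𝓝 (d * K * 0)) :=
    Real.tendsto_exp_neg_atTop_nhds_zero.const_mul _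
  rw [mul_zero] at hlim
  filter_upwards [eventually_ge_atTop (R + 1), eventually_ge_atTop (2 * Real.exp (d * (R + 1)) + 1),
    hlim.eventually_le_const (by norm_num : (0 : ℝ) < 1)] with t ht1 ht2 ht3
  have hre : R ≤ (stripPoint d n t).re := by rw [stripPoint_re]; linarith
  have h1 := hK _ hre
  rw [stripPoint_re] at h1
  have h2 := (Complex.abs_im_le_norm _).trans h1
  rw [Complex.sub_im, stripPoint_im] at h2
  set θ := d * ((chart f d (stripPoint d n t)).im - 2 * Real.pi * n / d) with hθ
  have hθ1 : |θ| ≤ 1 := by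
    rw [hθ, abs_mul, abs_of_pos (by positivity : (0 : ℝ) < d)]
    refine le_trans ?_ ht3
    rw [mul_assoc (d : ℝ) K]
    exact mul_le_mul_of_nonneg_left h2 (by positivity)
  refine ⟨hre, ?_, ?_⟩
  · rw [InStrip, le_div_iff₀ (by positivity)]
    rw [hθ, abs_mul, abs_of_pos (by positivity : (0 : ℝ) < d)] at hθ1
    linarith [Real.pi_gt_three]
  · have e : f (stripPoint d n t) =
        Complex.exp (d * chart f d (stripPoint d n t) - n * (2 * Real.pi * Complex.I)) := by
      rw [Complex.exp_sub, Complex.exp_int_mul_two_pi_mul_I, div_one, h.exp_chart _ hre]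
    have him : (d * chart f d (stripPoint d n t) - n * (2 * Real.pi * Complex.I)).im = θ := by
      simp [hθ]; field_simp
    have hree : (d * chart f d (stripPoint d n t) - n * (2 * Real.pi * Complex.I)).re =
        d * (chart f d (stripPoint d n t)).re := by simp
    rw [e, Complex.exp_re, him, hree]
    have h3 : 1 / 2 ≤ Real.cos θ := by
      have h4 := Real.one_sub_sq_div_two_le_cos (x := θ)
      have h5 : θ ^ 2 ≤ 1 := by rw [← sq_abs]; nlinarith [abs_nonneg θ]
      linarith
    have h4 := (abs_le.1 (h.re_near hre)).1
    rw [stripPoint_re] at h4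
    have h5 : t ≤ Real.exp (d * (chart f d (stripPoint d n t)).re) := by
      have := Real.add_one_le_exp (d * (chart f d (stripPoint d n t)).re)
      have := h.big
      nlinarith
    nlinarith [Real.exp_pos (d * (R + 1))]

lemma farStrip_subset (h : IsLarge f d R) (hrR : r ≤ R) (n : ℤ) :
    farStrip f d R n ⊆ f ⁻¹' rightHalfPlane r := by
  intro z hz
  have h0 := h.le_exp
  have h1 := hz.2.2
  change r < (f z).re
  linarith

lemma farStrip_subset_tract (h : IsLarge f d R) (hrR : r ≤ R) (n : ℤ) :
    farStrip f d R n ⊆ tract f d r n := by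
  intro z hz
  filter_upwards [eventually_stripPoint_mem_farStrip h n] with t ht
  exact (isPreconnected_farStrip h n).subset_connectedComponentIn ht (farStrip_subset h hrR n) hz

/-- Far to the right the tracts are the strips. -/
lemma eq_of_mem_farStrip_of_mem_tract (hf : f ∈ Family d) (h : IsLarge f d R) (hrR : r ≤ R)
    (hr : Disjoint (rightHalfPlane r) (singularValues f)) {m n : ℤ} (hm : z ∈ farStrip f d R m)
    (hn : z ∈ tract f d r n) : m = n := by
  obtain ⟨t, ht1, ht2⟩ := ((show ∀ᶠ t : ℝ in atTop, _ from hn).and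
    (eventually_stripPoint_mem_farStrip h n)).exists
  have hsub : ∀ k, farStrip f d R k ⊆ f ⁻¹' rightHalfPlane r := farStrip_subset h hrR
  have hinj := injOn_connectedComponentIn hf h.differentiable hr (hsub n ht2)
  -- both strips contain a preimage of the same point, and they lie in the same tract
  obtain ⟨x, hx, hxe⟩ := exists_mem_farStrip h m (ζ := (Real.exp (d * (R + 1)) + 1 : ℝ))
    (by rw [Complex.ofReal_re]; exact lt_add_one _)
  obtain ⟨y, hy, hye⟩ := exists_mem_farStrip h n (ζ := (Real.exp (d * (R + 1)) + 1 : ℝ))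
    (by rw [Complex.ofReal_re]; exact lt_add_one _)
  have hx' : x ∈ connectedComponentIn (f ⁻¹' rightHalfPlane r) (stripPoint d n t) := by
    rw [connectedComponentIn_eq ht1]
    exact (isPreconnected_farStrip h m).subset_connectedComponentIn hm (hsub m) hx
  have hy' : y ∈ connectedComponentIn (f ⁻¹' rightHalfPlane r) (stripPoint d n t) :=
    (isPreconnected_farStrip h n).subset_connectedComponentIn ht2 (hsub n) hy
  have hxy : x = y := hinj hx' hy' (hxe.trans hye.symm)
  subst hxy
  exact hx.2.1.unique h.one_le hy.2.1

/-! ### Changes of parameter -/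

/-- A change of parameter has an inverse. -/
lemma exists_inverse_param {h : ℝ → ℝ} {a b : ℝ} (hmono : StrictMonoOn h (Ioi a))
    (himg : h '' Ioi a = Ioi b) :
    ∃ k : ℝ → ℝ, ContinuousOn k (Ioi b) ∧ StrictMonoOn k (Ioi b) ∧ k '' Ioi b = Ioi a ∧
      (∀ t, a < t → k (h t) = t) ∧ ∀ u, b < u → h (k u) = u := by
  have h1 : ∀ u ∈ Ioi b, ∃ t ∈ Ioi a, h t = u := fun u hu => by rwa [← himg] at hu
  choose! k hk1 hk2 using h1
  have hkh : ∀ t, a < t → k (h t) = t := by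
    intro t ht
    have h2 : h t ∈ Ioi b := himg ▸ mem_image_of_mem h ht
    exact hmono.injOn (hk1 _ h2) ht (hk2 _ h2)
  have hkm : StrictMonoOn k (Ioi b) := by
    intro u hu v hv huv
    rw [← hmono.lt_iff_lt (hk1 u hu) (hk1 v hv), hk2 u hu, hk2 v hv]
    exact huv
  have hki : k '' Ioi b = Ioi a := by
    apply Subset.antisymm
    · rintro _ ⟨u, hu, rfl⟩
      exact hk1 u hu
    · intro t ht
      exact ⟨h t, himg ▸ mem_image_of_mem h ht, hkh t ht⟩
  refine ⟨k, fun u hu => ContinuousAt.continuousWithinAt ?_, hkm, hki, hkh, hk2⟩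
  refine hkm.continuousAt_of_image_mem_nhds (Ioi_mem_nhds hu) ?_
  rw [hki]
  exact Ioi_mem_nhds (hk1 u hu)

lemma SameCurve.symm {γ δ : ℝ → ℂ} {a b : ℝ} (h : SameCurve γ a δ b) : SameCurve δ b γ a := by
  obtain ⟨h, -, h2, h3, h4⟩ := h
  obtain ⟨k, k1, k2, k3, -, k5⟩ := exists_inverse_param h2 h3
  refine ⟨k, k1, k2, k3, fun u hu => ?_⟩
  rw [h4 _ (k3 ▸ mem_image_of_mem k hu), k5 u hu]

lemma SameCurve.trans {γ δ ε : ℝ → ℂ} {a b c : ℝ} (h : SameCurve γ a δ b)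
    (h' : SameCurve δ b ε c) : SameCurve γ a ε c := by
  obtain ⟨h, h1, h2, h3, h4⟩ := h
  obtain ⟨k, k1, k2, k3, k4⟩ := h'
  have hm : MapsTo h (Ioi a) (Ioi b) := fun t ht => h3 ▸ mem_image_of_mem h ht
  refine ⟨k ∘ h, k1.comp h1 hm, k2.comp h2 hm, by rw [image_comp, h3, k3], fun t ht => ?_⟩
  rw [h4 t ht, k4 _ (hm ht)]
  rfl

lemma image_add_Ioi (a b : ℝ) : (fun t => a + t) '' Ioi b = Ioi (a + b) := by
  simp [add_comm]

lemma SameCurve.translate {γ δ : ℝ → ℂ} {a b c : ℝ} (h : ∀ t, b < t → γ t = δ (a + t))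
    (hc : a + b = c) : SameCurve γ b δ c :=
  ⟨fun t => a + t, by fun_prop, fun x _ y _ hxy => by simpa using hxy,
    by rw [image_add_Ioi, hc], h⟩

/-- A strictly increasing, continuous and unbounded function maps a right half-line to one. -/
lemma exists_image_Ioi {h : ℝ → ℝ} {a : ℝ} (hc : ContinuousOn h (Ioi a))
    (hm : StrictMonoOn h (Ioi a)) (hb : ∀ t, a < t → 0 ≤ h t) (hu : ∀ B, ∃ t, a < t ∧ B < h t) :
    ∃ b, 0 ≤ b ∧ h '' Ioi a = Ioi b := by
  have hne : (h '' Ioi a).Nonempty := ⟨_, mem_image_of_mem h (lt_add_one a)⟩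
  have hbd : BddBelow (h '' Ioi a) := by
    refine ⟨0, ?_⟩
    rintro _ ⟨t, ht, rfl⟩
    exact hb t ht
  refine ⟨sInf (h '' Ioi a), Real.sInf_nonneg ?_, Subset.antisymm ?_ ?_⟩
  · rintro _ ⟨t, ht, rfl⟩
    exact hb t ht
  · rintro _ ⟨t, ht, rfl⟩
    obtain ⟨u, hau, hut⟩ := exists_between (show a < t from ht)
    exact (csInf_le hbd (mem_image_of_mem h hau)).trans_lt (hm hau ht hut)
  · intro v hv
    obtain ⟨_, ⟨t, ht, rfl⟩, htv⟩ := exists_lt_of_csInf_lt hne hv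
    obtain ⟨u, hau, huv⟩ := hu v
    exact (isPreconnected_Ioi.image h hc).ordConnected.out (mem_image_of_mem h ht)
      (mem_image_of_mem h hau) ⟨htv.le, huv.le⟩

/-! ### Rays parametrized by potential -/

/-- A curve `(a, ∞) → I(f)` with address `s` that is parametrized by potential. The address refers
to strips (`tail`), and `deep` says that each end `[t, ∞)` enters `tailSet` after finitely many
steps, uniformly; only `γ` on `(a, ∞)` matters. Every ray is of this form after a change of parameter
(`IsRayCurve.exists_isPotRay`). -/
structure IsPotRay (f : ℂ → ℂ) (d : ℕ) (R : ℝ) (s : ℕ → ℤ) (a : ℝ) (γ : ℝ → ℂ) : Prop where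
  nonneg : 0 ≤ a
  continuousOn : ContinuousOn γ (Ioi a)
  pot : ∀ t, a < t → HasPot f d (γ t) t
  deep : ∀ t, a < t → ∃ N : ℕ, ∀ u, t ≤ u → f^[N] (γ u) ∈ tailSet f d R (shift N s)
  tail : ∃ T, ∀ u, T ≤ u → γ u ∈ tailSet f d R s

lemma tailSet.tendsto_re (h : IsLarge f d R) (hz : z ∈ tailSet f d R s) {t : ℝ} (ht : 0 < t)
    (hzt : HasPot f d z t) : Tendsto (fun n => (f^[n] z).re) atTop atTop := by
  rw [tendsto_atTop]
  intro M
  have h1 := (hzt.tendsto_norm h.one_le ht).eventually_gt_atTop (Real.exp (d * (M + 1 / 8)))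
  rw [← map_add_atTop_eq_nat 1, eventually_map] at h1
  filter_upwards [h1] with n hn
  rw [Function.iterate_succ_apply'] at hn
  have h2 := hn.trans_le (h.norm_le (hz n).1)
  rw [Real.exp_lt_exp] at h2
  have h3 := lt_of_mul_lt_mul_left h2 (by positivity)
  linarith

lemma IsPotRay.eventually_le_re (h : IsLarge f d R) (hγ : IsPotRay f d R s a γ) {t : ℝ}
    (ht : a < t) (M : ℝ) : ∀ᶠ n : ℕ in atTop, ∀ u, t ≤ u → M ≤ (f^[n] (γ u)).re := by
  obtain ⟨N, hN⟩ := hγ.deep t ht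
  have ht0 : 0 < t := hγ.nonneg.trans_lt ht
  have hpot : ∀ u, t ≤ u → HasPot f d (f^[N] (γ u)) ((F d)^[N] u) := fun u hu =>
    (hγ.pot u (ht.trans_le hu)).iterate h.one_le N
  have h1 := (tailSet.tendsto_re h (hN t le_rfl) (F_iterate_pos h.one_le N ht0)
    (hpot t le_rfl)).eventually_ge_atTop (M + 1)
  rw [← map_add_atTop_eq_nat N, eventually_map]
  filter_upwards [h1] with n hn u hu
  have h2 := tailSet.re_iterate_lt h (hN t le_rfl) (hN u hu) (hpot t le_rfl) (hpot u hu)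
    ((F_iterate_strictMono h.one_le N).monotone hu) n
  rw [Function.iterate_add_apply]
  linarith

/-- All points of a tail of a ray eventually enter `tailSet`, simultaneously. -/
lemma IsPotRay.eventually_mem_tailSet (h : IsLarge f d R) (hγ : IsPotRay f d R s a γ) {t : ℝ}
    (ht : a < t) (R' : ℝ) :
    ∀ᶠ n : ℕ in atTop, ∀ u, t ≤ u → f^[n] (γ u) ∈ tailSet f d R' (shift n s) := by
  obtain ⟨N, hN⟩ := hγ.deep t ht
  obtain ⟨N', hN'⟩ := eventually_atTop.1 (hγ.eventually_le_re h ht R')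
  filter_upwards [eventually_ge_atTop (max N N')] with n hn u hu k
  rw [← Function.iterate_add_apply]
  refine ⟨hN' _ (by omega) u hu, ?_⟩
  obtain ⟨m, rfl⟩ := Nat.exists_eq_add_of_le (show N ≤ n by omega)
  have h1 := (hN u hu (m + k)).2
  rw [← Function.iterate_add_apply] at h1
  have e1 : m + k + N = k + (N + m) := by ring
  rw [e1] at h1
  simpa only [shift, add_assoc] using h1

lemma tailSet.le_norm_add_one (h : IsLarge f d R) (hz : z ∈ tailSet f d R s) {t : ℝ}
    (ht : HasPot f d z t) : t ≤ ‖z‖ + 1 := by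
  by_contra! hlt
  obtain ⟨b, hb1, hb2⟩ := exists_between hlt
  obtain ⟨n, hn⟩ := (ht.ge b (lt_trans (by positivity) hb1) hb2).exists
  have h3 := tailSet.norm_iterate_le h hz (u := ‖z‖ + 1) (by linarith) n
  have h4 := F_iterate_strictMono h.one_le n hb1
  linarith

lemma IsPotRay.tendsto_norm_iterate (h : IsLarge f d R) (hγ : IsPotRay f d R s a γ) (n : ℕ) :
    Tendsto (fun t => ‖f^[n] (γ t)‖) atTop atTop := by
  obtain ⟨T, hT⟩ := hγ.tail
  have h1 : Tendsto (fun t : ℝ => t + -1) atTop atTop := tendsto_atTop_add_const_right _ _ tendsto_id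
  refine tendsto_atTop_mono' _ ?_ h1
  filter_upwards [eventually_ge_atTop T, eventually_gt_atTop a] with t ht hat
  have h2 := tailSet.le_norm_add_one h (tailSet.iterate (hT t ht) n)
    ((hγ.pot t hat).iterate h.one_le n)
  have h3 := le_F_iterate h.one_le (hγ.nonneg.trans hat.le) n
  linarith

lemma IsPotRay.tendsto_re_iterate (h : IsLarge f d R) (hγ : IsPotRay f d R s a γ) (n : ℕ) :
    Tendsto (fun t => (f^[n] (γ t)).re) atTop atTop := by
  obtain ⟨T, hT⟩ := hγ.tail
  rw [tendsto_atTop]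
  intro M
  filter_upwards [eventually_ge_atTop T, (hγ.tendsto_norm_iterate h (n + 1)).eventually_gt_atTop
    (Real.exp (d * (M + 1 / 8)))] with t ht hn
  rw [Function.iterate_succ_apply'] at hn
  have h2 := hn.trans_le (h.norm_le (hT t ht n).1)
  rw [Real.exp_lt_exp] at h2
  have h3 := lt_of_mul_lt_mul_left h2 (by positivity)
  linarith

/-- The domain `(a, ∞)` is translated to `(0, ∞)`. -/
lemma IsPotRay.isRayCurve (h : IsLarge f d R) (hγ : IsPotRay f d R s a γ) :
    IsRayCurve f fun t => γ (a + t) := by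
  have hd := h.one_le
  have hpos : ∀ t : ℝ, 0 < t → 0 < a + t := fun t ht => by linarith [hγ.nonneg]
  have hinj : ∀ n : ℕ, InjOn (fun t => f^[n] (γ (a + t))) (Ioi 0) := by
    intro n t ht u hu htu
    have ht' : (0 : ℝ) < t := ht
    have hu' : (0 : ℝ) < u := hu
    have h1 := (hγ.pot (a + t) (by linarith)).iterate hd n
    have h2 := (hγ.pot (a + u) (by linarith)).iterate hd n
    simp only at htu
    rw [htu] at h1
    have := (F_iterate_strictMono hd n).injective (h1.unique hd h2)
    linarith
  have hmaps : MapsTo (fun t => γ (a + t)) (Ioi 0) (escapingSet f) := fun t ht =>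
    (hγ.pot _ (by have : (0 : ℝ) < t := ht; linarith)).mem_escapingSet hd (hpos t ht)
  refine ⟨hmaps, by simpa using hinj 0, fun t ht => ⟨?_, hmaps.mono_left ?_, fun n =>
    (hinj n).mono ?_, fun n => ?_, fun M => ?_⟩⟩
  · refine hγ.continuousOn.comp (by fun_prop) fun u hu => ?_
    have : t ≤ u := hu
    simp only [mem_Ioi]; linarith
  · exact Ici_subset_Ioi.2 ht
  · exact Ici_subset_Ioi.2 ht
  · exact tendsto_norm_atTop_iff_cobounded.1 ((hγ.tendsto_norm_iterate h n).comp
      (tendsto_atTop_add_const_left _ a tendsto_id))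
  · filter_upwards [hγ.eventually_le_re h (show a < a + t by linarith) M] with n hn u hu
    have hu' : t ≤ u := hu
    exact (hn (a + u) (by linarith)).trans ((le_abs_self _).trans (Complex.abs_re_le_norm _))

lemma IsPotRay.hasAddress (h : IsLarge f d R) (hrR : r ≤ R) (hγ : IsPotRay f d R s a γ) {b : ℝ} :
    HasAddress f d r (fun t => γ (b + t)) s := by
  intro n
  obtain ⟨T, hT⟩ := hγ.tail
  have h1 : ∀ᶠ t in atTop, f^[n] (γ t) ∈ tract f d r (s n) := by
    filter_upwards [eventually_ge_atTop T, (hγ.tendsto_re_iterate h (n + 1)).eventually_gt_atTop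
      (Real.exp (d * (R + 1)))] with t ht hn
    rw [Function.iterate_succ_apply'] at hn
    exact farStrip_subset_tract h hrR _ ⟨(hT t ht n).1, (hT t ht n).2, hn⟩
  exact (tendsto_atTop_add_const_left _ b tendsto_id).eventually h1

/-! ### Every ray can be parametrized by potential -/

/-- The strip is constant along a connected set. -/
lemma InStrip.of_isPreconnected (h : IsLarge f d R) {S : Set ℝ} (hS : IsPreconnected S)
    {g : ℝ → ℂ} (hg : ContinuousOn g S) (hre : ∀ x ∈ S, R ≤ (g x).re)
    (hfre : ∀ x ∈ S, 0 ≤ (f (g x)).re) {n : ℤ} {x₀ x : ℝ} (hx₀ : x₀ ∈ S) (hx : x ∈ S)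
    (hn : InStrip f d n (g x₀)) : InStrip f d n (g x) := by
  have hd := h.cast_one_le
  have hpi := Real.pi_pos
  obtain ⟨m, hm⟩ := h.exists_inStrip (hre x hx) (hfre x hx)
  have hc : ContinuousOn (fun x => (chart f d (g x)).im * d / (2 * Real.pi)) S := by
    refine ContinuousOn.div_const (ContinuousOn.mul_const ?_ _) _
    exact Complex.continuous_im.comp_continuousOn fun x hx =>
      (h.continuousAt_chart _ (hre x hx)).comp_continuousWithinAt (hg x hx)
  -- in units of `2π/d`, a point of the `k`-th strip has height within `1/4` of `k`, so that the
  -- heights `k + 1/2` are never attained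
  have key : ∀ x (k : ℤ), InStrip f d k (g x) →
      |(chart f d (g x)).im * d / (2 * Real.pi) - k| ≤ 1 / 4 := by
    intro x k hk
    have e : (chart f d (g x)).im * d / (2 * Real.pi) - k =
        ((chart f d (g x)).im - 2 * Real.pi * k / d) * (d / (2 * Real.pi)) := by
      field_simp
    rw [e, abs_mul, abs_of_pos (by positivity : (0 : ℝ) < d / (2 * Real.pi))]
    calc _ ≤ Real.pi / (2 * d) * (d / (2 * Real.pi)) := by gcongr; exact hk
      _ = 1 / 4 := by field_simp; norm_num
  have hno : ∀ x ∈ S, ∀ k : ℤ, (chart f d (g x)).im * d / (2 * Real.pi) ≠ k + 1 / 2 := by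
    intro x hx k hk
    obtain ⟨l, hl⟩ := h.exists_inStrip (hre x hx) (hfre x hx)
    have h1 := abs_le.1 (key x l hl)
    rw [hk] at h1
    have h2 : (l : ℝ) < k + 1 := by linarith [h1.1]
    have h3 : (k : ℝ) < l := by linarith [h1.2]
    have h2' : l < k + 1 := by exact_mod_cast h2
    have h3' : k < l := by exact_mod_cast h3
    omega
  have h1 := abs_le.1 (key x₀ n hn)
  have h2 := abs_le.1 (key x m hm)
  rcases lt_trichotomy m n with hlt | rfl | hlt
  · have hlt' : (m : ℝ) + 1 ≤ n := by exact_mod_cast hlt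
    obtain ⟨y, hy, hye⟩ := hS.intermediate_value hx hx₀ hc
      (show ((m : ℝ) + 1 / 2) ∈ Icc _ _ from ⟨by linarith [h2.2], by linarith [h1.1]⟩)
    exact absurd hye (hno y hy m)
  · exact hm
  · have hlt' : (n : ℝ) + 1 ≤ m := by exact_mod_cast hlt
    obtain ⟨y, hy, hye⟩ := hS.intermediate_value hx₀ hx hc
      (show ((n : ℝ) + 1 / 2) ∈ Icc _ _ from ⟨by linarith [h1.2], by linarith [h2.1]⟩)
    exact absurd hye (hno y hy n)

/-- Every ray has an address. -/
lemma IsRayCurve.exists_address (hf : f ∈ Family d) (h : IsLarge f d R) (hγ : IsRayCurve f γ) :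
    ∃ s : ℕ → ℤ, (∃ T, 0 < T ∧ ∀ u, T ≤ u → γ u ∈ tailSet f d R s) ∧
      ∀ t, 0 < t → ∃ N : ℕ, ∀ u, t ≤ u → f^[N] (γ u) ∈ tailSet f d R (shift N s) := by
  obtain ⟨B, hB⟩ := exists_lt_re_of_lt_norm hf R
  have hesc : ∀ t : ℝ, 0 < t → ∃ N : ℕ, ∀ n, N ≤ n → ∀ u, t ≤ u → R ≤ (f^[n] (γ u)).re := by
    intro t ht
    obtain ⟨N, hN⟩ := eventually_atTop.1 ((hγ.rayTail t ht).uniform_escape (B + 1))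
    refine ⟨N, fun n hn u hu => (hB _ ?_).le⟩
    rw [← Function.iterate_succ_apply' f]
    linarith [hN (n + 1) (by omega) u hu]
  have hcont : ∀ (n : ℕ) (t : ℝ), 0 < t → ContinuousOn (fun u => f^[n] (γ u)) (Ici t) :=
    fun n t ht => (h.differentiable.continuous.iterate n).comp_continuousOn
      (hγ.rayTail t ht).continuousOn
  have hR0 : 0 ≤ R := by linarith [h.big]
  obtain ⟨N, hN⟩ := hesc 1 one_pos
  have h1 : ∀ᶠ t : ℝ in atTop, ∀ n ∈ Finset.range N, R ≤ (f^[n] (γ t)).re := by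
    rw [Filter.eventually_all_finset]
    intro n _
    filter_upwards [(tendsto_norm_atTop_iff_cobounded.2
      ((hγ.rayTail 1 one_pos).tendsto_iterate (n + 1))).eventually_gt_atTop B] with t ht
    rw [Function.iterate_succ_apply'] at ht
    exact (hB _ ht).le
  obtain ⟨T₀, hT₀⟩ := eventually_atTop.1 h1
  set T := max T₀ 1 with hT
  have hT1 : (1 : ℝ) ≤ T := le_max_right _ _
  have hTpos : 0 < T := by linarith
  have hre : ∀ u, T ≤ u → ∀ n : ℕ, R ≤ (f^[n] (γ u)).re := by
    intro u hu n
    rcases lt_or_ge n N with hn | hn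
    · exact hT₀ u ((le_max_left _ _).trans hu) n (Finset.mem_range.2 hn)
    · exact hN n hn u (hT1.trans hu)
  obtain ⟨s, hs⟩ := exists_mem_tailSet h (hre T le_rfl)
  have htail : ∀ u, T ≤ u → γ u ∈ tailSet f d R s := by
    intro u hu n
    refine ⟨hre u hu n, InStrip.of_isPreconnected h isPreconnected_Ici (hcont n T hTpos)
      (fun x hx => hre x hx n) (fun x hx => ?_) (self_mem_Ici (a := T)) (x := u) hu (hs n).2⟩
    have := hre x hx (n + 1)
    rw [Function.iterate_succ_apply'] at this
    linarith
  refine ⟨s, ⟨T, hTpos, htail⟩, fun t ht => ?_⟩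
  obtain ⟨N', hN'⟩ := hesc t ht
  refine ⟨N', fun u hu n => ?_⟩
  rw [← Function.iterate_add_apply]
  refine ⟨hN' _ (by omega) u hu, InStrip.of_isPreconnected h (isPreconnected_Ici (a := t))
    (hcont (n + N') t ht) (fun x hx => hN' _ (by omega) x hx) (fun x hx => ?_)
    (x₀ := max t T) (x := u) (mem_Ici.2 (le_max_left t T)) (mem_Ici.2 hu) ?_⟩
  · have := hN' (n + N' + 1) (by omega) x hx
    rw [Function.iterate_succ_apply'] at this
    linarith
  · have := (htail (max t T) (le_max_right _ _) (n + N')).2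
    simpa [shift, add_comm] using this

/-- Every ray is, up to a change of parameter, parametrized by potential. -/
theorem IsRayCurve.exists_isPotRay (hf : f ∈ Family d) (h : IsLarge f d R) (hγ : IsRayCurve f γ) :
    ∃ s a γ', IsPotRay f d R s a γ' ∧ SameCurve γ 0 γ' a := by
  have hd := h.one_le
  obtain ⟨s, ⟨T, hT0, hT⟩, hdeep⟩ := hγ.exists_address hf (h.mono (by linarith : R ≤ R + 2))
  have hRR : R ≤ R + 2 := by linarith
  have hpot : ∀ t, 0 < t → ∃ u, HasPot f d (γ t) u := by
    intro t ht
    obtain ⟨N, hN⟩ := hdeep t ht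
    obtain ⟨v, hv⟩ := tailSet.exists_hasPot (h.mono hRR) (hN t le_rfl)
    obtain ⟨u, hu0, rfl⟩ := exists_F_iterate_eq hd N hv.nonneg
    exact ⟨u, hv.of_iterate hd hu0⟩
  choose! p hp using hpot
  have hcont : ContinuousOn p (Ioi 0) := by
    intro t ht
    have ht' : (0 : ℝ) < t := ht
    refine ContinuousAt.continuousWithinAt ?_
    obtain ⟨N, hN⟩ := hdeep (t / 2) (by linarith)
    refine (isEmbedding_F_iterate hd N).tendsto_nhds_iff.2 ?_
    refine tailSet.tendsto_pot h (x := fun u => f^[N] (γ u)) ?_ (hN t (by linarith))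
      ((hp t ht').iterate hd N) ?_
    · filter_upwards [Ioi_mem_nhds (show t / 2 < t by linarith)] with u hu
      have hu' : t / 2 < u := hu
      exact ⟨hN u hu'.le, (hp u (by linarith)).iterate hd N⟩
    · refine ((h.differentiable.continuous.iterate N).continuousAt).tendsto.comp ?_
      exact (hγ.rayTail (t / 2) (by linarith)).continuousOn.continuousAt
        (Ici_mem_nhds (by linarith))
  have hinj : InjOn p (Ioi 0) := by
    intro t ht u hu htu
    have ht' : (0 : ℝ) < t := ht
    have hu' : (0 : ℝ) < u := hu
    have hm : 0 < min t u := lt_min ht' hu'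
    obtain ⟨N, hN⟩ := hdeep (min t u) hm
    have h1 := (hp t ht').iterate hd N
    rw [htu] at h1
    exact (hγ.rayTail _ hm).injOn_iterate N (min_le_left t u) (min_le_right t u)
      (tailSet.eq_of_pot (h.mono hRR) (hN t (min_le_left t u)) (hN u (min_le_right t u)) h1
        ((hp u hu').iterate hd N))
  -- if the potentials were bounded, a point of larger potential would bound the curve
  have hunb : ∀ B, ∃ t, 1 ≤ t ∧ B < p t := by
    intro B
    by_contra! hcon
    obtain ⟨N, hN⟩ := hdeep 1 one_pos
    obtain ⟨y, hy, hyp⟩ := tailSet.exists_pot_gt h (hN 1 le_rfl) ((hp 1 one_pos).iterate hd N)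
      (F_iterate_strictMono hd N ((hcon 1 le_rfl).trans_lt (lt_add_one B)))
    obtain ⟨t, ht1, ht2⟩ := ((eventually_ge_atTop (1 : ℝ)).and ((tendsto_norm_atTop_iff_cobounded.2
      ((hγ.rayTail 1 one_pos).tendsto_iterate N)).eventually_gt_atTop (‖y‖ + (1 + 4)))).exists
    have hx := tailSet.mono hRR (hN t ht1)
    have h2 := tailSet.re_iterate_lt h hx hy ((hp t (by linarith)).iterate hd N) hyp
      ((F_iterate_strictMono hd N).monotone ((hcon t ht1).trans (by linarith))) 0
    simp only [Function.iterate_zero, id] at h2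
    refine absurd (norm_le_of_re_le (by linarith [tailSet.re hx, h.big]) h2.le
      ((hx 0).2.abs_im_sub_le h (tailSet.re hx) (tailSet.re hy) (hy 0).2) zero_le_one)
      (not_le.2 ht2)
  have hmono : StrictMonoOn p (Ioi 0) := by
    intro t ht u hu htu
    have ht' : (0 : ℝ) < t := ht
    obtain ⟨v, hv1, hv⟩ := hunb (p (min t 1))
    have hm : 0 < min t 1 := lt_min ht' one_pos
    have hmv : min t 1 < v := lt_of_le_of_ne ((min_le_right _ _).trans hv1) fun e => by
      rw [e] at hv
      exact lt_irrefl _ hv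
    have hsub : Icc (min t 1) (max u v) ⊆ Ioi 0 := fun x hx => hm.trans_le hx.1
    have hle : min t 1 ≤ max u v := hmv.le.trans (le_max_right _ _)
    have hv' : v ∈ Icc (min t 1) (max u v) := ⟨hmv.le, le_max_right _ _⟩
    rcases (hcont.mono hsub).strictMonoOn_of_injOn_Icc' hle (hinj.mono hsub) with h1 | h1
    · exact h1 ⟨min_le_left _ _, htu.le.trans (le_max_left _ _)⟩
        ⟨(min_le_left _ _).trans htu.le, le_max_left _ _⟩ htu
    · exact absurd (h1 (left_mem_Icc.2 hle) hv' hmv) hv.not_gt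
  obtain ⟨a, ha0, ha⟩ := exists_image_Ioi hcont hmono (fun t ht => (hp t ht).nonneg)
    fun B => by
      obtain ⟨t, ht1, ht2⟩ := hunb B
      exact ⟨t, by linarith, ht2⟩
  obtain ⟨k, k1, k2, k3, k4, k5⟩ := exists_inverse_param hmono ha
  have hk : MapsTo k (Ioi a) (Ioi 0) := fun u hu => k3 ▸ mem_image_of_mem k hu
  have hγc : ContinuousOn γ (Ioi 0) := fun t ht => by
    have ht' : (0 : ℝ) < t := ht
    exact ((hγ.rayTail (t / 2) (by linarith)).continuousOn.continuousAt
      (Ici_mem_nhds (by linarith))).continuousWithinAt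
  refine ⟨s, a, γ ∘ k, ⟨ha0, hγc.comp k1 hk, fun t ht => ?_, fun t ht => ?_, ?_⟩,
    p, hcont, hmono, ha, fun t ht => ?_⟩
  · have := hp (k t) (hk ht)
    rwa [k5 t ht] at this
  · obtain ⟨N, hN⟩ := hdeep (k t) (hk ht)
    refine ⟨N, fun u hu => tailSet.mono hRR (hN (k u) ?_)⟩
    exact k2.monotoneOn ht (lt_of_lt_of_le ht hu) hu
  · have hpT : p T ∈ Ioi a := ha ▸ mem_image_of_mem p hT0
    refine ⟨p T, fun u hu => tailSet.mono hRR (hT (k u) ?_)⟩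
    rw [← k4 T hT0]
    exact k2.monotoneOn hpT (lt_of_lt_of_le hpT hu) hu
  · simp only [Function.comp, k4 t ht]

/-! ### Maximal rays -/

lemma IsPotRay.mono (hγ : IsPotRay f d R s a γ) (hab : a ≤ b) : IsPotRay f d R s b γ where
  nonneg := hγ.nonneg.trans hab
  continuousOn := hγ.continuousOn.mono (Ioi_subset_Ioi hab)
  pot t ht := hγ.pot t (hab.trans_lt ht)
  deep t ht := hγ.deep t (hab.trans_lt ht)
  tail := hγ.tail

/-- A curve that is on each `(t, ∞)`, `t > a`, the end of a ray is a ray on `(a, ∞)`. -/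
lemma IsPotRay.of_local (ha : 0 ≤ a)
    (hγ : ∀ t, a < t → ∃ b δ, b < t ∧ IsPotRay f d R s b δ ∧ EqOn γ δ (Ioi b)) :
    IsPotRay f d R s a γ where
  nonneg := ha
  continuousOn t ht := by
    obtain ⟨b, δ, hb, hδ, he⟩ := hγ t ht
    refine ContinuousAt.continuousWithinAt ?_
    exact (hδ.continuousOn.continuousAt (Ioi_mem_nhds hb)).congr
      (he.symm.eventuallyEq_of_mem (Ioi_mem_nhds hb))
  pot t ht := by
    obtain ⟨b, δ, hb, hδ, he⟩ := hγ t ht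
    rw [he hb]
    exact hδ.pot t hb
  deep t ht := by
    obtain ⟨b, δ, hb, hδ, he⟩ := hγ t ht
    obtain ⟨N, hN⟩ := hδ.deep t hb
    refine ⟨N, fun u hu => ?_⟩
    rw [he (hb.trans_le hu)]
    exact hN u hu
  tail := by
    obtain ⟨b, δ, hb, hδ, he⟩ := hγ (a + 1) (lt_add_one a)
    obtain ⟨T, hT⟩ := hδ.tail
    refine ⟨max T (b + 1), fun u hu => ?_⟩
    rw [he (show b < u by linarith [(le_max_right T (b + 1)).trans hu])]
    exact hT u ((le_max_left _ _).trans hu)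

/-- A ray parametrized by potential that cannot be continued to smaller potentials. -/
structure IsMaxPotRay (f : ℂ → ℂ) (d : ℕ) (R : ℝ) (s : ℕ → ℤ) (a : ℝ) (γ : ℝ → ℂ) : Prop
    extends IsPotRay f d R s a γ where
  maximal : ∀ b δ, IsPotRay f d R s b δ → EqOn δ γ (Ioi a) → a ≤ b

/-- By Zorn's lemma. There may be several maximal continuations if the ray meets preimages of
singular values. -/
theorem IsPotRay.exists_isMaxPotRay (hγ : IsPotRay f d R s a γ) :
    ∃ b δ, b ≤ a ∧ IsMaxPotRay f d R s b δ ∧ EqOn δ γ (Ioi a) := by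
  let X := {p : ℝ × (ℝ → ℂ) // IsPotRay f d R s p.1 p.2 ∧ p.1 ≤ a ∧ EqOn p.2 γ (Ioi a)}
  let rel : X → X → Prop := fun p q => q.1.1 ≤ p.1.1 ∧ EqOn q.1.2 p.1.2 (Ioi p.1.1)
  have htrans : ∀ {p q v : X}, rel p q → rel q v → rel p v := fun {p q v} h1 h2 =>
    ⟨h2.1.trans h1.1, fun t ht => (h2.2 (lt_of_le_of_lt h1.1 ht)).trans (h1.2 ht)⟩
  have hchain : ∀ c : Set X, IsChain rel c → ∃ ub, ∀ p ∈ c, rel p ub := by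
    intro c hc
    rcases c.eq_empty_or_nonempty with rfl | ⟨p₀, hp₀⟩
    · exact ⟨⟨(a, γ), hγ, le_rfl, fun _ _ => rfl⟩, by simp⟩
    have hbdd : BddBelow ((fun p : X => p.1.1) '' c) := by
      refine ⟨0, ?_⟩
      rintro _ ⟨p, -, rfl⟩
      exact p.2.1.nonneg
    have hne : ((fun p : X => p.1.1) '' c).Nonempty := ⟨_, mem_image_of_mem _ hp₀⟩
    -- the union of the chain
    set a' := sInf ((fun p : X => p.1.1) '' c) with ha'
    have hle : ∀ p ∈ c, a' ≤ p.1.1 := fun p hp => csInf_le hbdd (mem_image_of_mem _ hp)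
    have hex : ∀ t, a' < t → ∃ p ∈ c, p.1.1 < t := by
      intro t ht
      obtain ⟨_, ⟨p, hp, rfl⟩, hpt⟩ := exists_lt_of_csInf_lt hne ht
      exact ⟨p, hp, hpt⟩
    have : Nonempty X := ⟨p₀⟩
    choose! q hqc hqt using hex
    have hagree : ∀ p ∈ c, EqOn (fun t => (q t).1.2 t) p.1.2 (Ioi p.1.1) := by
      intro p hp t ht
      have hat : a' < t := (hle p hp).trans_lt ht
      rcases eq_or_ne (q t) p with e | hne
      · simp only [e]
      rcases hc (hqc t hat) hp hne with h1 | h1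
      · exact (h1.2 (hqt t hat)).symm
      · exact h1.2 ht
    refine ⟨⟨(a', fun t => (q t).1.2 t), ?_, (hle p₀ hp₀).trans p₀.2.2.1, ?_⟩, ?_⟩
    · refine .of_local ?_ fun t ht => ?_
      · refine Real.sInf_nonneg ?_
        rintro _ ⟨p, -, rfl⟩
        exact p.2.1.nonneg
      · exact ⟨_, _, hqt t ht, (q t).2.1, hagree _ (hqc t ht)⟩
    · intro t ht
      have : (q t).1.2 t = p₀.1.2 t := hagree p₀ hp₀ (lt_of_le_of_lt p₀.2.2.1 ht)
      exact this.trans (p₀.2.2.2 ht)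
    · exact fun p hp => ⟨hle p hp, hagree p hp⟩
  obtain ⟨m, hm⟩ := exists_maximal_of_chains_bounded hchain htrans
  refine ⟨m.1.1, m.1.2, m.2.2.1, ⟨m.2.1, fun b δ hδ he => ?_⟩, m.2.2.2⟩
  by_contra! hlt
  have h1 := hm ⟨(b, δ), hδ, hlt.le.trans m.2.2.1, fun t ht =>
    (he (lt_of_le_of_lt m.2.2.1 ht)).trans (m.2.2.2 ht)⟩ ⟨hlt.le, he⟩
  exact absurd h1.1 (not_le.2 hlt)

lemma IsPotRay.address_eq (h : IsLarge f d R) (hγ : IsPotRay f d R s a γ)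
    (hδ : IsPotRay f d R s' b δ) (he : ∃ T, EqOn γ δ (Ioi T)) : s = s' := by
  obtain ⟨T, hT⟩ := he
  obtain ⟨T₁, hT₁⟩ := hγ.tail
  obtain ⟨T₂, hT₂⟩ := hδ.tail
  have h1 : T < max (T + 1) (max T₁ T₂) := (lt_add_one T).trans_le (le_max_left _ _)
  have h2 := hT₁ _ ((le_max_left _ T₂).trans (le_max_right (T + 1) _))
  have h3 := hT₂ _ ((le_max_right T₁ _).trans (le_max_right (T + 1) _))
  rw [hT h1] at h2
  exact tailSet.unique h.one_le h2 h3

/-- The parameter of a ray parametrized by potential cannot be changed. -/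
lemma SameCurve.eq_of_isPotRay (h : IsLarge f d R) (hγ : IsPotRay f d R s a γ)
    (hδ : IsPotRay f d R s' b δ) (he : SameCurve γ a δ b) :
    a = b ∧ EqOn δ γ (Ioi a) ∧ s = s' := by
  obtain ⟨p, -, -, h3, h4⟩ := he
  have hp : ∀ t ∈ Ioi a, p t = t := fun t ht => by
    have h5 : p t ∈ Ioi b := h3 ▸ mem_image_of_mem p ht
    have h6 := hδ.pot _ h5
    rw [← h4 t ht] at h6
    exact h6.unique h.one_le (hγ.pot t ht)
  have hab : a = b := by
    have h5 : p '' Ioi a = id '' Ioi a := image_congr hp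
    rw [h3, image_id] at h5
    exact (Ioi_injective h5).symm
  have heq : EqOn δ γ (Ioi a) := fun t ht => by rw [h4 t ht, hp t ht]
  exact ⟨hab, heq, hγ.address_eq h hδ ⟨a, heq.symm⟩⟩

lemma SameCurve.restrict (h : SameCurve γ a δ b) {c : ℝ} (hac : a ≤ c) :
    ∃ e, b ≤ e ∧ SameCurve γ c δ e ∧ (e = b → c = a) := by
  rcases hac.eq_or_lt with rfl | hac
  · exact ⟨b, le_rfl, h, fun _ => rfl⟩
  obtain ⟨p, h1, h2, h3, h4⟩ := h
  have hsub : Ioi c ⊆ Ioi a := Ioi_subset_Ioi hac.le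
  have hb : p c ∈ Ioi b := h3 ▸ mem_image_of_mem p hac
  refine ⟨p c, le_of_lt hb, ⟨p, h1.mono hsub, h2.mono hsub, Subset.antisymm ?_ ?_,
    fun t ht => h4 t (hsub ht)⟩, fun e => absurd e (ne_of_gt hb)⟩
  · rintro _ ⟨t, ht, rfl⟩
    exact h2 hac (hsub ht) ht
  · intro u hu
    have hu' : u ∈ Ioi b := lt_trans (show b < p c from hb) hu
    rw [← h3] at hu'
    obtain ⟨t, ht, rfl⟩ := hu'
    exact ⟨t, (h2.lt_iff_lt hac ht).1 hu, rfl⟩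

/-- A continuation of the curve can be parametrized by potential, and then it continues `γ`. -/
theorem IsMaxPotRay.isDynamicRay (hf : f ∈ Family d) (h : IsLarge f d R)
    (hγ : IsMaxPotRay f d R s a γ) : IsDynamicRay f fun t => γ (a + t) := by
  refine ⟨hγ.toIsPotRay.isRayCurve h, fun δ hδ b hb hsame => ?_⟩
  obtain ⟨s', a', δ', hδ', hsame'⟩ := hδ.exists_isPotRay hf h
  obtain ⟨e, hae, h1, h2⟩ := hsame'.restrict hb
  have h3 : SameCurve γ a δ' e :=
    (((SameCurve.translate (a := a) (fun t _ => rfl) (add_zero a)).symm).trans hsame).trans h1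
  obtain ⟨rfl, heq, rfl⟩ := h3.eq_of_isPotRay h hγ.toIsPotRay (hδ'.mono hae)
  exact h2 (le_antisymm (hγ.maximal _ _ hδ' heq) hae)

theorem IsDynamicRay.exists_isMaxPotRay (hf : f ∈ Family d) (h : IsLarge f d R)
    (hγ : IsDynamicRay f γ) : ∃ s a γ', IsMaxPotRay f d R s a γ' ∧ SameCurve γ 0 γ' a := by
  obtain ⟨s, a, γ', hγ', hsame⟩ := hγ.isRayCurve.exists_isPotRay hf h
  refine ⟨s, a, γ', ⟨hγ', fun b δ hδ he => ?_⟩, hsame⟩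
  by_contra! hlt
  have h1 : SameCurve γ' a (fun t => δ (b + t)) (a - b) := by
    refine SameCurve.translate (a := -b) (fun t ht => ?_) (by ring)
    rw [← he ht]
    congr 1
    ring
  have := hγ.maximal _ (hδ.isRayCurve h) (a - b) (by linarith) (hsame.trans h1)
  linarith

lemma SameCurve.hasAddress (h : SameCurve γ a δ b) (hγ : HasAddress f d r γ s) :
    HasAddress f d r δ s := by
  obtain ⟨p, -, h2, h3, h4⟩ := h
  obtain ⟨k, -, k2, k3, k4, k5⟩ := exists_inverse_param h2 h3
  have hk : Tendsto k atTop atTop := by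
    rw [tendsto_atTop]
    intro M
    have ha : a < max M (a + 1) := (lt_add_one a).trans_le (le_max_right _ _)
    have hb : p (max M (a + 1)) ∈ Ioi b := h3 ▸ mem_image_of_mem p ha
    filter_upwards [eventually_ge_atTop (p (max M (a + 1)))] with u hu
    calc M ≤ max M (a + 1) := le_max_left _ _
      _ = k (p (max M (a + 1))) := (k4 _ ha).symm
      _ ≤ k u := k2.monotoneOn hb (lt_of_lt_of_le (mem_Ioi.1 hb) hu) hu
  intro n
  filter_upwards [hk.eventually (hγ n), eventually_gt_atTop b] with u hu hbu
  rwa [h4 _ (k3 ▸ mem_image_of_mem k hbu), k5 u hbu] at hu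

/-- The address given by the strips is the one given by the tracts. -/
lemma IsPotRay.eq_of_hasAddress (hf : f ∈ Family d) (h : IsLarge f d R) (hrR : r ≤ R)
    (hr : Disjoint (rightHalfPlane r) (singularValues f)) (hγ : IsPotRay f d R s a γ)
    (hs' : HasAddress f d r γ s') : s = s' := by
  funext n
  obtain ⟨T, hT⟩ := hγ.tail
  obtain ⟨t, ht, h1, h2⟩ := ((eventually_ge_atTop T).and
    (((hγ.tendsto_re_iterate h (n + 1)).eventually_gt_atTop (Real.exp (d * (R + 1)))).and
      (hs' n))).exists
  rw [Function.iterate_succ_apply'] at h1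
  exact eq_of_mem_farStrip_of_mem_tract hf h hrR hr ⟨(hT t ht n).1, (hT t ht n).2, h1⟩ h2

/-! ### Images and preimages of rays -/

/-- The image of a ray is a ray. -/
lemma IsPotRay.map (h : IsLarge f d R) (hγ : IsPotRay f d R s a γ) :
    IsPotRay f d R (shift 1 s) (F d a) fun u => f (γ (Finv d u)) := by
  have hd := h.one_le
  have ha : 0 ≤ F d a := by simpa using F_iterate_nonneg hd 1 hγ.nonneg
  have hF : ∀ u, F d a < u → a < Finv d u := fun u hu => (lt_Finv_iff hd (by linarith)).2 hu
  refine ⟨ha, ?_, fun t ht => ?_, fun t ht => ?_, ?_⟩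
  · refine h.differentiable.continuous.comp_continuousOn (hγ.continuousOn.comp
      ((continuousOn_Finv d).mono (Ioi_subset_Ioi (by linarith))) hF)
  · have := (hγ.pot _ (hF t ht)).map hd
    rwa [F_Finv hd (by linarith)] at this
  · obtain ⟨N, hN⟩ := hγ.deep _ (hF t ht)
    refine ⟨N, fun u hu => ?_⟩
    have h1 : Finv d t ≤ Finv d u := by
      rw [← (F_strictMono hd).le_iff_le, F_Finv hd (by linarith), F_Finv hd (by linarith)]
      exact hu
    have h2 := tailSet.map (hN _ h1)
    rw [shift_shift] at h2
    rw [← Function.iterate_succ_apply f, Function.iterate_succ_apply' f, shift_shift, add_comm]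
    exact h2
  · obtain ⟨T, hT⟩ := hγ.tail
    refine ⟨max (F d T) 0, fun u hu => tailSet.map (hT _ ?_)⟩
    have hu0 : 0 ≤ u := (le_max_right _ _).trans hu
    rw [← (F_strictMono hd).le_iff_le, F_Finv hd (by linarith)]
    exact (le_max_left _ _).trans hu

lemma IsPotRay.exists_iterate (h : IsLarge f d R) (hγ : IsPotRay f d R s a γ) (n : ℕ) :
    ∃ δ, IsPotRay f d R (shift n s) ((F d)^[n] a) δ ∧
      ∀ t, a < t → δ ((F d)^[n] t) = f^[n] (γ t) := by
  have hd := h.one_le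
  induction n with
  | zero => exact ⟨γ, by simpa [shift_zero] using hγ, fun t _ => rfl⟩
  | succ n ih =>
    obtain ⟨δ, hδ, he⟩ := ih
    refine ⟨fun u => f (δ (Finv d u)), ?_, fun t ht => ?_⟩
    · have := hδ.map h
      rw [shift_shift, ← Function.iterate_succ_apply' (F d)] at this
      exact this
    · simp only
      rw [Function.iterate_succ_apply' (F d), Finv_F hd, he t ht, Function.iterate_succ_apply']

/-- A lift of a ray through `f` is a ray. -/
lemma IsPotRay.of_map (hf : f ∈ Family d) (h : IsLarge f d R) (hb : 0 ≤ b)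
    (hδ : IsPotRay f d R s (F d b) δ) (hγ : ContinuousOn γ (Ioi b))
    (he : ∀ t, b < t → f (γ t) = δ (F d t)) :
    ∃ s', shift 1 s' = s ∧ IsPotRay f d R s' b γ := by
  have hd := h.one_le
  have hR0 := h.big
  obtain ⟨B, hB⟩ := exists_lt_re_of_lt_norm hf R
  obtain ⟨T, hT⟩ := hδ.tail
  obtain ⟨T', hT'⟩ := eventually_atTop.1
    ((hδ.tendsto_norm_iterate h 0).eventually_gt_atTop B)
  obtain ⟨T₀, hT₀⟩ : ∃ T₀, b < T₀ ∧ max T T' ≤ T₀ :=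
    ⟨max (b + 1) (max T T'), (lt_add_one b).trans_le (le_max_left _ _), le_max_right _ _⟩
  have hle : ∀ t, T₀ ≤ t → T₀ ≤ F d t := fun t ht => ht.trans (le_F hd (by linarith))
  have htail : ∀ t, T₀ ≤ t → f (γ t) ∈ tailSet f d R s := fun t ht => by
    rw [he t (hT₀.1.trans_le ht)]
    exact hT _ ((le_max_left _ _).trans (hT₀.2.trans (hle t ht)))
  have hre : ∀ t, T₀ ≤ t → R ≤ (γ t).re := fun t ht => by
    refine (hB _ ?_).le
    rw [he t (hT₀.1.trans_le ht)]
    exact hT' _ ((le_max_right _ _).trans (hT₀.2.trans (hle t ht)))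
  have hfre : ∀ t, T₀ ≤ t → 0 ≤ (f (γ t)).re := fun t ht => by
    linarith [tailSet.re (htail t ht)]
  obtain ⟨n, hn⟩ := h.exists_inStrip (hre T₀ le_rfl) (hfre T₀ le_rfl)
  set s' : ℕ → ℤ := fun k => Nat.casesOn k n s with hs'
  have hss : shift 1 s' = s := by
    funext k
    simp [shift, hs', add_comm 1 k]
  refine ⟨s', hss, hb, hγ, fun t ht => ?_, fun t ht => ?_, T₀, fun t ht => ?_⟩
  · refine HasPot.of_map hd (hb.trans ht.le) ?_
    rw [he t ht]
    exact hδ.pot _ (F_strictMono hd ht)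
  · obtain ⟨N, hN⟩ := hδ.deep (F d t) (F_strictMono hd ht)
    refine ⟨N + 1, fun u hu => ?_⟩
    rw [Function.iterate_succ_apply, he u (ht.trans_le hu), add_comm N, ← shift_shift N 1 s', hss]
    exact hN _ ((F_strictMono hd).monotone hu)
  · refine tailSet.cons (hre t ht) ?_ (hss ▸ htail t ht)
    exact InStrip.of_isPreconnected h isPreconnected_Ici
      (hγ.mono (Ici_subset_Ioi.2 hT₀.1)) hre hfre (self_mem_Ici (a := T₀)) (mem_Ici.2 ht) hn

/-- Two rays that meet coincide as long as their images avoid the singular values. -/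
lemma IsPotRay.eqOn_of_eq (h : IsLarge f d R) (hγ : IsPotRay f d R s a γ)
    (hδ : IsPotRay f d R s' a δ) {t₀ : ℝ} (ht₀ : a < t₀) (he : γ t₀ = δ t₀)
    (hS : ∀ t, a < t → ∀ i, f^[i + 1] (γ t) ∉ singularValues f) : EqOn γ δ (Ioi a) := by
  refine eqOn_of_isPreconnected isPreconnected_Ioi hγ.continuousOn hδ.continuousOn ht₀ he ?_
  intro x hx hxe
  obtain ⟨b, hab, hbx⟩ := exists_between (show a < x from hx)
  obtain ⟨N, hN, hN'⟩ := ((hγ.eventually_mem_tailSet h hab R).and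
    (hδ.eventually_mem_tailSet h hab R)).exists
  obtain ⟨U, hU, hUi⟩ := exists_injOn_iterate h.differentiable N (z := γ x)
    fun i _ => hS x hx i
  have hcγ := (hγ.continuousOn.continuousAt (Ioi_mem_nhds hx)).tendsto
  have hcδ := (hδ.continuousOn.continuousAt (Ioi_mem_nhds hx)).tendsto
  rw [← hxe] at hcδ
  have hss : shift N s = shift N s' := by
    have h2 := hN' x hbx.le
    rw [← hxe] at h2
    exact tailSet.unique h.one_le (hN x hbx.le) h2
  filter_upwards [nhdsWithin_le_nhds (hcγ hU), nhdsWithin_le_nhds (hcδ hU),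
    nhdsWithin_le_nhds (Ioi_mem_nhds hbx)] with y hy1 hy2 hby
  refine hUi hy1 hy2 ?_
  have hby' : b < y := hby
  have h2 := hN' y hby'.le
  rw [← hss] at h2
  exact tailSet.eq_of_pot h (hN y hby'.le) h2
    ((hγ.pot y (hab.trans hby')).iterate h.one_le N)
    ((hδ.pot y (hab.trans hby')).iterate h.one_le N)

/-- Two rays with the same address coincide as long as their images avoid the singular values. -/
lemma IsPotRay.eqOn_of_address (h : IsLarge f d R) (hγ : IsPotRay f d R s a γ)
    (hδ : IsPotRay f d R s a δ)
    (hS : ∀ t, a < t → ∀ i, f^[i + 1] (γ t) ∉ singularValues f) : EqOn γ δ (Ioi a) := by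
  obtain ⟨T, hT⟩ := hγ.tail
  obtain ⟨T', hT'⟩ := hδ.tail
  have h1 : a < max (a + 1) (max T T') := (lt_add_one a).trans_le (le_max_left _ _)
  refine hγ.eqOn_of_eq h hδ h1 ?_ hS
  exact tailSet.eq_of_pot h (hT _ ((le_max_left _ _).trans (le_max_right _ _)))
    (hT' _ ((le_max_right _ _).trans (le_max_right _ _))) (hγ.pot _ h1) (hδ.pot _ h1)

/-- If the image of a ray can be continued without meeting a singular value, so can the ray. -/
lemma IsPotRay.exists_pullback (hf : f ∈ Family d) (h : IsLarge f d R)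
    (hγ : IsPotRay f d R s a γ) (hb : 0 ≤ b) (hba : b ≤ a)
    (hδ : IsPotRay f d R s' (F d b) δ) (he : ∀ t, a < t → δ (F d t) = f (γ t))
    (hS : ∀ t, F d b < t → δ t ∉ singularValues f) :
    ∃ η, IsPotRay f d R s b η ∧ EqOn η γ (Ioi a) := by
  have hd := h.one_le
  have hmaps : MapsTo (F d) (Ioi b) (Ioi (F d b)) := fun t ht => F_strictMono hd ht
  obtain ⟨η, h1, h2, h3⟩ := exists_lift_Ioi hf (z := γ (a + 1)) (u₀ := a + 1) (b := b)
    (hδ.continuousOn.comp (continuous_F d).continuousOn hmaps)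
    (fun u hu => hS _ (hmaps hu)) (by linarith) (he _ (lt_add_one a)).symm
  have heq : EqOn η γ (Ioi a) := by
    refine eqOn_of_isPreconnected isPreconnected_Ioi (h1.mono (Ioi_subset_Ioi hba))
      hγ.continuousOn (lt_add_one a) h2 fun x hx hxe => ?_
    obtain ⟨U, hU, hUi⟩ := exists_injOn_iterate h.differentiable 1 (z := γ x) fun i hi => by
      obtain rfl : i = 0 := by omega
      rw [zero_add, Function.iterate_one, ← he x hx]
      exact hS _ (hmaps (lt_of_le_of_lt hba hx))
    have hcη := (h1.continuousAt (Ioi_mem_nhds (lt_of_le_of_lt hba hx))).tendsto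
    rw [hxe] at hcη
    have hcγ := (hγ.continuousOn.continuousAt (Ioi_mem_nhds hx)).tendsto
    filter_upwards [nhdsWithin_le_nhds (hcη hU), nhdsWithin_le_nhds (hcγ hU),
      self_mem_nhdsWithin] with y hy1 hy2 hy
    refine hUi hy1 hy2 ?_
    rw [Function.iterate_one, h3 y (lt_of_le_of_lt hba hy)]
    exact he y hy
  obtain ⟨s'', -, hη⟩ := hδ.of_map hf h hb h1 h3
  have := hη.address_eq h hγ ⟨a, heq⟩
  exact ⟨η, this ▸ hη, heq⟩

/-- Every ray is part of a dynamic ray. -/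
lemma IsPotRay.exists_isDynamicRay (hf : f ∈ Family d) (h : IsLarge f d R)
    (hγ : IsPotRay f d R s a γ) :
    ∃ b δ, b ≤ a ∧ IsMaxPotRay f d R s b δ ∧ EqOn δ γ (Ioi a) ∧
      IsDynamicRay f fun t => δ (b + t) := by
  obtain ⟨b, δ, h1, h2, h3⟩ := hγ.exists_isMaxPotRay
  exact ⟨b, δ, h1, h2, h3, h2.isDynamicRay hf h⟩

lemma sameCurve_refl (γ : ℝ → ℂ) (a : ℝ) : SameCurve γ a γ a :=
  ⟨id, continuousOn_id, strictMonoOn_id, image_id _, fun _ _ => rfl⟩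

lemma SameCurve.congr_left {ε : ℝ → ℂ} (h : SameCurve γ a δ b) (he : EqOn ε γ (Ioi a)) :
    SameCurve ε a δ b := by
  obtain ⟨p, h1, h2, h3, h4⟩ := h
  exact ⟨p, h1, h2, h3, fun t ht => (he ht).trans (h4 t ht)⟩

lemma sameCurve_iterate (hd : 1 ≤ d) (n : ℕ) (he : ∀ t, a < t → δ ((F d)^[n] t) = f^[n] (γ t)) :
    SameCurve (fun t => f^[n] (γ t)) a δ ((F d)^[n] a) := by
  refine ⟨(F d)^[n], ((continuous_F d).iterate n).continuousOn,
    (F_iterate_strictMono hd n).strictMonoOn _, Subset.antisymm ?_ ?_, fun t ht => (he t ht).symm⟩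
  · rintro _ ⟨t, ht, rfl⟩
    exact F_iterate_strictMono hd n ht
  · intro u hu
    have h2 := (tendsto_atTop_atTop.1 (tendsto_atTop_mono' (f₁ := fun t : ℝ => t)
      atTop (by
        filter_upwards [eventually_ge_atTop 0] with t ht
        exact le_F_iterate hd ht n) tendsto_id) u)
    obtain ⟨B, hB⟩ := h2
    have h3 : (F d)^[n] a < u := hu
    have h4 := intermediate_value_Icc (le_max_left a B)
      ((continuous_F d).iterate n).continuousOn ⟨h3.le, hB _ (le_max_right a B)⟩
    obtain ⟨t, ht, rfl⟩ := h4
    exact ⟨t, (F_iterate_strictMono hd n).lt_iff_lt.1 h3, rfl⟩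

/-- The hypothesis on the iterates of a ray, in terms of parametrization by potential. -/
lemma IteratesAvoidSingularValues.notMem (hf : f ∈ Family d) (h : IsLarge f d R) {γ₀ : ℝ → ℂ}
    (hav : IteratesAvoidSingularValues f γ₀) (hsame : SameCurve γ₀ 0 γ a)
    {n : ℕ} (hn : 1 ≤ n) (hδ : IsPotRay f d R s' b δ) (hb : b ≤ (F d)^[n] a)
    (he : ∀ t, a < t → δ ((F d)^[n] t) = f^[n] (γ t)) {u : ℝ} (hu : b < u) :
    δ u ∉ singularValues f := by
  obtain ⟨c, ε, hcb, -, h1, h2⟩ := hδ.exists_isDynamicRay hf h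
  have h3 : SameCurve (fun t => f^[n] (γ₀ t)) 0 δ ((F d)^[n] a) := by
    refine SameCurve.trans ?_ (sameCurve_iterate h.one_le n he)
    obtain ⟨p, p1, p2, p3, p4⟩ := hsame
    exact ⟨p, p1, p2, p3, fun t ht => congrArg f^[n] (p4 t ht)⟩
  have h4 : SameCurve δ ((F d)^[n] a) (fun t => ε (c + t)) ((F d)^[n] a - c) := by
    refine SameCurve.translate (a := -c) (fun t ht => ?_) (by ring)
    rw [← h1 (lt_of_le_of_lt hb ht)]
    congr 1
    ring
  have h5 := hav n hn _ h2 ⟨_, by linarith, h3.trans h4⟩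
  refine disjoint_left.1 h5 ⟨u - c, show 0 < u - c by linarith, ?_⟩
  simp only [add_sub_cancel]
  exact h1 hu

/-! ### Existence of rays with a given address -/

lemma IsStd.mono_pot (hd : 1 ≤ d) {u v : ℝ} (hu : IsStd d R s u) (huv : u ≤ v) :
    IsStd d R s v :=
  ⟨hu.big.trans huv, fun k => (hu.cone k).trans
    (div_le_div_of_nonneg_right ((F_iterate_strictMono hd k).monotone huv) (by norm_num))⟩

/-- Close to the right end the ray with a given address is close to its model, the sequence of
horizontal half-lines given by the address. -/
theorem IsStd.exists_isPotRay (h : IsLarge f d R) {U : ℝ} (hU : IsStd d (R + 2) s U) :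
    ∃ σ, IsPotRay f d R s U σ ∧ ∀ u, U < u → σ u ∈ tailSet f d R s ∧
      ∀ k : ℕ, ‖f^[k] (σ u) - stripPoint d (s k) ((F d)^[k] u)‖ ≤ 1 := by
  have hRR : R ≤ R + 2 := by linarith
  have h' := h.mono hRR
  choose! σ h1 h2 h3 using fun u (hu : U < u) => (hU.mono_pot h.one_le hu.le).exists_mem_tailSet h'
  refine ⟨σ, ⟨hU.nonneg h', fun t ht => ?_, h2, fun t ht => ⟨0, fun u hu => ?_⟩, U + 1,
    fun u hu => tailSet.mono hRR (h1 u (by linarith))⟩,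
    fun u hu => ⟨tailSet.mono hRR (h1 u hu), h3 u hu⟩⟩
  · refine tailSet.tendsto_of_pot h (T := id) ?_ (h1 t ht) (h2 t ht)
      (tendsto_id.mono_left nhdsWithin_le_nhds)
    filter_upwards [self_mem_nhdsWithin] with u hu
    exact ⟨h1 u hu, h2 u hu⟩
  · rw [shift_zero]
    exact tailSet.mono hRR (h1 u (ht.trans_le hu))

theorem exists_isDynamicRay_hasAddress (hf : f ∈ Family d) (h : IsLarge f d R) (hrR : r ≤ R)
    (hs : ExpBounded d s) : ∃ γ, IsDynamicRay f γ ∧ HasAddress f d r γ s := by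
  obtain ⟨U, hU⟩ := exists_isStd h.one_le (R + 2) hs
  obtain ⟨σ, hσ, -⟩ := (hU U le_rfl).exists_isPotRay h
  obtain ⟨b, δ, -, h1, -, h2⟩ := hσ.exists_isDynamicRay hf h
  exact ⟨_, h2, h1.toIsPotRay.hasAddress h hrR⟩

/-! ### Rays whose iterates avoid the singular values -/

/-- The potentials on a ray are larger than the minimal potential of its address. -/
lemma IsPotRay.minPotential_le (h : IsLarge f d R) (hs : ExpBounded d s)
    (hγ : IsPotRay f d R s a γ) : minPotential d s ≤ a := by
  refine le_of_forall_gt_imp_ge_of_dense fun t ht => ?_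
  obtain ⟨N, hN⟩ := hγ.deep t ht
  have h1 := tailSet.minPotential_le h (hN t le_rfl) ((hγ.pot t ht).iterate h.one_le N)
  rw [minPotential_shift h.one_le hs] at h1
  exact (F_iterate_strictMono h.one_le N).le_iff_le.1 h1

lemma IsMaxPotRay.unique (h : IsLarge f d R) (hγ : IsMaxPotRay f d R s a γ)
    (hδ : IsMaxPotRay f d R s b δ)
    (hS : ∀ t, a < t → ∀ i, f^[i + 1] (γ t) ∉ singularValues f) : a = b ∧ EqOn δ γ (Ioi a) := by
  have heq := (hγ.toIsPotRay.mono (le_max_left a b)).eqOn_of_address h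
    (hδ.toIsPotRay.mono (le_max_right a b)) fun t ht => hS t ((le_max_left a b).trans_lt ht)
  have h1 : a ≤ b := by
    by_contra! hlt
    rw [max_eq_left hlt.le] at heq
    exact absurd (hγ.maximal _ _ hδ.toIsPotRay heq.symm) (not_le.2 hlt)
  have h2 : b ≤ a := by
    by_contra! hlt
    rw [max_eq_right hlt.le] at heq
    exact absurd (hδ.maximal _ _ hγ.toIsPotRay heq) (not_le.2 hlt)
  rw [max_eq_left h2] at heq
  exact ⟨le_antisymm h1 h2, heq.symm⟩

/-- The images of a ray, if they and their continuations avoid the singular values, are not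
contained in longer rays. -/
lemma IsMaxPotRay.iterate (hf : f ∈ Family d) (h : IsLarge f d R) (hγ : IsMaxPotRay f d R s a γ)
    {Γ : ℕ → ℝ → ℂ} (hΓ : ∀ n, IsPotRay f d R (shift n s) ((F d)^[n] a) (Γ n))
    (he : ∀ n t, a < t → Γ n ((F d)^[n] t) = f^[n] (γ t))
    (hav : ∀ n b δ, IsPotRay f d R (shift (n + 1) s) b δ → b ≤ (F d)^[n + 1] a →
      EqOn δ (Γ (n + 1)) (Ioi ((F d)^[n + 1] a)) → ∀ u, b < u → δ u ∉ singularValues f) (n : ℕ) :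
    IsMaxPotRay f d R (shift n s) ((F d)^[n] a) (Γ n) := by
  have hd := h.one_le
  induction n with
  | zero =>
    refine ⟨hΓ 0, fun b δ hδ heq => ?_⟩
    rw [shift_zero] at hδ
    exact hγ.maximal b δ hδ fun t ht => (heq ht).trans (he 0 t ht)
  | succ n ih =>
    refine ⟨hΓ (n + 1), fun b δ hδ heq => ?_⟩
    by_contra! hlt
    have hb0 := hδ.nonneg
    have hFb : F d (Finv d b) = b := F_Finv hd (by linarith)
    have hF := hlt
    rw [Function.iterate_succ_apply', ← Finv_lt_iff hd (by linarith)] at hF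
    have hfinv : 0 ≤ Finv d b := by
      rwa [← (F_strictMono hd).le_iff_le, hFb, F_zero]
    have hav' := hav n b δ hδ hlt.le heq
    obtain ⟨η, hη, hηe⟩ := (hΓ n).exists_pullback hf h hfinv hF.le (δ := δ) (s' := shift (n + 1) s)
      (hFb.symm ▸ hδ) (fun t ht => by
        have hmono := F_iterate_strictMono hd n
        obtain ⟨v, hv0, rfl⟩ := exists_F_iterate_eq hd n (u := t) ((hΓ n).nonneg.trans ht.le)
        have hav : a < v := hmono.lt_iff_lt.1 ht
        rw [he n v hav, ← Function.iterate_succ_apply' (F d), ← Function.iterate_succ_apply' f,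
          ← he (n + 1) v hav]
        exact heq (F_iterate_strictMono hd (n + 1) hav)) (fun t ht => hav' t (hFb ▸ ht))
    exact absurd (ih.maximal _ _ hη hηe) (not_le.2 hF)

/-- If the iterates of a ray avoid the singular values, the ray has exactly the potentials above the
minimal potential of its address, and its images are maximal rays, none of whose images meets a
singular value. -/
theorem IteratesAvoidSingularValues.exists_rays (hf : f ∈ Family d) (h : IsLarge f d R)
    (hs : ExpBounded d s) {γ₀ : ℝ → ℂ} (hav : IteratesAvoidSingularValues f γ₀)
    (hγ : IsMaxPotRay f d R s a γ) (hsame : SameCurve γ₀ 0 γ a) :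
    a = minPotential d s ∧ ∃ Γ : ℕ → ℝ → ℂ,
      (∀ n, IsMaxPotRay f d R (shift n s) ((F d)^[n] a) (Γ n)) ∧
      (∀ n t, a < t → Γ n ((F d)^[n] t) = f^[n] (γ t)) ∧
      ∀ n u, (F d)^[n] a < u → ∀ i, f^[i + 1] (Γ n u) ∉ singularValues f := by
  have hd := h.one_le
  choose Γ hΓ he using fun n => hγ.toIsPotRay.exists_iterate h n
  have hmax := hγ.iterate hf h hΓ he fun n b δ hδ hb heq u hu =>
    hav.notMem hf h hsame (n := n + 1) (by omega) hδ hb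
      (fun t ht => (heq (F_iterate_strictMono hd _ ht)).trans (he _ t ht)) hu
  have hS : ∀ n u, (F d)^[n] a < u → ∀ i, f^[i + 1] (Γ n u) ∉ singularValues f := by
    intro n u hu i
    obtain ⟨v, hv0, rfl⟩ := exists_F_iterate_eq hd n (u := u) ((hΓ n).nonneg.trans hu.le)
    have hav' : a < v := (F_iterate_strictMono hd n).lt_iff_lt.1 hu
    rw [he n v hav', ← Function.iterate_add_apply, ← he _ v hav']
    exact hav.notMem hf h hsame (n := i + 1 + n) (by omega) (hΓ _) le_rfl (he _)
      (F_iterate_strictMono hd _ hav')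
  refine ⟨le_antisymm ?_ (hγ.toIsPotRay.minPotential_le h hs), Γ, hmax, he, hS⟩
  -- a ray of model orbits with potentials above `F^n(t)`, `t < a`, would continue the `n`-th image
  refine le_of_forall_gt_imp_ge_of_dense fun t ht => ?_
  by_contra! hta
  obtain ⟨n, hn⟩ := (eventually_isStd_shift hd (R + 2) (mem_boundSet_of_lt hd hs ht)).exists
  obtain ⟨σ, hσ, -⟩ := (hn _ le_rfl).exists_isPotRay h
  have hlt := F_iterate_strictMono hd n hta
  have h1 := (hΓ n).eqOn_of_address h (hσ.mono hlt.le) (hS n)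
  exact absurd ((hmax n).maximal _ _ hσ h1.symm) (not_le.2 hlt)

/-! ### Asymptotics -/

/-- Since `Φ(z) - z = O(exp (-Re z))`, the estimate of `chart_sub_stripPoint_le` carries over to `z`. -/
lemma norm_sub_stripPoint_le (h : IsLarge f d R) {K : ℝ} (hK0 : 0 ≤ K)
    (hK : ∀ z : ℂ, R ≤ z.re → ‖chart f d z - z‖ ≤ K * Real.exp (-z.re)) {u : ℝ}
    (hz : z ∈ tailSet f d R s) (h0 : ‖z - stripPoint d (s 0) u‖ ≤ 1)
    (h1 : ‖f z - stripPoint d (s 1) (F d u)‖ ≤ 1)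
    (hsmall : (2 + 2 * Real.pi * |(s 1 : ℝ)| / d) * Real.exp (-(d * u)) ≤ 1 / 2) :
    ‖z - stripPoint d (s 0) u‖ ≤
      3 / 2 * ((2 + 2 * Real.pi * |(s 1 : ℝ)| / d) * Real.exp (-(d * u))) +
        K * Real.exp 1 * Real.exp (-u) := by
  have h2 := chart_sub_stripPoint_le h (tailSet.re hz) (hz 0).2 h1 hsmall
  have h3 := hK z (tailSet.re hz)
  have h4 : u - 1 ≤ z.re := by
    have := (abs_le.1 ((Complex.abs_re_le_norm _).trans h0)).1
    rw [Complex.sub_re, stripPoint_re] at this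
    linarith
  have h5 : K * Real.exp (-z.re) ≤ K * Real.exp 1 * Real.exp (-u) := by
    rw [mul_assoc, ← Real.exp_add]
    gcongr
    linarith
  have e : z - stripPoint d (s 0) u =
      (chart f d z - stripPoint d (s 0) u) - (chart f d z - z) := by ring
  rw [e]
  exact (norm_sub_le _ _).trans (add_le_add h2 (h3.trans h5))

/-- The asymptotics of a single ray. -/
theorem IsPotRay.exists_norm_sub_stripPoint_le (h : IsLarge f d R) (hs : ExpBounded d s)
    (hγ : IsPotRay f d R s a γ) {c : ℝ} (hc : a < c) :
    ∃ C, ∀ u, c ≤ u → ‖γ u - stripPoint d (s 0) u‖ ≤ C * Real.exp (-u / 2) := by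
  have hd := h.cast_one_le
  obtain ⟨K, hK0, hK⟩ := h.asymp
  obtain ⟨U, hU⟩ := exists_isStd h.one_le (R + 2) hs
  obtain ⟨σ, hσ, hσ'⟩ := (hU U le_rfl).exists_isPotRay h
  obtain ⟨T, hT⟩ := hγ.tail
  set V := max (max T (U + 1)) c with hV
  have hTV : T ≤ V := (le_max_left _ _).trans (le_max_left _ _)
  have hUV : U + 1 ≤ V := (le_max_right _ _).trans (le_max_left _ _)
  have hcV : c ≤ V := le_max_right _ _
  have hcont : ContinuousOn (fun u => ‖γ u - stripPoint d (s 0) u‖ * Real.exp (u / 2)) (Icc c V) := by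
    refine ContinuousOn.mul (ContinuousOn.norm (ContinuousOn.sub
      (hγ.continuousOn.mono fun u hu => hc.trans_le hu.1) ?_)) (by fun_prop)
    unfold stripPoint
    fun_prop
  obtain ⟨C₁, hC₁⟩ := (isCompact_Icc.image_of_continuousOn hcont).bddAbove
  set C₂ := 3 / 2 * (2 + 2 * Real.pi * |(s 1 : ℝ)| / d) + K * Real.exp 1 with hC₂
  have hexp : ∀ u : ℝ, Real.exp (u / 2) * Real.exp (-u / 2) = 1 := fun u => by
    rw [← Real.exp_add]; ring_nf; simp
  refine ⟨max C₁ C₂, fun u hu => ?_⟩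
  rcases le_total u V with huV | huV
  · have h1 := hC₁ (mem_image_of_mem _ (show u ∈ Icc c V from ⟨hu, huV⟩))
    calc _ = ‖γ u - stripPoint d (s 0) u‖ * Real.exp (u / 2) * Real.exp (-u / 2) := by
          rw [mul_assoc, hexp, mul_one]
      _ ≤ _ := by gcongr; exact h1.trans (le_max_left _ _)
  · have hUu : U < u := by linarith
    have heq : γ u = σ u := tailSet.eq_of_pot h (hT u (hTV.trans huV)) (hσ' u hUu).1
      (hγ.pot u (hc.trans_le hu)) (hσ.pot u hUu)
    have hstd := hU u hUu.le
    have hu0 : 0 ≤ u := hstd.nonneg (h.mono (by linarith))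
    have h1 := (hσ' u hUu).2
    have h2 := norm_sub_stripPoint_le h hK0 hK (u := u) (hσ' u hUu).1 (h1 0) (h1 1)
      (hstd.smallness (h.mono (by linarith)))
    rw [heq]
    refine h2.trans ?_
    have h3 : Real.exp (-(d * u)) ≤ Real.exp (-u / 2) := by
      gcongr
      nlinarith
    have h4 : Real.exp (-u) ≤ Real.exp (-u / 2) := by gcongr; linarith
    calc _ ≤ 3 / 2 * ((2 + 2 * Real.pi * |(s 1 : ℝ)| / d) * Real.exp (-u / 2)) +
          K * Real.exp 1 * Real.exp (-u / 2) := by gcongr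
      _ = C₂ * Real.exp (-u / 2) := by rw [hC₂]; ring
      _ ≤ _ := by gcongr; exact le_max_right _ _

/-- The asymptotics of the images of a ray, with uniform constants. -/
theorem exists_uniform_norm_sub_stripPoint_le (h : IsLarge f d R) (hs : ExpBounded d s)
    {Γ : ℕ → ℝ → ℂ} (ha : a = minPotential d s)
    (hΓ : ∀ n, IsPotRay f d R (shift n s) ((F d)^[n] a) (Γ n))
    (hS : ∀ n u, (F d)^[n] a < u → ∀ i, f^[i + 1] (Γ n u) ∉ singularValues f) {t' : ℝ}
    (ht' : a < t') :
    ∃ C, ∀ n u, (F d)^[n] t' ≤ u → ‖Γ n u - stripPoint d (s n) u‖ ≤ C * Real.exp (-u / 2) := by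
  have hd := h.cast_one_le
  have hd1 := h.one_le
  have ha0 : 0 ≤ a := (hΓ 0).nonneg
  obtain ⟨K, hK0, hK⟩ := h.asymp
  -- the entries of the address are bounded in terms of `F^n(t'')`, and `2 F^n(t'') ≤ F^n(t')` eventually
  obtain ⟨t'', hat, htt⟩ := exists_between ht'
  have ht0 : 0 < t'' := ha0.trans_lt hat
  obtain ⟨N, hN⟩ := eventually_atTop.1 ((eventually_isStd_shift hd1 (R + 2)
    (mem_boundSet_of_lt hd1 hs (ha ▸ hat))).and (eventually_mul_F_iterate_add_le hd1 ht0 htt 2))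
  choose C hC using fun n => (hΓ n).exists_norm_sub_stripPoint_le h (hs.shift hd1 n)
    (F_iterate_strictMono hd1 n ht')
  set C₀ := 3 / 2 * 3 + K * Real.exp 1 with hC₀
  have hC₀0 : 0 ≤ C₀ := by positivity
  refine ⟨C₀ + ∑ n ∈ Finset.range N, |C n|, fun n u hu => ?_⟩
  rcases lt_or_ge n N with hn | hn
  · refine (hC n u hu).trans ?_
    gcongr
    have := Finset.single_le_sum (f := fun n => |C n|) (fun i _ => abs_nonneg _)
      (Finset.mem_range.2 hn)
    linarith [le_abs_self (C n)]
  · obtain ⟨hstd, hmul⟩ := hN n hn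
    have htu : (F d)^[n] t'' < u := (F_iterate_strictMono hd1 n htt).trans_le hu
    obtain ⟨σ, hσ, hσ'⟩ := (hstd _ le_rfl).exists_isPotRay h
    have hau := F_iterate_strictMono hd1 n hat
    have heq : Γ n u = σ u := ((hΓ n).mono hau.le).eqOn_of_address h hσ
      (fun t ht => hS n t (hau.trans ht)) htu
    have h1 := (hσ' u htu).2
    have h2 := norm_sub_stripPoint_le h hK0 hK (u := u) (hσ' u htu).1 (h1 0) (h1 1)
      ((hstd u htu.le).smallness (h.mono (by linarith)))
    have hsn : shift n s 0 = s n := rfl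
    rw [hsn] at h2
    rw [heq]
    refine h2.trans ?_
    have hu0 : 0 ≤ u := (F_iterate_nonneg hd1 n ht0.le).trans htu.le
    have hcone := (hstd _ le_rfl).cone 1
    have h3 : 2 * Real.pi * |(shift n s 1 : ℝ)| / d ≤ Real.exp (d * (u / 2)) := by
      have h4 : F d ((F d)^[n] t'') ≤ Real.exp (d * (u / 2)) := by
        have : Real.exp (d * (F d)^[n] t'') ≤ Real.exp (d * (u / 2)) := by
          gcongr
          linarith
        simp only [F]
        linarith
      rw [Function.iterate_one] at hcone
      have h5 : 0 ≤ F d ((F d)^[n] t'') := by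
        simpa using F_iterate_nonneg hd1 1 (F_iterate_nonneg hd1 n ht0.le)
      linarith
    have h6 : 1 ≤ Real.exp (d * (u / 2)) := Real.one_le_exp (by positivity)
    have h7 : Real.exp (d * (u / 2)) * Real.exp (-(d * u)) ≤ Real.exp (-u / 2) := by
      rw [← Real.exp_add]
      gcongr
      nlinarith
    have h8 : Real.exp (-u) ≤ Real.exp (-u / 2) := by gcongr; linarith
    have h9 : (2 + 2 * Real.pi * |(shift n s 1 : ℝ)| / d) * Real.exp (-(d * u)) ≤
        3 * Real.exp (-u / 2) := by
      calc _ ≤ (3 * Real.exp (d * (u / 2))) * Real.exp (-(d * u)) :=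
            mul_le_mul_of_nonneg_right (by linarith) (Real.exp_nonneg _)
        _ ≤ _ := by rw [mul_assoc]; gcongr
    calc _ ≤ 3 / 2 * (3 * Real.exp (-u / 2)) + K * Real.exp 1 * Real.exp (-u / 2) := by gcongr
      _ = C₀ * Real.exp (-u / 2) := by rw [hC₀]; ring
      _ ≤ _ := by
        gcongr
        exact le_add_of_nonneg_right (Finset.sum_nonneg fun i _ => abs_nonneg _)

/-! ### Uniqueness and parametrization -/

lemma IsDynamicRay.exists_isMaxPotRay_of_hasAddress (hf : f ∈ Family d) (h : IsLarge f d R)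
    (hrR : r ≤ R) (hr : Disjoint (rightHalfPlane r) (singularValues f)) (hγ : IsDynamicRay f γ)
    (hs : HasAddress f d r γ s) : ∃ a γ', IsMaxPotRay f d R s a γ' ∧ SameCurve γ 0 γ' a := by
  obtain ⟨s', a, γ', h1, h2⟩ := hγ.exists_isMaxPotRay hf h
  obtain rfl := h1.toIsPotRay.eq_of_hasAddress hf h hrR hr (h2.hasAddress hs)
  exact ⟨a, γ', h1, h2⟩

/-- A ray whose iterates avoid the singular values is the only one with its address, and so are
its images; they are parametrized by potential. -/
theorem unique_parametrization (hf : f ∈ Family d) (h : IsLarge f d R)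
    (hrR : r ≤ R) (hr : Disjoint (rightHalfPlane r) (singularValues f)) (hs : ExpBounded d s)
    (hγ : IsDynamicRay f γ) (hγs : HasAddress f d r γ s) (hav : IteratesAvoidSingularValues f γ) :
    ∃ Γ : ℕ → ℝ → ℂ,
      SameCurve γ 0 (Γ 0) (minPotential d s) ∧
      (∀ n : ℕ, (∃ δ : ℝ → ℂ, IsDynamicRay f δ ∧ HasAddress f d r δ (shift n s)) ∧
        ∀ δ : ℝ → ℂ, IsDynamicRay f δ → HasAddress f d r δ (shift n s) →
          SameCurve δ 0 (Γ n) (minPotential d (shift n s))) ∧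
      (∀ n t, minPotential d s < t → f^[n] (Γ 0 t) = Γ n ((F d)^[n] t)) ∧
      ∀ t', minPotential d s < t' → ∃ C, ∀ n u, (F d)^[n] t' ≤ u →
        ‖Γ n u - stripPoint d (s n) u‖ ≤ C * Real.exp (-u / 2) := by
  have hd := h.one_le
  obtain ⟨a, γ', hγ', hsame⟩ := hγ.exists_isMaxPotRay_of_hasAddress hf h hrR hr hγs
  obtain ⟨ha, Γ, hΓ, he, hS⟩ := hav.exists_rays hf h hs hγ' hsame
  have h0 : EqOn (Γ 0) γ' (Ioi a) := he 0
  refine ⟨Γ, ?_, fun n => ⟨?_, fun δ hδ hδs => ?_⟩, fun n t ht => ?_, fun t' ht' => ?_⟩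
  · rw [← ha]
    exact hsame.trans ((sameCurve_refl _ _).congr_left h0.symm)
  · exact ⟨_, (hΓ n).isDynamicRay hf h, (hΓ n).toIsPotRay.hasAddress h hrR⟩
  · obtain ⟨b, δ', hδ', hsame'⟩ := hδ.exists_isMaxPotRay_of_hasAddress hf h hrR hr hδs
    obtain ⟨hab, heq⟩ := (hΓ n).unique h hδ' (hS n)
    rw [minPotential_shift hd hs, ← ha, hab]
    rw [hab] at heq
    exact hsame'.trans ((sameCurve_refl _ _).congr_left heq)
  · rw [← ha] at ht
    rw [h0 ht, he n t ht]
  · exact exists_uniform_norm_sub_stripPoint_le h hs ha (fun n => (hΓ n).toIsPotRay) hS (ha ▸ ht')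

/-- If no singular value escapes, every ray has the largest possible range of potentials. -/
lemma IsMaxPotRay.eq_minPotential (hf : f ∈ Family d) (h : IsLarge f d R)
    (hS : Disjoint (singularValues f) (escapingSet f)) (hγ : IsMaxPotRay f d R s a γ) :
    ExpBounded d s ∧ a = minPotential d s := by
  have hs : ExpBounded d s := by
    obtain ⟨T, hT⟩ := hγ.tail
    exact tailSet.expBounded h (hT T le_rfl)
  refine ⟨hs, ?_⟩
  have hav : IteratesAvoidSingularValues f fun t => γ (a + t) := by
    intro n _ δ hδ _
    refine disjoint_left.2 ?_
    rintro _ ⟨t, ht, rfl⟩ hsing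
    exact disjoint_left.1 hS hsing (hδ.isRayCurve.mapsTo ht)
  exact (hav.exists_rays hf h hs hγ (SameCurve.translate (fun t _ => rfl) (add_zero a))).1

/-! ### Every escaping point lies on a ray or is an endpoint -/

lemma escapingSet.exists_mem_tailSet (hf : f ∈ Family d) (h : IsLarge f d R)
    (hz : z ∈ escapingSet f) : ∃ N s, f^[N] z ∈ tailSet f d R s := by
  obtain ⟨B, hB⟩ := exists_lt_re_of_lt_norm hf R
  obtain ⟨N, hN⟩ := eventually_atTop.1 ((tendsto_norm_atTop_iff_cobounded.2 hz).eventually_gt_atTop B)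
  obtain ⟨s, hs⟩ := PolyExp.exists_mem_tailSet h (z := f^[N] z) fun k => by
    refine (hB _ ?_).le
    rw [← Function.iterate_add_apply, ← Function.iterate_succ_apply' f]
    exact hN _ (by omega)
  exact ⟨N, s, hs⟩

lemma map_mem_escapingSet (hz : z ∈ escapingSet f) : f z ∈ escapingSet f := by
  have h1 : Tendsto (fun n : ℕ => f^[n + 1] z) atTop (Bornology.cobounded ℂ) :=
    (tendsto_add_atTop_iff_nat 1).2 hz
  simpa only [Function.iterate_succ_apply] using! h1

lemma iterate_mem_escapingSet (hz : z ∈ escapingSet f) (n : ℕ) : f^[n] z ∈ escapingSet f := by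
  induction n with
  | zero => exact hz
  | succ n ih => rw [Function.iterate_succ_apply']; exact map_mem_escapingSet ih

lemma IsPotRay.mem_escapingSet (h : IsLarge f d R) (hγ : IsPotRay f d R s a γ) {t : ℝ}
    (ht : a < t) : γ t ∈ escapingSet f :=
  (hγ.pot t ht).mem_escapingSet h.one_le (hγ.nonneg.trans_lt ht)

/-- The points with a given address and larger potential form a ray. -/
lemma tailSet.exists_isPotRay (h : IsLarge f d R) (hw : w ∈ tailSet f d (R + 2 + 2) s) :
    ∃ a γ, IsPotRay f d R s a γ ∧ Tendsto γ (𝓝[>] a) (𝓝 w) := by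
  have hRR : R ≤ R + 2 := by linarith
  have h2 := h.mono hRR
  have hw' : w ∈ tailSet f d (R + 2) s := tailSet.mono (by linarith) hw
  obtain ⟨a, ha⟩ := tailSet.exists_hasPot h2 hw'
  choose! γ h1 h3 using fun t (ht : a < t) => tailSet.exists_pot_gt h2 hw ha ht
  have hlim : ∀ t z, HasPot f d z t → z ∈ tailSet f d (R + 2) s →
      Tendsto γ (𝓝[Ioi a] t) (𝓝 z) := by
    intro t z hz hz'
    refine tailSet.tendsto_of_pot h (T := id) ?_ hz' hz (tendsto_id.mono_left nhdsWithin_le_nhds)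
    filter_upwards [self_mem_nhdsWithin] with u hu
    exact ⟨h1 u hu, h3 u hu⟩
  refine ⟨a, γ, ⟨ha.nonneg, fun t ht => hlim t _ (h3 t ht) (h1 t ht), h3, fun t ht =>
    ⟨0, fun u hu => ?_⟩, a + 1, fun u hu => tailSet.mono hRR (h1 u (by linarith))⟩,
    hlim a w ha hw'⟩
  rw [shift_zero]
  exact tailSet.mono hRR (h1 u (ht.trans_le hu))

/-- A ray that lands at a non-singular point `f z` can be lifted to a ray that lands at `z`. -/
lemma IsPotRay.exists_lift_of_tendsto (hf : f ∈ Family d) (h : IsLarge f d R)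
    (hS : Disjoint (singularValues f) (escapingSet f)) (hδ : IsPotRay f d R s b δ)
    (hz : z ∈ escapingSet f) (hlim : Tendsto δ (𝓝[>] b) (𝓝 (f z))) :
    ∃ s' a γ, IsPotRay f d R s' a γ ∧ Tendsto γ (𝓝[>] a) (𝓝 z) := by
  have hd := h.one_le
  have hb0 := hδ.nonneg
  set a := Finv d b with ha
  have hFa : F d a = b := F_Finv hd (by linarith)
  have ha0 : 0 ≤ a := by rwa [← (F_strictMono hd).le_iff_le, hFa, F_zero]
  -- continue the ray by the constant `f z` for `u ≤ b`
  set δ' : ℝ → ℂ := fun u => if b < u then δ u else f z with hδ'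
  have hδ1 : ∀ u, b < u → δ' u = δ u := fun u hu => by simp [hδ', hu]
  have hδ2 : ∀ u, u ≤ b → δ' u = f z := fun u hu => by simp [hδ', not_lt.2 hu]
  have hcont : Continuous δ' := by
    rw [continuous_iff_continuousAt]
    intro u
    rcases lt_trichotomy u b with hu | rfl | hu
    · refine (continuousAt_const (y := f z)).congr ?_
      filter_upwards [Iio_mem_nhds hu] with v hv
      exact (hδ2 v (le_of_lt hv)).symm
    · rw [continuousAt_iff_continuous_left'_right']
      have e : δ' u = f z := hδ2 u le_rfl
      constructor
      · rw [ContinuousWithinAt, e]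
        refine tendsto_const_nhds.congr' ?_
        filter_upwards [self_mem_nhdsWithin] with v hv
        exact (hδ2 v (le_of_lt hv)).symm
      · rw [ContinuousWithinAt, e]
        refine hlim.congr' ?_
        filter_upwards [self_mem_nhdsWithin] with v hv
        exact (hδ1 v hv).symm
    · refine (hδ.continuousOn.continuousAt (Ioi_mem_nhds hu)).congr ?_
      filter_upwards [Ioi_mem_nhds hu] with v hv
      exact (hδ1 v hv).symm
  have hav : ∀ u, δ' u ∉ singularValues f := by
    intro u hu
    rcases lt_or_ge b u with hbu | hbu
    · rw [hδ1 u hbu] at hu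
      exact disjoint_left.1 hS hu (hδ.mem_escapingSet h hbu)
    · rw [hδ2 u hbu] at hu
      exact disjoint_left.1 hS hu (map_mem_escapingSet hz)
  obtain ⟨η, h1, h2, h3⟩ := exists_lift_Ioi hf (δ := fun u => δ' (F d u)) (z := z) (b := a - 1)
    (u₀ := a) (hcont.comp (continuous_F d)).continuousOn (fun u _ => hav _) (by linarith)
    (hδ2 _ hFa.le).symm
  obtain ⟨s', -, hη⟩ := (hFa.symm ▸ hδ : IsPotRay f d R s (F d a) δ).of_map hf h ha0
    (h1.mono (Ioi_subset_Ioi (by linarith))) fun t ht => by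
      rw [h3 t (by linarith), hδ1 _ (hFa ▸ F_strictMono hd ht)]
  refine ⟨s', a, η, hη, ?_⟩
  have h4 := (h1.continuousAt (Ioi_mem_nhds (show a - 1 < a by linarith))).tendsto
  rw [h2] at h4
  exact h4.mono_left nhdsWithin_le_nhds

/-- An iterate of `z` is the limit of a ray by `tailSet.exists_isPotRay`, and this ray is lifted. -/
lemma escapingSet.exists_isPotRay (hf : f ∈ Family d) (h : IsLarge f d R)
    (hS : Disjoint (singularValues f) (escapingSet f)) (hz : z ∈ escapingSet f) :
    ∃ s a γ, IsPotRay f d R s a γ ∧ Tendsto γ (𝓝[>] a) (𝓝 z) := by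
  obtain ⟨N, s, hN⟩ := escapingSet.exists_mem_tailSet hf (h.mono (by linarith : R ≤ R + 2 + 2)) hz
  induction N generalizing z s with
  | zero => exact ⟨s, tailSet.exists_isPotRay h hN⟩
  | succ N ih =>
    rw [Function.iterate_succ_apply] at hN
    obtain ⟨s', b, δ, hδ, hlim⟩ := ih (map_mem_escapingSet hz) s hN
    exact hδ.exists_lift_of_tendsto hf h hS hz hlim

theorem escapingSet_eq (hf : f ∈ Family d) (h : IsLarge f d R)
    (hS : Disjoint (singularValues f) (escapingSet f)) :
    escapingSet f = onRays f ∪ escapingEndpoints f := by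
  apply Subset.antisymm
  · intro z hz
    obtain ⟨s, a, γ, hγ, hlim⟩ := escapingSet.exists_isPotRay hf h hS hz
    obtain ⟨b, δ, hba, -, heq, hδ⟩ := hγ.exists_isDynamicRay hf h
    have hlim' : Tendsto δ (𝓝[>] a) (𝓝 z) := by
      refine hlim.congr' ?_
      filter_upwards [self_mem_nhdsWithin] with u hu
      exact (heq hu).symm
    rcases hba.eq_or_lt with rfl | hba
    · refine Or.inr ⟨hz, _, hδ, ?_⟩
      refine hlim'.comp (tendsto_nhdsWithin_iff.2 ⟨?_, ?_⟩)
      · have : ContinuousAt (fun t : ℝ => b + t) 0 := by fun_prop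
        have h1 := this.tendsto
        rw [add_zero] at h1
        exact h1.mono_left nhdsWithin_le_nhds
      · filter_upwards [self_mem_nhdsWithin] with t ht
        exact lt_add_of_pos_right b ht
    · refine Or.inl ⟨_, hδ, a - b, sub_pos.2 hba, ?_⟩
      have hc : ContinuousAt (fun t => δ (b + t)) (a - b) :=
        (hδ.isRayCurve.rayTail ((a - b) / 2) (by linarith)).continuousOn.continuousAt
          (Ici_mem_nhds (by linarith))
      have h1 : Tendsto (fun u => δ (b + (u - b))) (𝓝[>] a) (𝓝 (δ (b + (a - b)))) := by
        have h2 : ContinuousAt (fun u : ℝ => u - b) a := by fun_prop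
        exact (hc.tendsto.comp h2.tendsto).mono_left nhdsWithin_le_nhds
      simp only [add_sub_cancel] at h1 ⊢
      exact tendsto_nhds_unique h1 hlim'
  · rintro z (⟨γ, hγ, t, ht, rfl⟩ | hz)
    · exact hγ.isRayCurve.mapsTo ht
    · exact hz.1

/-! ### Different rays are disjoint -/

lemma IsMaxPotRay.unique_of_eq (h : IsLarge f d R)
    (hS : Disjoint (singularValues f) (escapingSet f)) (hγ : IsMaxPotRay f d R s a γ)
    (hδ : IsMaxPotRay f d R s' b δ) {t u : ℝ} (ht : a < t) (hu : b < u) (he : γ t = δ u) :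
    s = s' ∧ a = b ∧ EqOn δ γ (Ioi a) := by
  have hav : ∀ t, a < t → ∀ i, f^[i + 1] (γ t) ∉ singularValues f := fun t ht i hi =>
    disjoint_left.1 hS hi (iterate_mem_escapingSet (hγ.toIsPotRay.mem_escapingSet h ht) _)
  have htu : t = u := by
    have h1 := hγ.pot t ht
    rw [he] at h1
    exact h1.unique h.one_le (hδ.pot u hu)
  subst htu
  have h1 := (hγ.toIsPotRay.mono (le_max_left a b)).eqOn_of_eq h
    (hδ.toIsPotRay.mono (le_max_right a b)) (max_lt ht hu) he
    fun t ht => hav t ((le_max_left a b).trans_lt ht)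
  obtain rfl := hγ.toIsPotRay.address_eq h hδ.toIsPotRay ⟨_, h1⟩
  exact ⟨rfl, hγ.unique h hδ hav⟩

lemma SameCurve.image_eq (h : SameCurve γ a δ b) : γ '' Ioi a = δ '' Ioi b := by
  obtain ⟨p, -, -, h3, h4⟩ := h
  rw [← h3, image_image]
  exact image_congr h4

theorem trace_eq_or_disjoint (hf : f ∈ Family d) (h : IsLarge f d R)
    (hS : Disjoint (singularValues f) (escapingSet f)) (hγ : IsDynamicRay f γ)
    (hδ : IsDynamicRay f δ) : trace γ = trace δ ∨ Disjoint (trace γ) (trace δ) := by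
  obtain ⟨s, a, γ', hγ', h1⟩ := hγ.exists_isMaxPotRay hf h
  obtain ⟨s', b, δ', hδ', h2⟩ := hδ.exists_isMaxPotRay hf h
  rw [trace, trace, h1.image_eq, h2.image_eq]
  by_cases hdis : Disjoint (γ' '' Ioi a) (δ' '' Ioi b)
  · exact Or.inr hdis
  obtain ⟨_, ⟨t, ht, rfl⟩, u, hu, he⟩ := not_disjoint_iff.1 hdis
  obtain ⟨-, rfl, heq⟩ := hγ'.unique_of_eq h hS hδ' ht hu he.symm
  exact Or.inl (image_congr heq).symm

/-! ### A curve between two barriers -/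

lemma mem_Ioo_of_continuous {φ : ℝ → ℝ} (hφ : Continuous φ) {x₀ x₁ p q : ℝ} (hx : x₀ ≤ x₁)
    (hp : ∀ x ∈ Icc x₀ x₁, φ x ≠ p) (hq : ∀ x ∈ Icc x₀ x₁, φ x ≠ q) :
    φ x₀ ∈ Ioo p q ↔ φ x₁ ∈ Ioo p q := by
  have hpre : (φ '' Icc x₀ x₁).OrdConnected :=
    (isPreconnected_Icc.image φ hφ.continuousOn).ordConnected
  have h0 : φ x₀ ∈ φ '' Icc x₀ x₁ := mem_image_of_mem φ (left_mem_Icc.2 hx)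
  have h1 : φ x₁ ∈ φ '' Icc x₀ x₁ := mem_image_of_mem φ (right_mem_Icc.2 hx)
  have key : ∀ c, (∀ x ∈ Icc x₀ x₁, φ x ≠ c) → (c < φ x₀ ↔ c < φ x₁) := by
    intro c hc
    constructor
    · intro h
      by_contra! h'
      obtain ⟨x, hx, he⟩ := hpre.out h1 h0 ⟨h', h.le⟩
      exact hc x hx he
    · intro h
      by_contra! h'
      obtain ⟨x, hx, he⟩ := hpre.out h0 h1 ⟨h', h.le⟩
      exact hc x hx he
  have hq' : ∀ x ∈ Icc x₀ x₁, (φ x < q ↔ ¬ q < φ x) := fun x hx =>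
    ⟨fun h => not_lt.2 h.le, fun h => lt_of_le_of_ne (not_lt.1 h) (hq x hx)⟩
  simp only [mem_Ioo, hq' _ (left_mem_Icc.2 hx), hq' _ (right_mem_Icc.2 hx), key p hp, key q hq]

/-- Two-dimensional intermediate value theorem (Poincaré–Miranda): a continuous map of a rectangle
whose boundary values wind once around the origin has a zero. Otherwise it would have a continuous
logarithm. -/
theorem exists_zero_of_rectangle {H : ℝ × ℝ → ℂ} (hH : Continuous H) {t₀ t₁ u₀ u₁ : ℝ}
    (ht : t₀ ≤ t₁) (hu : u₀ ≤ u₁) (h1 : ∀ t ∈ Icc t₀ t₁, 0 < (H (t, u₀)).re)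
    (h2 : ∀ t ∈ Icc t₀ t₁, (H (t, u₁)).re < 0) (h3 : ∀ u ∈ Icc u₀ u₁, (H (t₀, u)).im < 0)
    (h4 : ∀ u ∈ Icc u₀ u₁, 0 < (H (t₁, u)).im) : ∃ x, H x = 0 := by
  by_contra! hne
  obtain ⟨L, ⟨hL1, hL2⟩, -⟩ := Complex.isCoveringMapOn_exp.existsUnique_continuousMap_lifts
    (⟨H, hH⟩ : C(ℝ × ℝ, ℂ)) (a₀ := (t₀, u₀)) (e₀ := Complex.log (H (t₀, u₀)))
    (Complex.exp_log (hne _)) (fun x => hne x)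
  have hexp : ∀ x, Complex.exp (L x) = H x := fun x => congrFun hL2 x
  set θ : ℝ → ℝ → ℝ := fun t u => (L (t, u)).im with hθ
  have hc1 : ∀ u, Continuous fun t => θ t u := fun u =>
    Complex.continuous_im.comp (L.continuous.comp (by fun_prop))
  have hc2 : ∀ t, Continuous fun u => θ t u := fun t =>
    Complex.continuous_im.comp (L.continuous.comp (by fun_prop))
  have hre : ∀ t u, (H (t, u)).re = Real.exp (L (t, u)).re * Real.cos (θ t u) := fun t u => by
    rw [← hexp, Complex.exp_re]
  have him : ∀ t u, (H (t, u)).im = Real.exp (L (t, u)).re * Real.sin (θ t u) := fun t u => by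
    rw [← hexp, Complex.exp_im]
  have k1 : ∀ t ∈ Icc t₀ t₁, 0 < Real.cos (θ t u₀) := fun t ht =>
    pos_of_mul_pos_right (hre t u₀ ▸ h1 t ht) (Real.exp_pos _).le
  have k2 : ∀ t ∈ Icc t₀ t₁, Real.cos (θ t u₁) < 0 := fun t ht =>
    neg_of_mul_neg_right (hre t u₁ ▸ h2 t ht) (Real.exp_pos _).le
  have k3 : ∀ u ∈ Icc u₀ u₁, Real.sin (θ t₀ u) < 0 := fun u hu =>
    neg_of_mul_neg_right (him t₀ u ▸ h3 u hu) (Real.exp_pos _).le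
  have k4 : ∀ u ∈ Icc u₀ u₁, 0 < Real.sin (θ t₁ u) := fun u hu =>
    pos_of_mul_pos_right (him t₁ u ▸ h4 u hu) (Real.exp_pos _).le
  have hpi := Real.pi_pos
  have ht0 : t₀ ∈ Icc t₀ t₁ := left_mem_Icc.2 ht
  have ht1 : t₁ ∈ Icc t₀ t₁ := right_mem_Icc.2 ht
  have hu0 : u₀ ∈ Icc u₀ u₁ := left_mem_Icc.2 hu
  have hu1 : u₁ ∈ Icc u₀ u₁ := right_mem_Icc.2 hu
  have hne1 : ∀ {φ : ℝ → ℝ} {I : Set ℝ} {c : ℝ}, Real.cos c = 0 →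
      (∀ x ∈ I, Real.cos (φ x) ≠ 0) → ∀ x ∈ I, φ x ≠ c := fun hc hφ x hx e => hφ x hx (e ▸ hc)
  have hne2 : ∀ {φ : ℝ → ℝ} {I : Set ℝ} {c : ℝ}, Real.sin c = 0 →
      (∀ x ∈ I, Real.sin (φ x) ≠ 0) → ∀ x ∈ I, φ x ≠ c := fun hc hφ x hx e => hφ x hx (e ▸ hc)
  have c1 : Real.cos (-(Real.pi / 2)) = 0 := by rw [Real.cos_neg, Real.cos_pi_div_two]
  have c3 : Real.cos (3 * Real.pi / 2) = 0 := by
    rw [show 3 * Real.pi / 2 = Real.pi / 2 + Real.pi by ring, Real.cos_add_pi,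
      Real.cos_pi_div_two, neg_zero]
  have e0 : θ t₀ u₀ = Complex.arg (H (t₀, u₀)) := by
    simp only [hθ, hL1, Complex.log_im]
  -- follow the argument of `H` around the boundary of the rectangle
  have a0 : θ t₀ u₀ < 0 := by rw [e0, Complex.arg_neg_iff]; exact h3 u₀ hu0
  have a0' : θ t₀ u₀ ∈ Ioo (-(Real.pi / 2)) (Real.pi / 2) := by
    rw [e0]
    exact abs_lt.1 (Complex.abs_arg_lt_pi_div_two_iff.2 (Or.inl (h1 t₀ ht0)))
  have a1 := (mem_Ioo_of_continuous (hc1 u₀) ht (hne1 c1 fun t ht => (k1 t ht).ne')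
    (hne1 Real.cos_pi_div_two fun t ht => (k1 t ht).ne')).1 a0'
  have a1' : 0 < θ t₁ u₀ := by
    by_contra! hle
    exact absurd (Real.sin_nonpos_of_nonpos_of_neg_pi_le hle (by linarith [a1.1]))
      (not_le.2 (k4 u₀ hu0))
  have a2 := (mem_Ioo_of_continuous (hc2 t₁) hu (hne2 Real.sin_zero fun u hu => (k4 u hu).ne')
    (hne2 Real.sin_pi fun u hu => (k4 u hu).ne')).1 ⟨a1', by linarith [a1.2]⟩
  have a2' : Real.pi / 2 < θ t₁ u₁ := by
    by_contra! hle
    exact absurd (Real.cos_nonneg_of_neg_pi_div_two_le_of_le (by linarith [a2.1]) hle)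
      (not_le.2 (k2 t₁ ht1))
  have a3 := (mem_Ioo_of_continuous (hc1 u₁) ht
    (hne1 Real.cos_pi_div_two fun t ht => (k2 t ht).ne)
    (hne1 c3 fun t ht => (k2 t ht).ne)).2 ⟨a2', by linarith [a2.2]⟩
  have a3' : Real.pi < θ t₀ u₁ := by
    by_contra! hle
    exact absurd (Real.sin_nonneg_of_nonneg_of_le_pi (by linarith [a3.1]) hle)
      (not_le.2 (k3 u₁ hu1))
  have a4 := (mem_Ioo_of_continuous (hc2 t₀) hu (hne2 Real.sin_pi fun u hu => (k3 u hu).ne)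
    (hne2 Real.sin_two_pi fun u hu => (k3 u hu).ne)).2 ⟨a3', by linarith [a3.2]⟩
  linarith [a4.1]

/-- A curve that moves from below to above a nearly horizontal curve, without passing on its
left, meets it. -/
lemma exists_eq_of_crossing {g β : ℝ → ℂ} {t₀ t₁ U y : ℝ} (ht : t₀ ≤ t₁)
    (hg : ContinuousOn g (Icc t₀ t₁)) (hβ : ContinuousOn β (Ici U))
    (hβy : ∀ u, U ≤ u → |(β u).re - u| ≤ 1 ∧ |(β u).im - y| ≤ 1)
    (hre : ∀ t ∈ Icc t₀ t₁, U + 1 < (g t).re) (h0 : (g t₀).im < y - 1) (h1 : y + 1 < (g t₁).im) :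
    ∃ t ∈ Icc t₀ t₁, ∃ u, U ≤ u ∧ g t = β u := by
  obtain ⟨B, hB⟩ := (isCompact_Icc.image_of_continuousOn
    (Complex.continuous_re.comp_continuousOn hg)).bddAbove
  have hB' : ∀ t ∈ Icc t₀ t₁, (g t).re ≤ B := fun t ht => hB (mem_image_of_mem _ ht)
  set V := max U (B + 2) with hV
  have hUV : U ≤ V := le_max_left _ _
  have hBV : B + 2 ≤ V := le_max_right _ _
  set g' : ℝ → ℂ := IccExtend ht ((Icc t₀ t₁).domRestrict g) with hg'
  set β' : ℝ → ℂ := IccExtend hUV ((Icc U V).domRestrict β) with hβ'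
  have eg : ∀ t ∈ Icc t₀ t₁, g' t = g t := fun t h => IccExtend_of_mem ht _ h
  have eβ : ∀ u ∈ Icc U V, β' u = β u := fun t h => IccExtend_of_mem hUV _ h
  have cg : Continuous g' := hg.domRestrict.Icc_extend'
  have cβ : Continuous β' := (hβ.mono Icc_subset_Ici_self).domRestrict.Icc_extend'
  obtain ⟨⟨x, v⟩, hx⟩ := exists_zero_of_rectangle (H := fun x => g' x.1 - β' x.2) (by fun_prop) ht
    hUV (fun t ht => by
      rw [eg t ht, eβ _ (left_mem_Icc.2 hUV), Complex.sub_re]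
      linarith [hre t ht, (abs_le.1 (hβy U le_rfl).1).2])
    (fun t ht => by
      rw [eg t ht, eβ _ (right_mem_Icc.2 hUV), Complex.sub_re]
      linarith [hB' t ht, (abs_le.1 (hβy V hUV).1).1])
    (fun u hu => by
      rw [eg _ (left_mem_Icc.2 ht), eβ _ hu, Complex.sub_im]
      linarith [(abs_le.1 (hβy u hu.1).2).1])
    (fun u hu => by
      rw [eg _ (right_mem_Icc.2 ht), eβ _ hu, Complex.sub_im]
      linarith [(abs_le.1 (hβy u hu.1).2).2])
  refine ⟨projIcc t₀ t₁ ht x, (projIcc t₀ t₁ ht x).2, projIcc U V hUV v,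
    (projIcc U V hUV v).2.1, sub_eq_zero.1 hx⟩

/-- A curve that stays away from the origin and starts between two nearly horizontal curves
that it does not meet remains between them. -/
theorem between_barriers {g β : ℝ → ℂ} {t₀ t₁ U y X : ℝ} (ht : t₀ ≤ t₁)
    (hg : ContinuousOn g (Icc t₀ t₁)) (hβ : ContinuousOn β (Ici U))
    (hβy : ∀ u, U ≤ u → |(β u).re - u| ≤ 1 ∧ |(β u).im - y| ≤ 1)
    (hX : 0 < X) (hUX : U + 1 < X)
    (hfar : ∀ t ∈ Icc t₀ t₁, |(g t).im - y| ≤ 2 * Real.pi + 2 → X ≤ |(g t).re|)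
    (h0re : 0 < (g t₀).re) (h0im : |(g t₀).im - y| ≤ 2)
    (hne : ∀ t ∈ Icc t₀ t₁, ∀ u, U ≤ u → g t ≠ β u + 2 * Real.pi * Complex.I ∧
      g t ≠ β u - 2 * Real.pi * Complex.I) :
    X ≤ (g t₁).re ∧ |(g t₁).im - y| ≤ 2 * Real.pi + 1 := by
  have hpi := Real.pi_gt_three
  have him : ContinuousOn (fun t => |(g t).im - y|) (Icc t₀ t₁) :=
    ((Complex.continuous_im.comp_continuousOn hg).sub continuousOn_const).abs
  have hre : ContinuousOn (fun t => (g t).re) (Icc t₀ t₁) :=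
    Complex.continuous_re.comp_continuousOn hg
  -- as long as the curve is between the barriers it remains in the right half-plane
  have hpos : ∀ c ∈ Icc t₀ t₁, (∀ t ∈ Icc t₀ c, |(g t).im - y| ≤ 2 * Real.pi + 2) →
      X ≤ (g c).re := by
    intro c hc hle
    have h1 := hfar c hc (hle c (right_mem_Icc.2 hc.1))
    rcases le_or_gt 0 (g c).re with h2 | h2
    · rwa [abs_of_nonneg h2] at h1
    · obtain ⟨t, ht, hte⟩ := intermediate_value_Icc' hc.1
        (hre.mono (Icc_subset_Icc_right hc.2)) ⟨h2.le, h0re.le⟩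
      have h3 := hfar t ⟨ht.1, ht.2.trans hc.2⟩ (hle t ht)
      simp only at hte
      rw [hte, abs_zero] at h3
      linarith
  have hmain : ∀ t ∈ Icc t₀ t₁, |(g t).im - y| ≤ 2 * Real.pi + 1 := by
    by_contra! hcon
    obtain ⟨t, ht, hlt⟩ := hcon
    obtain ⟨c, hc1, hc2⟩ := exists_between (lt_min hlt (show 2 * Real.pi + 1 < 2 * Real.pi + 2
      by linarith))
    have hct : c < |(g t).im - y| := hc2.trans_le (min_le_left _ _)
    have hc2' : c < 2 * Real.pi + 2 := hc2.trans_le (min_le_right _ _)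
    -- the first time at which the curve has distance `c` from the line of symmetry
    set E := Icc t₀ t ∩ (fun t => |(g t).im - y|) ⁻¹' {c} with hE
    have hsub : Icc t₀ t ⊆ Icc t₀ t₁ := Icc_subset_Icc_right ht.2
    have hEc : IsCompact E := isCompact_Icc.of_isClosed_subset
      ((him.mono hsub).preimage_isClosed_of_isClosed isClosed_Icc isClosed_singleton)
      inter_subset_left
    have hEne : E.Nonempty := by
      obtain ⟨x, hx, hxe⟩ := intermediate_value_Icc ht.1 (him.mono hsub)
        ⟨h0im.trans (by linarith), hct.le⟩
      exact ⟨x, hx, hxe⟩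
    have hτ := hEc.sInf_mem hEne
    set τ := sInf E with hτdef
    have hτI : τ ∈ Icc t₀ t₁ := hsub hτ.1
    have hτc : |(g τ).im - y| = c := hτ.2
    have hτle : ∀ x ∈ Icc t₀ τ, |(g x).im - y| ≤ c := by
      intro x hx
      by_contra! hlt
      obtain ⟨x', hx', hxe'⟩ := intermediate_value_Icc hx.1
        (him.mono (Icc_subset_Icc_right (hx.2.trans hτI.2))) ⟨h0im.trans (by linarith), hlt.le⟩
      have h1 : τ ≤ x' := csInf_le hEc.bddBelow ⟨⟨hx'.1, hx'.2.trans (hx.2.trans hτ.1.2)⟩, hxe'⟩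
      have h2 : x = τ := le_antisymm hx.2 (h1.trans hx'.2)
      rw [h2] at hlt
      linarith
    have hre' : ∀ x ∈ Icc t₀ τ, U + 1 < (g x).re := fun x hx =>
      hUX.trans_le (hpos x ⟨hx.1, hx.2.trans hτI.2⟩ fun x' hx' =>
        (hτle x' ⟨hx'.1, hx'.2.trans hx.2⟩).trans hc2'.le)
    have hsub' : Icc t₀ τ ⊆ Icc t₀ t₁ := Icc_subset_Icc_right hτI.2
    have h0 := abs_le.1 h0im
    rcases abs_choice ((g τ).im - y) with h1 | h1
    · obtain ⟨x, hx, u, hu, he⟩ := exists_eq_of_crossing (β := fun u => β u + 2 * Real.pi * Complex.I)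
        (y := y + 2 * Real.pi) hτ.1.1 (hg.mono hsub') (by fun_prop) (fun u hu => by
          simpa [add_sub_add_right_eq_sub] using hβy u hu) hre' (by linarith) (by linarith)
      exact (hne x (hsub' hx) u hu).1 he
    · obtain ⟨x, hx, u, hu, he⟩ := exists_eq_of_crossing
        (g := fun t => (starRingEnd ℂ) (g t))
        (β := fun u => (starRingEnd ℂ) (β u - 2 * Real.pi * Complex.I))
        (y := -(y - 2 * Real.pi)) hτ.1.1
        (Complex.continuous_conj.comp_continuousOn (hg.mono hsub'))
        (Complex.continuous_conj.comp_continuousOn (by fun_prop)) (fun u hu => by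
          have h2 := hβy u hu
          refine ⟨by simpa using h2.1, ?_⟩
          have e : ((starRingEnd ℂ) (β u - 2 * Real.pi * Complex.I)).im - -(y - 2 * Real.pi) =
              -((β u).im - y) := by
            simp; ring
          rw [e, abs_neg]
          exact (hβy u hu).2) (fun x hx => by simpa using hre' x hx)
        (by rw [Complex.conj_im]; linarith) (by rw [Complex.conj_im]; linarith)
      exact (hne x (hsub' hx) u hu).2 ((starRingEnd ℂ).injective he)
  exact ⟨hpos t₁ (right_mem_Icc.2 ht) fun t ht => (hmain t ht).trans (by linarith),
    hmain t₁ (right_mem_Icc.2 ht)⟩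

/-! ### No ray lands on a ray -/

/-- Eventually the images of a ray do not meet the vertical translates by `±2πi` of the images
of another (or the same) ray. -/
lemma IsPotRay.exists_not_crossing (hf : f ∈ Family d) (h : IsLarge f d R)
    (hS : Disjoint (singularValues f) (escapingSet f)) (hγ : IsPotRay f d R s a γ)
    (hδ : IsPotRay f d R s' b δ) :
    ∃ m₀, ∀ m, m₀ ≤ m → ∀ t, a < t → ∀ v, b < v →
      f^[m] (γ t) ≠ f^[m] (δ v) + 2 * Real.pi * Complex.I ∧
      f^[m] (γ t) ≠ f^[m] (δ v) - 2 * Real.pi * Complex.I := by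
  have hd := h.one_le
  have hpot : ∀ m t v, a < t → b < v → f^[m] (γ t) = f^[m] (δ v) → t = v := by
    intro m t v ht hv he
    have h1 := (hγ.pot t ht).iterate hd m
    rw [he] at h1
    exact (F_iterate_strictMono hd m).injective (h1.unique hd ((hδ.pot v hv).iterate hd m))
  have hsucc : ∀ m t v, (f^[m] (γ t) = f^[m] (δ v) + 2 * Real.pi * Complex.I ∨
      f^[m] (γ t) = f^[m] (δ v) - 2 * Real.pi * Complex.I) →
      f^[m + 1] (γ t) = f^[m + 1] (δ v) := by
    rintro m t v (he | he)
    · rw [Function.iterate_succ_apply', he, Family.periodic hf, ← Function.iterate_succ_apply' f]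
    · rw [Function.iterate_succ_apply', he, ← Family.periodic hf, sub_add_cancel,
        ← Function.iterate_succ_apply' f]
  have hI : (2 * Real.pi * Complex.I : ℂ) ≠ 0 := Complex.two_pi_I_ne_zero
  by_cases hmeet : ∃ k t v, a < t ∧ b < v ∧ f^[k] (γ t) = f^[k] (δ v)
  · -- the images coincide, and a ray does not meet its own translates
    obtain ⟨k, t₀, v₀, ht₀, hv₀, he⟩ := hmeet
    obtain rfl := hpot k t₀ v₀ ht₀ hv₀ he
    obtain ⟨Γ, hΓ, hΓe⟩ := hγ.exists_iterate h k
    obtain ⟨Δ, hΔ, hΔe⟩ := hδ.exists_iterate h k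
    have hmono := (F_iterate_strictMono hd k)
    have heq := (hΓ.mono (hmono.monotone (le_max_left a b))).eqOn_of_eq h
      (hΔ.mono (hmono.monotone (le_max_right a b))) (hmono (max_lt ht₀ hv₀))
      (by rw [hΓe _ ht₀, hΔe _ hv₀, he]) fun t ht i hi =>
        disjoint_left.1 hS hi (iterate_mem_escapingSet (hΓ.mem_escapingSet h
          ((hmono.monotone (le_max_left a b)).trans_lt ht)) _)
    refine ⟨k, fun m hm t ht v hv => ?_⟩
    have key : f^[m + 1] (γ t) = f^[m + 1] (δ v) → f^[m] (γ t) = f^[m] (δ v) := by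
      intro h1
      obtain rfl := hpot _ _ _ ht hv h1
      have h2 := heq (hmono (max_lt ht hv))
      rw [hΓe _ ht, hΔe _ hv] at h2
      obtain ⟨j, rfl⟩ := Nat.exists_eq_add_of_le hm
      rw [add_comm k j, Function.iterate_add_apply, h2, ← Function.iterate_add_apply]
    constructor
    · intro h1
      rw [key (hsucc m t v (Or.inl h1))] at h1
      exact hI (left_eq_add.1 h1)
    · intro h1
      rw [key (hsucc m t v (Or.inr h1))] at h1
      exact hI (by linear_combination h1)
  · push Not at hmeet
    exact ⟨0, fun m _ t ht v hv => ⟨fun h1 => hmeet (m + 1) t v ht hv (hsucc m t v (Or.inl h1)),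
      fun h1 => hmeet (m + 1) t v ht hv (hsucc m t v (Or.inr h1))⟩⟩

/-- The images of the end `(t, ∞)` of a ray are eventually close to horizontal half-lines. -/
lemma IsPotRay.eventually_norm_sub_stripPoint_le (h : IsLarge f d R) (hs : ExpBounded d s)
    (ha : a = minPotential d s) {Γ : ℕ → ℝ → ℂ}
    (hΓ : ∀ n, IsPotRay f d R (shift n s) ((F d)^[n] a) (Γ n))
    (hS : ∀ n u, (F d)^[n] a < u → ∀ i, f^[i + 1] (Γ n u) ∉ singularValues f) {t : ℝ}
    (ht : a < t) :
    ∀ᶠ n in atTop, IsStd d (R + 2) (shift n s) ((F d)^[n] t) ∧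
      ∀ u, (F d)^[n] t < u → ‖Γ n u - stripPoint d (s n) u‖ ≤ 1 := by
  have hd := h.one_le
  filter_upwards [eventually_isStd_shift hd (R + 2) (mem_boundSet_of_lt hd hs (ha ▸ ht))]
    with n hn
  refine ⟨hn _ le_rfl, fun u hu => ?_⟩
  obtain ⟨σ, hσ, hσ'⟩ := (hn _ le_rfl).exists_isPotRay h
  have hau := F_iterate_strictMono hd n ht
  have heq : Γ n u = σ u := ((hΓ n).mono hau.le).eqOn_of_address h hσ
    (fun v hv => hS n v (hau.trans hv)) hu
  rw [heq]
  exact (hσ' u hu).2 0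

/-- If a ray lands on another ray, then its images are, from some time on, trapped between two
vertical translates of the images of the latter. -/
theorem IsPotRay.trapped (hf : f ∈ Family d) (h : IsLarge f d R)
    (hS : Disjoint (singularValues f) (escapingSet f)) (hγ : IsPotRay f d R s a γ)
    (hδ : IsPotRay f d R s' b δ) (hs' : ExpBounded d s') (hb : b = minPotential d s') {t₂ τ : ℝ}
    (hbt : b < t₂) (htτ : t₂ < τ) (hlim : Tendsto γ (𝓝[>] a) (𝓝 (δ τ))) :
    ∃ T, a < T ∧ ∀ᶠ m in atTop, ∀ t, a < t → t ≤ T → (F d)^[m] t₂ + 1 ≤ (f^[m] (γ t)).re ∧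
      |(f^[m] (γ t)).im - 2 * Real.pi * s' m / d| ≤ 2 * Real.pi + 1 := by
  have hd := h.one_le
  have hd' := h.cast_one_le
  have hfc := h.differentiable.continuous
  have hb0 := hδ.nonneg
  obtain ⟨t₁, hbt₁, ht₁₂⟩ := exists_between hbt
  obtain ⟨t₁', ht₁₁, ht₁₂'⟩ := exists_between ht₁₂
  choose Δ hΔ hΔe using fun n => hδ.exists_iterate h n
  have hΔS : ∀ n u, (F d)^[n] b < u → ∀ i, f^[i + 1] (Δ n u) ∉ singularValues f :=
    fun n u hu i hi => disjoint_left.1 hS hi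
      (iterate_mem_escapingSet ((hΔ n).mem_escapingSet h hu) _)
  obtain ⟨m₀, hm₀⟩ := hγ.exists_not_crossing hf h hS hδ
  obtain ⟨M, hM⟩ := eventually_atTop.1 ((IsPotRay.eventually_norm_sub_stripPoint_le h hs' hb hΔ hΔS
    hbt₁).and ((eventually_mul_F_iterate_add_le hd (hb0.trans_lt hbt) htτ 4).and
      (eventually_ge_atTop m₀)))
  have hmono := fun n => F_iterate_strictMono hd n
  have hbτ := hbt.trans htτ
  have ht₁τ := ht₁₂.trans htτ
  have hbar : ∀ m, M ≤ m → ∀ u, (F d)^[m] t₁ < u → |(Δ m u).re - u| ≤ 1 ∧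
      |(Δ m u).im - 2 * Real.pi * s' m / d| ≤ 1 := by
    intro m hm u hu
    have h1 := (hM m hm).1.2 u hu
    constructor
    · have h2 := (Complex.abs_re_le_norm _).trans h1
      rwa [Complex.sub_re, stripPoint_re] at h2
    · have h2 := (Complex.abs_im_le_norm _).trans h1
      rwa [Complex.sub_im, stripPoint_im] at h2
  -- close to the landing point the images are between the barriers
  have hstart : ∀ m, M ≤ m → ∀ᶠ t in 𝓝[>] a, (F d)^[m] t₂ + 1 ≤ (f^[m] (γ t)).re ∧
      |(f^[m] (γ t)).im - 2 * Real.pi * s' m / d| ≤ 2 := by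
    intro m hm
    have h1 := ((hfc.iterate m).tendsto (δ τ)).comp hlim
    obtain ⟨h2, h3⟩ := hbar m hm _ (hmono m ht₁τ)
    rw [hΔe m τ hbτ] at h2 h3
    have h4 := (hM m hm).2.1
    have h5 := F_iterate_nonneg hd m (hb0.trans hbt.le)
    filter_upwards [Metric.tendsto_nhds.1 h1 1 one_pos] with t ht
    rw [dist_eq_norm] at ht
    have h6 := abs_le.1 ((Complex.abs_re_le_norm _).trans ht.le)
    have h7 := abs_le.1 ((Complex.abs_im_le_norm _).trans ht.le)
    simp only [Complex.sub_re, Complex.sub_im, Function.comp] at h6 h7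
    have h8 := abs_le.1 h2
    have h9 := abs_le.1 h3
    refine ⟨by linarith [h6.1, h8.1], abs_le.2 ⟨by linarith [h7.1, h9.1], by linarith [h7.2, h9.2]⟩⟩
  obtain ⟨T, haT, hT⟩ := (mem_nhdsGT_iff_exists_Ioc_subset (a := a)).1 (hstart M le_rfl)
  refine ⟨T, haT, ?_⟩
  filter_upwards [eventually_ge_atTop M] with m hm
  induction m, hm using Nat.le_induction with
  | base =>
    intro t hat htT
    obtain ⟨h1, h2⟩ := hT ⟨hat, htT⟩
    exact ⟨h1, h2.trans (by linarith [Real.pi_gt_three])⟩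
  | succ m hm ih =>
    intro t hat htT
    have hm1 : M ≤ m + 1 := by omega
    obtain ⟨⟨hstd, -⟩, -, hm₀m⟩ := hM (m + 1) hm1
    obtain ⟨t₀, ⟨h0re, h0im⟩, hat₀, ht₀t⟩ :=
      ((hstart (m + 1) hm1).and (Ioc_mem_nhdsGT hat)).exists
    have hF₁ : 100 ≤ (F d)^[m + 1] t₁ := by
      linarith [hstd.big, Real.exp_pos (d * (R + 2 + 1)), h.big]
    have hF₂ := hmono (m + 1) ht₁₂
    have hF₁' := hmono (m + 1) ht₁₂'
    have hcone := hstd.cone 0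
    have hFR : R ≤ (F d)^[m] t₂ + 1 := by
      have h1 := (hM m hm).1.1.big
      linarith [hmono m ht₁₂, Real.exp_pos (d * (R + 2 + 1))]
    refine between_barriers (g := fun t => f^[m + 1] (γ t)) (β := Δ (m + 1))
      (U := (F d)^[m + 1] t₁') ht₀t ?_ ?_ ?_ (by linarith) (by linarith) ?_ (by linarith) h0im ?_
    · exact (hfc.iterate _).comp_continuousOn
        (hγ.continuousOn.mono fun x hx => hat₀.trans_le hx.1)
    · exact (hΔ _).continuousOn.mono (Ici_subset_Ioi.2 (hmono _ (hbt₁.trans ht₁₁)))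
    · exact fun u hu => hbar _ hm1 u ((hmono _ ht₁₁).trans_le hu)
    · intro x hx him
      -- the image is far away from the origin and close to the real axis
      have hx1 := (ih x (hat₀.trans_le hx.1) (hx.2.trans htT)).1
      have h1 := h.le_norm (hFR.trans hx1)
      rw [← Function.iterate_succ_apply' f] at h1
      have h2 : 15 / 8 * ((F d)^[m + 1] t₂ + 1) ≤
          Real.exp (d * ((f^[m] (γ x)).re - 1 / 8)) := by
        have h3 : (F d)^[m + 1] t₂ + 1 = Real.exp (d * (F d)^[m] t₂) := by
          rw [Function.iterate_succ_apply', F]; ring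
        rw [h3]
        calc 15 / 8 * Real.exp (d * (F d)^[m] t₂)
            ≤ Real.exp (d * (7 / 8)) * Real.exp (d * (F d)^[m] t₂) := by
              gcongr
              linarith [Real.add_one_le_exp (d * (7 / 8 : ℝ))]
          _ = Real.exp (d * ((F d)^[m] t₂ + 7 / 8)) := by rw [← Real.exp_add]; ring_nf
          _ ≤ _ := by gcongr; linarith
      have h4 : |(f^[m + 1] (γ x)).im| ≤ (F d)^[m + 1] t₁ / 10 + 10 := by
        have h5 : |2 * Real.pi * (s' (m + 1) : ℝ) / d| ≤ (F d)^[m + 1] t₁ / 10 := by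
          rw [abs_div, abs_mul, abs_of_pos (by positivity : 0 < 2 * Real.pi), Nat.abs_cast]
          simpa [shift] using hcone
        have h6 := abs_sub_abs_le_abs_sub (f^[m + 1] (γ x)).im (2 * Real.pi * s' (m + 1) / d)
        linarith [Real.pi_lt_four]
      have h7 := Complex.norm_le_abs_re_add_abs_im (f^[m + 1] (γ x))
      linarith
    · intro x hx u hu
      have hu' : (F d)^[m + 1] b < u := (hmono _ (hbt₁.trans ht₁₁)).trans_le hu
      obtain ⟨v, -, rfl⟩ := exists_F_iterate_eq hd (m + 1) ((hΔ (m + 1)).nonneg.trans hu'.le)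
      have hbv : b < v := (hmono _).lt_iff_lt.1 hu'
      rw [hΔe _ v hbv]
      exact hm₀ (m + 1) hm₀m x (hat₀.trans_le hx.1) v hbv

/-- The rays may be the same. -/
lemma IsMaxPotRay.not_tendsto (hf : f ∈ Family d) (h : IsLarge f d R)
    (hS : Disjoint (singularValues f) (escapingSet f)) (hγ : IsMaxPotRay f d R s a γ)
    (hδ : IsMaxPotRay f d R s' b δ) {τ : ℝ} (hbτ : b < τ) :
    ¬ Tendsto γ (𝓝[>] a) (𝓝 (δ τ)) := by
  intro hlim
  have hd := h.one_le
  have hd' := h.cast_one_le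
  have hpi := Real.pi_gt_three
  obtain ⟨hs, ha⟩ := hγ.eq_minPotential hf h hS
  obtain ⟨hs', hb⟩ := hδ.eq_minPotential hf h hS
  obtain ⟨t₂, hbt, htτ⟩ := exists_between hbτ
  obtain ⟨T, haT, hT⟩ := hγ.toIsPotRay.trapped hf h hS hδ.toIsPotRay hs' hb hbt htτ hlim
  -- the potential on the trapped part is at least `t₂`
  have h1 : t₂ ≤ a := by
    by_contra! hlt
    obtain ⟨t, hat, ht⟩ := exists_between (lt_min haT hlt)
    obtain ⟨c, htc, hct⟩ := exists_between (ht.trans_le (min_le_right _ _))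
    obtain ⟨m, hm1, hm2⟩ := (((hγ.pot t hat).le c htc).and hT).exists
    have h2 := (hm2 t hat (ht.le.trans (min_le_left _ _))).1
    have h3 := (le_abs_self _).trans (Complex.abs_re_le_norm (f^[m] (γ t)))
    have h4 := F_iterate_strictMono hd m hct
    linarith
  -- and the two addresses have bounded distance
  obtain ⟨N, hN⟩ := hγ.deep T haT
  obtain ⟨t₁, hbt₁, ht₁₂⟩ := exists_between hbt
  obtain ⟨u, hbu, hut₁⟩ := exists_between hbt₁
  have hu := mem_boundSet_of_lt hd hs' (hb ▸ hbu)
  have h2 : t₁ ∈ boundSet d s := by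
    refine mem_boundSet_of_eventually_le hd hu.1 hut₁ (K := 2 * d) ?_
    filter_upwards [hT, eventually_ge_atTop N, (Metric.tendsto_nhds.1 hu.2) 1 one_pos]
      with m hm hmN hmu
    have h3 := (hm T haT le_rfl).2
    obtain ⟨k, rfl⟩ := Nat.exists_eq_add_of_le hmN
    obtain ⟨h4, h5⟩ := hN T le_rfl k
    rw [← Function.iterate_add_apply, add_comm k] at h4 h5
    have h6 := h5.abs_im_le h h4
    have hsh : shift N s k = s (N + k) := rfl
    rw [hsh] at h6
    have hFu := F_iterate_pos hd (N + k) hu.1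
    rw [dist_zero_right, norm_div, Real.norm_of_nonneg hFu.le, div_lt_one hFu,
      Real.norm_eq_abs] at hmu
    have h7 : |2 * Real.pi * (s (N + k) : ℝ) / d - 2 * Real.pi * s' (N + k) / d| ≤
        2 * Real.pi + 3 := by
      rw [abs_le] at h3 h6 ⊢
      constructor <;> linarith [h3.1, h3.2, h6.1, h6.2]
    have h8 : |(s (N + k) : ℝ) - s' (N + k)| ≤ 2 * d := by
      have e : 2 * Real.pi * (s (N + k) : ℝ) / d - 2 * Real.pi * s' (N + k) / d =
          2 * Real.pi / d * (s (N + k) - s' (N + k)) := by ring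
      rw [e, abs_mul, abs_of_pos (by positivity : 0 < 2 * Real.pi / d), div_mul_eq_mul_div,
        div_le_iff₀ (by positivity)] at h7
      nlinarith [abs_nonneg ((s (N + k) : ℝ) - s' (N + k))]
    have h9 := abs_sub_abs_le_abs_sub (s (N + k) : ℝ) (s' (N + k))
    nlinarith
  have h3 := minPotential_le h2
  linarith

theorem disjoint_onRays_escapingEndpoints (hf : f ∈ Family d) (h : IsLarge f d R)
    (hS : Disjoint (singularValues f) (escapingSet f)) :
    Disjoint (onRays f) (escapingEndpoints f) := by
  rw [disjoint_left]
  rintro z ⟨δ, hδ, hz⟩ ⟨-, γ, hγ, hend⟩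
  obtain ⟨s, a, γ', hγ', h1⟩ := hγ.exists_isMaxPotRay hf h
  obtain ⟨s', b, δ', hδ', h2⟩ := hδ.exists_isMaxPotRay hf h
  rw [trace, h2.image_eq] at hz
  obtain ⟨τ, hτ, rfl⟩ := hz
  refine hγ'.not_tendsto hf h hS hδ' hτ ?_
  obtain ⟨k, k1, k2, k3, k4⟩ := h1.symm
  have hk : Tendsto k (𝓝[>] a) (𝓝[>] 0) := by
    refine tendsto_nhdsWithin_iff.2 ⟨?_, ?_⟩
    · rw [tendsto_order]
      constructor
      · intro c hc
        filter_upwards [self_mem_nhdsWithin] with u hu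
        have : k u ∈ Ioi 0 := k3 ▸ mem_image_of_mem k hu
        exact hc.trans this
      · intro c hc
        have hc' : c ∈ k '' Ioi a := k3.symm ▸ hc
        obtain ⟨v, hv, rfl⟩ := hc'
        filter_upwards [Ioo_mem_nhdsGT hv] with u hu
        exact k2 hu.1 hv hu.2
    · filter_upwards [self_mem_nhdsWithin] with u hu
      exact k3 ▸ mem_image_of_mem k hu
  refine (hend.comp hk).congr' ?_
  filter_upwards [self_mem_nhdsWithin] with u hu
  exact (k4 u hu).symm

end PolyExp

end

theorem theorem2 (d : ℕ) (hd : 1 ≤ d) (f : ℂ → ℂ) (hf : f ∈ PolyExp.Family d)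
    (r : ℝ) (hr : Disjoint (PolyExp.rightHalfPlane r) (PolyExp.singularValues f)) :
    -- every exponentially bounded address is realized
    (∀ s : ℕ → ℤ, PolyExp.ExpBounded d s →
      ∃ γ : ℝ → ℂ, PolyExp.IsDynamicRay f γ ∧ PolyExp.HasAddress f d r γ s) ∧
    -- uniqueness, parametrization and asymptotics
    (∀ s : ℕ → ℤ, PolyExp.ExpBounded d s →
      ∀ γ : ℝ → ℂ, PolyExp.IsDynamicRay f γ → PolyExp.HasAddress f d r γ s →
        PolyExp.IteratesAvoidSingularValues f γ →
        (∀ γ' : ℝ → ℂ, PolyExp.IsDynamicRay f γ' → PolyExp.HasAddress f d r γ' s →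
          PolyExp.SameCurve γ' 0 γ 0) ∧
        ∃ R : ℕ → ℝ → ℂ,
          -- `R n` parametrizes on `(t_{σ^n s}, ∞)` the unique dynamic ray with address `σ^n s`
          PolyExp.SameCurve γ 0 (R 0) (PolyExp.minPotential d s) ∧
          (∀ n : ℕ,
            (∃ δ : ℝ → ℂ, PolyExp.IsDynamicRay f δ ∧
              PolyExp.HasAddress f d r δ (PolyExp.shift n s)) ∧
            ∀ δ : ℝ → ℂ, PolyExp.IsDynamicRay f δ →
              PolyExp.HasAddress f d r δ (PolyExp.shift n s) →
              PolyExp.SameCurve δ 0 (R n) (PolyExp.minPotential d (PolyExp.shift n s))) ∧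
          -- the asymptotic formula
          ((fun t : ℝ => R 0 t - PolyExp.stripPoint d (s 0) t)
            =O[Filter.atTop] fun t : ℝ => Real.exp (-t / 2)) ∧
          -- the conjugation
          (∀ n : ℕ, ∀ t : ℝ, PolyExp.minPotential d s < t →
            f^[n] (R 0 t) = R n ((PolyExp.F d)^[n] t)) ∧
          -- the bounds are uniform in `n` on the images of every ray tail `R 0 ([t', ∞))`
          (∀ t' : ℝ, PolyExp.minPotential d s < t' → ∃ C : ℝ, ∀ n : ℕ, ∀ u : ℝ,
            (PolyExp.F d)^[n] t' ≤ u →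
              ‖R n u - PolyExp.stripPoint d (s n) u‖ ≤ C * Real.exp (-u / 2))) ∧
    -- the escaping set when no singular value escapes
    (Disjoint (PolyExp.singularValues f) (PolyExp.escapingSet f) →
      PolyExp.escapingSet f = PolyExp.onRays f ∪ PolyExp.escapingEndpoints f ∧
      Disjoint (PolyExp.onRays f) (PolyExp.escapingEndpoints f) ∧
      ∀ γ δ : ℝ → ℂ, PolyExp.IsDynamicRay f γ → PolyExp.IsDynamicRay f δ →
        PolyExp.trace γ = PolyExp.trace δ ∨ Disjoint (PolyExp.trace γ) (PolyExp.trace δ)) := by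
  obtain ⟨R₀, hR₀⟩ := PolyExp.exists_isLarge hd hf
  have h := hR₀ (max R₀ r) (le_max_left _ _)
  have hrR : r ≤ max R₀ r := le_max_right _ _
  refine ⟨fun s hs => PolyExp.exists_isDynamicRay_hasAddress hf h hrR hs,
    fun s hs γ hγ hγs hav => ?_, fun hS => ⟨PolyExp.escapingSet_eq hf h hS,
      PolyExp.disjoint_onRays_escapingEndpoints hf h hS,
      fun γ δ hγ hδ => PolyExp.trace_eq_or_disjoint hf h hS hγ hδ⟩⟩
  obtain ⟨Γ, h1, h2, h3, h4⟩ := PolyExp.unique_parametrization hf h hrR hr hs hγ hγs hav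
  refine ⟨fun γ' hγ' hγs' => ?_, Γ, h1, h2, ?_, h3, h4⟩
  · have h5 := (h2 0).2 γ' hγ' (by rwa [PolyExp.shift_zero])
    rw [PolyExp.shift_zero] at h5
    exact h5.trans h1.symm
  · obtain ⟨C, hC⟩ := h4 (PolyExp.minPotential d s + 1) (lt_add_one _)
    refine Asymptotics.IsBigO.of_bound C ?_
    filter_upwards [Filter.eventually_ge_atTop (PolyExp.minPotential d s + 1)] with t ht
    rw [Real.norm_of_nonneg (Real.exp_pos _).le]
    exact hC 0 t ht
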